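/- Let $\Sigma$ be a finite alphabet and $\mathcal D$ a countably infinite set of data values. Conditions over variables $x_1,\dots,x_m$ are Boolean combinations of $x_i^{=}$ and $x_i^{\neq}$; for a partial valuation $\nu$ of the variables, $d,\nu\models x_i^{=}$ iff $\nu(x_i)=d$, and $x_i^{\neq}$ is its negation. Regular expressions with binding (REWBs) are given by $r::=\varepsilon\mid a\mid a[c]\mid r+r\mid r\cdot r\mid r^*\mid a{\downarrow_x}(r)$ with $a\in\Sigma$, $c$ a condition and $x$ a variable. The language $L(r,\nu)\subseteq(\Sigma\times\mathcal D)^*$ is defined as usual for $\varepsilon,+,\cdot,{}^*$, with $L(a,\nu)=\{\binom ad\mid d\in\mathcal D\}$, $L(a[c],\nu)=\{\binom ad\mid d,\nu\models c\}$ and $L(a{\downarrow_x}(r),\nu)=\bigcup_{d}\{\binom ad\}\cdot L(r,\nu[x\to d])$. The size of an REWB is its number of symbols. The levels $E_i$, $F_i$ of nesting depth of iterated bindings are generated by $$F_0::=\varepsilon\mid a\mid a[c]\mid F_0+F_0\mid F_0\cdot F_0\mid F_0^*,$$ $$E_i::=F_{i-1}\mid E_i+E_i\mid E_i\cdot E_i\mid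 a{\downarrow_x}(E_i),\qquad F_i::=E_i\mid F_i+F_i\mid F_i\cdot F_i\mid F_i^*\qquad(i\ge 1).$$ A data graph is a finite set $V$ of nodes with a finite set of edges in $V\times\Sigma\times\mathcal D\times V$. An instance of *REWB query evaluation* consists of a data graph, an REWB $e$, a valuation $\nu$ defined on the free variables of $e$ and a pair $\langle u,v\rangle$ of nodes (the alphabet being part of the instance); the question is whether some path from $u$ to $v$ is labelled by a data word in $L(e,\nu)$. The parameter is the size of $e$. An instance of *weighted quantified satisfiability* consists of a Boolean formula $\phi$ over a set $\mathit{PR}$ of atoms, a partition $\mathit{PR}_1,\dots,\mathit{PR}_\ell$ of $\mathit{PR}$ into nonempty blocks and numbers $k_1,\dots,k_\ell\in\mathbb N$ (written in unary); the question is whether $\exists^{k_1}\mathit{PR}_1\,\forall^{k_2}\mathit{PR}_2\,\exists^{k_3}\mathit{PR}_3\cdots\phi$ is true, where $\exists^{k}\mathit{PR}_j$ (resp. $\forall^{k}\mathit{PR}_j$) quantifies over the assignments to $\mathit{PR}_j$ that set exactly $k$ atoms to true. The parameter is $\ell+k_1+\cdots+k_\ell$. An FPT reduction from a parameterized problem $Q$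 to a parameterized problem $Q'$ is a mapping $R$ from instances $(x,k)$ of $Q$ to instances $(x',k')=R(x,k)$ of $Q'$ such that $(x,k)\in Q$ iff $(x',k')\in Q'$; $k'\le g(k)$ for a computable $g:\mathbb N\to\mathbb N$; and $R$ is computable in time $f(k)\,(|x|+1)^{c}$ for a computable $f:\mathbb N\to\mathbb N$ and a constant $c$. $\mathrm{AW[SAT]}$ is the class of parameterized problems that are FPT-reducible to weighted quantified satisfiability. **Theorem.** REWB query evaluation, parameterized by the size of the query, is hard for $\mathrm{AW[SAT]}$ under FPT reductions: every problem in $\mathrm{AW[SAT]}$ is FPT-reducible to it. Moreover, there is a polynomial-time computable mapping that sends each instance of weighted quantified satisfiability to an instance of REWB query evaluation such that the former is a yes-instance iff the latter is, and such that the query produced has no free variables, belongs to the level $E_{1+k_2+k_4+\cdots}$ (the weight of each universal block is added to the nesting depth), and has a size that depends only on $k_1,\dots,k_\ell$. -/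

import Mathlib

open Turing

namespace REWBEval

/-! ## Regular expressions with binding and data graphs -/

/-- Conditions: Boolean combinations of `x^=` and `x^≠` over the set `X` of variables. -/
inductive Cond (X : Type) : Type
  | eq (x : X)
  | ne (x : X)
  | not (c : Cond X)
  | and (c₁ c₂ : Cond X)
  | or (c₁ c₂ : Cond X)

namespace Cond

/-- Satisfaction `d, ν ⊨ c`, where `ν` is a partial valuation. -/
def Sat {X D : Type} (d : D) (ν : X → Option D) : Cond X → Prop
  | eq x => ν x = some d
  | ne x => ν x ≠ some d
  | not c => ¬ c.Sat d ν
  | and c₁ c₂ => c₁.Sat d ν ∧ c₂.Sat d ν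
  | or c₁ c₂ => c₁.Sat d ν ∨ c₂.Sat d ν

/-- The variables occurring in a condition. -/
def vars {X : Type} : Cond X → Set X
  | eq x => {x}
  | ne x => {x}
  | not c => c.vars
  | and c₁ c₂ => c₁.vars ∪ c₂.vars
  | or c₁ c₂ => c₁.vars ∪ c₂.vars

/-- The number of symbols of a condition (each `x^=` or `x^≠` is one symbol). -/
def size {X : Type} : Cond X → ℕ
  | eq _ => 1
  | ne _ => 1
  | not c => c.size + 1
  | and c₁ c₂ => c₁.size + c₂.size + 1
  | or c₁ c₂ => c₁.size + c₂.size + 1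

end Cond

/-- Regular expressions with binding over the alphabet `A` and the set `X` of variables:
`ε`, `a`, `a[c]`, `r + s`, `r · s`, `r*`, `a ↓ₓ (r)`. -/
inductive REWB (A X : Type) : Type
  | eps
  | letter (a : A)
  | test (a : A) (c : Cond X)
  | plus (r s : REWB A X)
  | comp (r s : REWB A X)
  | star (r : REWB A X)
  | bind (a : A) (x : X) (r : REWB A X)

namespace REWB

/-- The free variables of an expression. -/
def fv {A X : Type} : REWB A X → Set X
  | eps => ∅
  | letter _ => ∅
  | test _ c => c.vars
  | plus r s => r.fv ∪ s.fv
  | comp r s => r.fv ∪ s.fv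
  | star r => r.fv
  | bind _ x r => r.fv \ {x}

/-- The size of an expression: the number of its symbols. -/
def size {A X : Type} : REWB A X → ℕ
  | eps => 1
  | letter _ => 1
  | test _ c => c.size + 1
  | plus r s => r.size + s.size + 1
  | comp r s => r.size + s.size + 1
  | star r => r.size + 1
  | bind _ _ r => r.size + 2

open scoped Classical in
/-- The language `L(r, ν)` of data words. -/
noncomputable def lang {A X D : Type} : REWB A X → (X → Option D) → Language (A × D)
  | eps, _ => 1
  | letter a, _ => {w | ∃ d, w = [(a, d)]}
  | test a c, ν => {w | ∃ d, c.Sat d ν ∧ w = [(a, d)]}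
  | plus r s, ν => r.lang ν + s.lang ν
  | comp r s, ν => r.lang ν * s.lang ν
  | star r, ν => KStar.kstar (r.lang ν)
  | bind a x r, ν => {w | ∃ d, ∃ w' ∈ r.lang (Function.update ν x (some d)), w = (a, d) :: w'}

mutual

/-- The level `E i` (for `i ≥ 1`; nothing is in `E 0`):
`E i ::= F (i-1) | E i + E i | E i · E i | a ↓ₓ (E i)`. -/
inductive InE {A X : Type} : ℕ → REWB A X → Prop
  | ofF {i : ℕ} {r : REWB A X} : InF i r → InE (i + 1) r
  | plus {i : ℕ} {r s : REWB A X} : InE i r → InE i s → InE i (REWB.plus r s)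
  | comp {i : ℕ} {r s : REWB A X} : InE i r → InE i s → InE i (REWB.comp r s)
  | bind {i : ℕ} {r : REWB A X} (a : A) (x : X) : InE i r → InE i (REWB.bind a x r)

/-- The level `F i`: `F 0 ::= ε | a | a[c] | F 0 + F 0 | F 0 · F 0 | (F 0)*`, and
`F i ::= E i | F i + F i | F i · F i | (F i)*` for `i ≥ 1`. -/
inductive InF {A X : Type} : ℕ → REWB A X → Prop
  | eps : InF 0 REWB.eps
  | letter (a : A) : InF 0 (REWB.letter a)
  | test (a : A) (c : Cond X) : InF 0 (REWB.test a c)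
  | ofE {i : ℕ} {r : REWB A X} : InE i r → InF i r
  | plus {i : ℕ} {r s : REWB A X} : InF i r → InF i s → InF i (REWB.plus r s)
  | comp {i : ℕ} {r s : REWB A X} : InF i r → InF i s → InF i (REWB.comp r s)
  | star {i : ℕ} {r : REWB A X} : InF i r → InF i (REWB.star r)

end

end REWB

/-- The data word `w` labels a data path from `u` to `v` in the data graph with edge set `E`. -/
def IsDataPath {V A D : Type} (E : Set (V × A × D × V)) : V → List (A × D) → V → Prop
  | u, [], v => u = v
  | u, (a, d) :: w, v => ∃ u', (u, a, d, u') ∈ E ∧ IsDataPath E u' w v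

/-- An instance of query evaluation: a data graph (nodes `Fin numNodes`, alphabet
`Fin numLetters`, data values in `ℕ`, edges given by a list), an REWB over this alphabet and the
variables `Fin numVars`, a valuation defined on its free variables, and a pair of nodes. -/
structure EvalInstance : Type where
  numNodes : ℕ
  numLetters : ℕ
  numVars : ℕ
  edges : List (Fin numNodes × Fin numLetters × ℕ × Fin numNodes)
  expr : REWB (Fin numLetters) (Fin numVars)
  val : Fin numVars → Option ℕ
  compatible : ∀ x ∈ expr.fv, ∃ d, val x = some d
  src : Fin numNodes
  tgt : Fin numNodes

/-- `src` is connected to `tgt` by a data path in `L(expr, val)`. -/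
def EvalInstance.Holds (I : EvalInstance) : Prop :=
  ∃ w ∈ I.expr.lang I.val, IsDataPath {t | t ∈ I.edges} I.src w I.tgt

/-! ## Weighted quantified satisfiability -/

/-- Boolean formulas over the atoms `Fin n`. -/
inductive BForm (n : ℕ) : Type
  | atom (p : Fin n)
  | neg (φ : BForm n)
  | conj (φ ψ : BForm n)
  | disj (φ ψ : BForm n)

/-- Truth of a formula under the assignment making exactly the atoms in `T` true. -/
def BForm.Holds {n : ℕ} (T : Finset (Fin n)) : BForm n → Prop
  | atom p => p ∈ T
  | neg φ => ¬ φ.Holds T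
  | conj φ ψ => φ.Holds T ∧ ψ.Holds T
  | disj φ ψ => φ.Holds T ∨ ψ.Holds T

/-- An instance of weighted quantified satisfiability: a formula `form` over the atoms `Fin n`,
the list `weights` of the numbers `k₁, …, k_ℓ`, and a partition of the atoms into `ℓ` nonempty
blocks, given by the (zero-based) index of the block of each atom. -/
structure WQSatInstance : Type where
  weights : List ℕ
  n : ℕ
  block : Fin n → Fin weights.length
  block_surjective : Function.Surjective block
  form : BForm n

/-- Truth of `Q^{k_{j+1}} PR_{j+1} Q'^{k_{j+2}} PR_{j+2} ⋯ φ`, the quantifiers alternating and the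
first one being existential iff `ex` is `true`, where `j` is the index of the current block, the
given list holds the remaining weights, and `T` is the set of atoms already made true. -/
def QHolds {n : ℕ} (block : Fin n → ℕ) (φ : BForm n) :
    Bool → ℕ → List ℕ → Finset (Fin n) → Prop
  | _, _, [], T => φ.Holds T
  | true, j, k :: ks, T =>
      ∃ S : Finset (Fin n), (∀ p ∈ S, block p = j) ∧ S.card = k ∧
        QHolds block φ false (j + 1) ks (T ∪ S)
  | false, j, k :: ks, T =>
      ∀ S : Finset (Fin n), (∀ p ∈ S, block p = j) → S.card = k →
        QHolds block φ true (j + 1) ks (T ∪ S)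

/-- `∃^{k₁} PR₁ ∀^{k₂} PR₂ ⋯ φ` is true. -/
def WQSatInstance.Holds (I : WQSatInstance) : Prop :=
  QHolds (fun p => (I.block p : ℕ)) I.form true 0 I.weights ∅

/-- `k₂ + k₄ + ⋯`, the total weight of the universally quantified blocks. -/
def universalWeight : List ℕ → ℕ
  | [] => 0
  | [_] => 0
  | _ :: k :: ks => k + universalWeight ks

/-! ## Encodings as words over a finite alphabet -/

/-- The alphabet used to write down instances. -/
inductive Sym : Type
  | one | done | item
  | atom | neg | conj | disj | eq | ne
  | eps | letter | test | plus | comp | star | bind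
  deriving DecidableEq

instance : Fintype Sym where
  elems := {.one, .done, .item, .atom, .neg, .conj, .disj, .eq, .ne, .eps, .letter, .test, .plus,
    .comp, .star, .bind}
  complete s := by cases s <;> decide

/-- Naturals are written in unary. -/
def encNat (m : ℕ) : List Sym := List.replicate m Sym.one ++ [Sym.done]

def encList {α : Type} (f : α → List Sym) : List α → List Sym
  | [] => [Sym.done]
  | a :: l => Sym.item :: (f a ++ encList f l)

def encOption : Option ℕ → List Sym
  | none => [Sym.done]
  | some d => Sym.item :: encNat d

def encForm {n : ℕ} : BForm n → List Sym
  | .atom p => Sym.atom :: encNat p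
  | .neg φ => Sym.neg :: encForm φ
  | .conj φ ψ => Sym.conj :: (encForm φ ++ encForm ψ)
  | .disj φ ψ => Sym.disj :: (encForm φ ++ encForm ψ)

def encCond {v : ℕ} : Cond (Fin v) → List Sym
  | .eq x => Sym.eq :: encNat x
  | .ne x => Sym.ne :: encNat x
  | .not c => Sym.neg :: encCond c
  | .and c₁ c₂ => Sym.conj :: (encCond c₁ ++ encCond c₂)
  | .or c₁ c₂ => Sym.disj :: (encCond c₁ ++ encCond c₂)

def encExpr {m v : ℕ} : REWB (Fin m) (Fin v) → List Sym
  | .eps => [Sym.eps]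
  | .letter a => Sym.letter :: encNat a
  | .test a c => Sym.test :: (encNat a ++ encCond c)
  | .plus r s => Sym.plus :: (encExpr r ++ encExpr s)
  | .comp r s => Sym.comp :: (encExpr r ++ encExpr s)
  | .star r => Sym.star :: encExpr r
  | .bind a x r => Sym.bind :: (encNat a ++ (encNat x ++ encExpr r))

def encEdge {n m : ℕ} (t : Fin n × Fin m × ℕ × Fin n) : List Sym :=
  encNat t.1 ++ (encNat t.2.1 ++ (encNat t.2.2.1 ++ encNat t.2.2.2))

def WQSatInstance.enc (I : WQSatInstance) : List Sym :=
  encList encNat I.weights ++ (encNat I.n ++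
    (encList (fun j : Fin I.weights.length => encNat j) (List.ofFn I.block) ++ encForm I.form))

def EvalInstance.enc (I : EvalInstance) : List Sym :=
  encNat I.numNodes ++ (encNat I.numLetters ++ (encNat I.numVars ++
    (encList encEdge I.edges ++ (encExpr I.expr ++ (encList encOption (List.ofFn I.val) ++
      (encNat I.src ++ encNat I.tgt))))))

/-! The encodings are injective (they are prefix codes). -/

def IsPrefixCode {α : Type} (f : α → List Sym) : Prop :=
  ∀ a b u v, f a ++ u = f b ++ v → a = b ∧ u = v

theorem isPrefixCode_encNat : IsPrefixCode encNat := by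
  intro a
  induction a with
  | zero =>
    intro b u v h
    cases b <;> simp_all [encNat, List.replicate_succ]
  | succ a ih =>
    intro b u v h
    cases b with
    | zero => simp [encNat, List.replicate_succ] at h
    | succ b =>
      have := ih b u v (by simpa [encNat, List.replicate_succ] using h)
      simpa using this

theorem isPrefixCode_encFin (n : ℕ) : IsPrefixCode (fun p : Fin n => encNat p) := by
  intro a b u v h
  obtain ⟨h₁, h₂⟩ := isPrefixCode_encNat _ _ _ _ h
  exact ⟨Fin.ext h₁, h₂⟩

theorem isPrefixCode_encList {α : Type} {f : α → List Sym} (hf : IsPrefixCode f) :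
    IsPrefixCode (encList f) := by
  intro a
  induction a with
  | nil =>
    intro b u v h
    cases b <;> simp_all [encList]
  | cons x a ih =>
    intro b u v h
    cases b with
    | nil => simp [encList] at h
    | cons y b =>
      simp only [encList, List.cons_append, List.append_assoc, List.cons.injEq, true_and] at h
      replace h := hf _ _ _ _ h
      obtain ⟨rfl, h⟩ := h
      replace h := ih _ _ _ h
      obtain ⟨rfl, h⟩ := h
      exact ⟨rfl, h⟩

theorem isPrefixCode_encOption : IsPrefixCode encOption := by
  intro a b u v h
  cases a <;> cases b <;> simp only [encOption, List.cons_append, List.nil_append, List.cons.injEq,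
    reduceCtorEq, false_and, true_and] at h
  · exact ⟨rfl, h⟩
  · replace h := isPrefixCode_encNat _ _ _ _ h
    obtain ⟨rfl, h⟩ := h
    exact ⟨rfl, h⟩

theorem isPrefixCode_encForm {n : ℕ} : IsPrefixCode (encForm (n := n)) := by
  intro a
  induction a with
  | atom p =>
    intro b u v h
    cases b <;> simp only [encForm, List.cons_append, List.cons.injEq,
      reduceCtorEq, false_and, true_and] at h
    replace h := isPrefixCode_encFin _ _ _ _ _ h
    obtain ⟨rfl, h⟩ := h
    exact ⟨rfl, h⟩
  | neg φ ih =>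
    intro b u v h
    cases b <;> simp only [encForm, List.cons_append, List.cons.injEq,
      reduceCtorEq, false_and, true_and] at h
    replace h := ih _ _ _ h
    obtain ⟨rfl, h⟩ := h
    exact ⟨rfl, h⟩
  | conj φ ψ ih₁ ih₂ =>
    intro b u v h
    cases b <;> simp only [encForm, List.cons_append, List.append_assoc, List.cons.injEq,
      reduceCtorEq, false_and, true_and] at h
    replace h := ih₁ _ _ _ h
    obtain ⟨rfl, h⟩ := h
    replace h := ih₂ _ _ _ h
    obtain ⟨rfl, h⟩ := h
    exact ⟨rfl, h⟩
  | disj φ ψ ih₁ ih₂ =>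
    intro b u v h
    cases b <;> simp only [encForm, List.cons_append, List.append_assoc, List.cons.injEq,
      reduceCtorEq, false_and, true_and] at h
    replace h := ih₁ _ _ _ h
    obtain ⟨rfl, h⟩ := h
    replace h := ih₂ _ _ _ h
    obtain ⟨rfl, h⟩ := h
    exact ⟨rfl, h⟩

theorem isPrefixCode_encCond {n : ℕ} : IsPrefixCode (encCond (v := n)) := by
  intro a
  induction a with
  | eq p =>
    intro b u v h
    cases b <;> simp only [encCond, List.cons_append, List.cons.injEq,
      reduceCtorEq, false_and, true_and] at h
    replace h := isPrefixCode_encFin _ _ _ _ _ h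
    obtain ⟨rfl, h⟩ := h
    exact ⟨rfl, h⟩
  | ne p =>
    intro b u v h
    cases b <;> simp only [encCond, List.cons_append, List.cons.injEq,
      reduceCtorEq, false_and, true_and] at h
    replace h := isPrefixCode_encFin _ _ _ _ _ h
    obtain ⟨rfl, h⟩ := h
    exact ⟨rfl, h⟩
  | not φ ih =>
    intro b u v h
    cases b <;> simp only [encCond, List.cons_append, List.cons.injEq,
      reduceCtorEq, false_and, true_and] at h
    replace h := ih _ _ _ h
    obtain ⟨rfl, h⟩ := h
    exact ⟨rfl, h⟩
  | and φ ψ ih₁ ih₂ =>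
    intro b u v h
    cases b <;> simp only [encCond, List.cons_append, List.append_assoc, List.cons.injEq,
      reduceCtorEq, false_and, true_and] at h
    replace h := ih₁ _ _ _ h
    obtain ⟨rfl, h⟩ := h
    replace h := ih₂ _ _ _ h
    obtain ⟨rfl, h⟩ := h
    exact ⟨rfl, h⟩
  | or φ ψ ih₁ ih₂ =>
    intro b u v h
    cases b <;> simp only [encCond, List.cons_append, List.append_assoc, List.cons.injEq,
      reduceCtorEq, false_and, true_and] at h
    replace h := ih₁ _ _ _ h
    obtain ⟨rfl, h⟩ := h
    replace h := ih₂ _ _ _ h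
    obtain ⟨rfl, h⟩ := h
    exact ⟨rfl, h⟩

theorem isPrefixCode_encExpr {m n : ℕ} : IsPrefixCode (encExpr (m := m) (v := n)) := by
  intro a
  induction a with
  | eps =>
    intro b u v h
    cases b <;> simp only [encExpr, List.cons_append, List.nil_append, List.cons.injEq,
      reduceCtorEq, false_and, true_and] at h
    exact ⟨rfl, h⟩
  | letter p =>
    intro b u v h
    cases b <;> simp only [encExpr, List.cons_append, List.nil_append, List.cons.injEq,
      reduceCtorEq, false_and, true_and] at h
    replace h := isPrefixCode_encFin _ _ _ _ _ h
    obtain ⟨rfl, h⟩ := h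
    exact ⟨rfl, h⟩
  | test p c =>
    intro b u v h
    cases b <;> simp only [encExpr, List.cons_append, List.nil_append, List.append_assoc,
      List.cons.injEq, reduceCtorEq, false_and, true_and] at h
    replace h := isPrefixCode_encFin _ _ _ _ _ h
    obtain ⟨rfl, h⟩ := h
    replace h := isPrefixCode_encCond _ _ _ _ h
    obtain ⟨rfl, h⟩ := h
    exact ⟨rfl, h⟩
  | star φ ih =>
    intro b u v h
    cases b <;> simp only [encExpr, List.cons_append, List.nil_append, List.cons.injEq,
      reduceCtorEq, false_and, true_and] at h
    replace h := ih _ _ _ h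
    obtain ⟨rfl, h⟩ := h
    exact ⟨rfl, h⟩
  | plus φ ψ ih₁ ih₂ =>
    intro b u v h
    cases b <;> simp only [encExpr, List.cons_append, List.nil_append, List.append_assoc,
      List.cons.injEq, reduceCtorEq, false_and, true_and] at h
    replace h := ih₁ _ _ _ h
    obtain ⟨rfl, h⟩ := h
    replace h := ih₂ _ _ _ h
    obtain ⟨rfl, h⟩ := h
    exact ⟨rfl, h⟩
  | comp φ ψ ih₁ ih₂ =>
    intro b u v h
    cases b <;> simp only [encExpr, List.cons_append, List.nil_append, List.append_assoc,
      List.cons.injEq, reduceCtorEq, false_and, true_and] at h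
    replace h := ih₁ _ _ _ h
    obtain ⟨rfl, h⟩ := h
    replace h := ih₂ _ _ _ h
    obtain ⟨rfl, h⟩ := h
    exact ⟨rfl, h⟩
  | bind p x φ ih =>
    intro b u v h
    cases b <;> simp only [encExpr, List.cons_append, List.nil_append, List.append_assoc,
      List.cons.injEq, reduceCtorEq, false_and, true_and] at h
    replace h := isPrefixCode_encFin _ _ _ _ _ h
    obtain ⟨rfl, h⟩ := h
    replace h := isPrefixCode_encFin _ _ _ _ _ h
    obtain ⟨rfl, h⟩ := h
    replace h := ih _ _ _ h
    obtain ⟨rfl, h⟩ := h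
    exact ⟨rfl, h⟩

theorem isPrefixCode_encEdge {n m : ℕ} : IsPrefixCode (encEdge (n := n) (m := m)) := by
  rintro ⟨a, b, c, d⟩ ⟨a', b', c', d'⟩ u v h
  simp only [encEdge, List.append_assoc] at h
  replace h := isPrefixCode_encFin _ _ _ _ _ h
  obtain ⟨rfl, h⟩ := h
  replace h := isPrefixCode_encFin _ _ _ _ _ h
  obtain ⟨rfl, h⟩ := h
  replace h := isPrefixCode_encNat _ _ _ _ h
  obtain ⟨rfl, h⟩ := h
  replace h := isPrefixCode_encFin _ _ _ _ _ h
  obtain ⟨rfl, h⟩ := h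
  exact ⟨rfl, h⟩

theorem WQSatInstance.enc_injective : Function.Injective WQSatInstance.enc := by
  rintro ⟨w, n, b, hb, φ⟩ ⟨w', n', b', hb', φ'⟩ h
  simp only [WQSatInstance.enc] at h
  replace h := isPrefixCode_encList isPrefixCode_encNat _ _ _ _ h
  obtain ⟨rfl, h⟩ := h
  replace h := isPrefixCode_encNat _ _ _ _ h
  obtain ⟨rfl, h⟩ := h
  obtain ⟨h₁, h⟩ := isPrefixCode_encList (isPrefixCode_encFin _) _ _ _ _ h
  obtain rfl := List.ofFn_injective h₁
  replace h := isPrefixCode_encForm φ φ' [] [] (by simpa using h)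
  obtain ⟨rfl, -⟩ := h
  rfl

theorem EvalInstance.enc_injective : Function.Injective EvalInstance.enc := by
  rintro ⟨n, m, v, E, e, ν, hν, s, t⟩ ⟨n', m', v', E', e', ν', hν', s', t'⟩ h
  simp only [EvalInstance.enc] at h
  replace h := isPrefixCode_encNat _ _ _ _ h
  obtain ⟨rfl, h⟩ := h
  replace h := isPrefixCode_encNat _ _ _ _ h
  obtain ⟨rfl, h⟩ := h
  replace h := isPrefixCode_encNat _ _ _ _ h
  obtain ⟨rfl, h⟩ := h
  replace h := isPrefixCode_encList isPrefixCode_encEdge _ _ _ _ h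
  obtain ⟨rfl, h⟩ := h
  replace h := isPrefixCode_encExpr _ _ _ _ h
  obtain ⟨rfl, h⟩ := h
  replace h := isPrefixCode_encList isPrefixCode_encOption _ _ _ _ h
  obtain ⟨hv, h⟩ := h
  obtain rfl := List.ofFn_injective hv
  replace h := isPrefixCode_encFin _ _ _ _ _ h
  obtain ⟨rfl, h⟩ := h
  replace h := isPrefixCode_encFin _ t t' [] [] (by simpa using h)
  obtain ⟨rfl, -⟩ := h
  rfl

/-! ## Parameterized problems and FPT reductions -/

/-- A parameterized problem. An instance `i` is presented as the pair `(x, k)` of the word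
`x = enc i` over a finite alphabet and the parameter `k = param i`. (A set `L` of pairs of a word
and a number is the case where `Inst` is the type of all such pairs, `enc` is the first and
`param` the second projection.) -/
structure ParamProblem : Type 1 where
  Inst : Type
  alph : Type
  alph_finite : Finite alph
  enc : Inst → List alph
  param : Inst → ℕ
  presentation_injective : Function.Injective fun i => (enc i, param i)
  yes : Set Inst

/-- The word handed to (or produced by) a machine for the pair `(x, k)`: the word `x`, followed by
`k` copies of an extra symbol. -/
def ParamProblem.code (P : ParamProblem) (i : P.Inst) : List (Option P.alph) :=
  (P.enc i).map some ++ List.replicate (P.param i) none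

/-- `P` is FPT-reducible to `Q`: there is a mapping `R` of instances that preserves and reflects
membership, bounds the new parameter by a computable function of the old one, and is computed by a
multi-stack Turing machine in at most `f(k) * (|x| + 1) ^ c` steps with `f` computable. -/
def FPTReducible (P Q : ParamProblem) : Prop :=
  ∃ R : P.Inst → Q.Inst,
    (∀ i, i ∈ P.yes ↔ R i ∈ Q.yes) ∧
    (∃ g : ℕ → ℕ, Computable g ∧ ∀ i, Q.param (R i) ≤ g (P.param i)) ∧
    (∃ (M : TM2ComputableAux (Option P.alph) (Option Q.alph)) (f : ℕ → ℕ) (c : ℕ),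
      Computable f ∧ ∀ i, Nonempty (TM2OutputsInTime M.tm
        ((P.code i).map M.inputAlphabet.invFun)
        (some ((Q.code (R i)).map M.outputAlphabet.invFun))
        (f (P.param i) * ((P.enc i).length + 1) ^ c)))

/-- `Q` is hard for the class `C` under FPT reductions. -/
def FPTHard (C : Set ParamProblem) (Q : ParamProblem) : Prop :=
  ∀ P ∈ C, FPTReducible P Q

/-- Weighted quantified satisfiability, parameterized by `ℓ + k₁ + ⋯ + k_ℓ`. -/
def wqSat : ParamProblem where
  Inst := WQSatInstance
  alph := Sym
  alph_finite := inferInstance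
  enc := WQSatInstance.enc
  param I := I.weights.length + I.weights.sum
  presentation_injective _ _ h := WQSatInstance.enc_injective (congrArg Prod.fst h)
  yes := {I | I.Holds}

/-- Evaluation of REWB queries, parameterized by the size of the query. -/
def rewbEval : ParamProblem where
  Inst := EvalInstance
  alph := Sym
  alph_finite := inferInstance
  enc := EvalInstance.enc
  param I := I.expr.size
  presentation_injective _ _ h := EvalInstance.enc_injective (congrArg Prod.fst h)
  yes := {I | I.Holds}

/-- The class AW[SAT]. -/
def AWSat : Set ParamProblem := {P | FPTReducible P wqSat}

end REWBEval

-- Membership in AW[SAT] is reducibility to `wqSat`, so both claims follow from one map,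
-- `reduction`, computed in polynomial time by an explicit machine; hardness then only needs this
-- machine to be appended to an arbitrary FPT reduction.
--
-- The query moves around a hub, node 0. The variables `v 1`, `v 2`, ... hold the atoms made true so
-- far and `v 0` holds a tag of the current block. The expression for each quantified atom, each
-- block and the final check starts and ends at the hub, so under a given valuation it amounts to a
-- condition on that valuation. An existential atom is a jump to the gadget of any atom, which is
-- bound and tested to be new and in the current block. A universal atom is a star whose rounds must
-- pass the gadgets of all atoms in their order. In its round an atom is passed if it was chosen
-- before, if it lies in another block, or if the rest of the query succeeds with this atom bound.
-- As the rest of the query sits inside the star and below the binding, its choices may depend on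
-- the atom. Thus a universal atom costs one level of nesting and an existential one none.
--
-- The formula is stored in the graph and not in the query: it becomes a series-parallel network
-- whose edges are literals, negations being pushed inwards by De Morgan's laws, and it is true iff
-- the sink can be reached from the source along true literals. For the negative direction a set of
-- nodes closed under the allowed steps separates the two nodes (`exists_closed`). Therefore the
-- query depends on the weights alone, and its size is quadratic in the parameter
-- (`size_mainExpr_le`).
--
-- Correctness is carried by `reach_checkExpr`, `reach_exExpr`, `reach_allExpr` and
-- `reach_queryExpr`. On the logical side, `qHolds_cons` replaces the choice of a set of `k` atoms
-- by `k` successive choices of distinct atoms. The nesting depth is computed in `inE_queryExpr`.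
--
-- For the running time, while programs on finitely many stacks are compiled to `TM2` machines with
-- exact step counts (`Run.steps`). `mainProg` reads the input once from left to right, writes edges
-- and expression on separate stacks, and assembles the output from its end (`does_mainProg`). The
-- expression is written in prefix notation; what follows the innermost subexpression waits on a
-- stack of its own. Composition with a given reduction is `exists_comp`, and `exists_length_le`
-- bounds the intermediate word by the running time of the first machine.

namespace REWBEval

/-! ## Programs on stacks -/

/-- While programs on stacks indexed by `K` with symbols in `G`. -/
inductive Prog (K G : Type) : Type
  | skip
  | push (k : K) (a : G)
  | pop (k : K)
  | move (k k' : K)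
  | seq (p q : Prog K G)
  | ite (k : K) (c : Option G → Bool) (p q : Prog K G)
  | loop (k : K) (c : Option G → Bool) (p : Prog K G)

namespace Prog

variable {K G : Type}

/-- The program `p` transforms the stacks `S` into `S'` in exactly `t` steps. -/
inductive Run [DecidableEq K] : Prog K G → (K → List G) → (K → List G) → ℕ → Prop
  | skip (S : K → List G) : Run .skip S S 1
  | push (S : K → List G) (k : K) (a : G) :
      Run (.push k a) S (Function.update S k (a :: S k)) 1
  | pop (S : K → List G) (k : K) : Run (.pop k) S (Function.update S k (S k).tail) 1
  | move (S : K → List G) (k k' : K) {a : G} {l : List G} (h : S k = a :: l) :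
      Run (.move k k') S
        (Function.update (Function.update S k l) k' (a :: Function.update S k l k')) 1
  | seq {p q : Prog K G} {S S' S'' : K → List G} {t t' : ℕ} :
      Run p S S' t → Run q S' S'' t' → Run (.seq p q) S S'' (t + t')
  | ite_true {k : K} {c : Option G → Bool} {p q : Prog K G} {S S' : K → List G} {t : ℕ} :
      c (S k).head? = true → Run p S S' t → Run (.ite k c p q) S S' (1 + t)
  | ite_false {k : K} {c : Option G → Bool} {p q : Prog K G} {S S' : K → List G} {t : ℕ} :
      c (S k).head? = false → Run q S S' t → Run (.ite k c p q) S S' (1 + t)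
  | loop_done {k : K} {c : Option G → Bool} {p : Prog K G} {S : K → List G} :
      c (S k).head? = false → Run (.loop k c p) S S 1
  | loop_step {k : K} {c : Option G → Bool} {p : Prog K G} {S S' S'' : K → List G} {t t' : ℕ} :
      c (S k).head? = true → Run p S S' t → Run (.loop k c p) S' S'' t' →
      Run (.loop k c p) S S'' (1 + (t + t'))

/-- The control points of a program. -/
def Lab : Prog K G → Type
  | skip => Unit
  | push _ _ => Unit
  | pop _ => Unit
  | move _ _ => Unit
  | seq p q => p.Lab ⊕ q.Lab
  | ite _ _ p q => Option (p.Lab ⊕ q.Lab)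
  | loop _ _ p => Option p.Lab

/-- The control point where the execution starts. -/
def entry : (p : Prog K G) → p.Lab
  | skip => ()
  | push _ _ => ()
  | pop _ => ()
  | move _ _ => ()
  | seq p _ => Sum.inl p.entry
  | ite _ _ _ _ => none
  | loop _ _ _ => none

/-- A program has finitely many control points. -/
@[reducible]
def labFintype : (p : Prog K G) → Fintype p.Lab
  | skip => inferInstanceAs (Fintype Unit)
  | push _ _ => inferInstanceAs (Fintype Unit)
  | pop _ => inferInstanceAs (Fintype Unit)
  | move _ _ => inferInstanceAs (Fintype Unit)
  | seq p q =>
    letI := p.labFintype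
    letI := q.labFintype
    inferInstanceAs (Fintype (p.Lab ⊕ q.Lab))
  | ite _ _ p q =>
    letI := p.labFintype
    letI := q.labFintype
    inferInstanceAs (Fintype (Option (p.Lab ⊕ q.Lab)))
  | loop _ _ p =>
    letI := p.labFintype
    inferInstanceAs (Fintype (Option p.Lab))

/-- Jump to `l` or to `l'` according to the top of the stack `k`. -/
def testStmt {Λ : Type} (k : K) (c : Option G → Bool) (l l' : Λ) :
    TM2.Stmt (fun _ : K => G) Λ (Option G) :=
  .peek k (fun _ o => o)
    (.branch c (.load (fun _ => none) (.goto fun _ => l)) (.load (fun _ => none) (.goto fun _ => l')))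

/-- The statement at a control point, where `emb` embeds the control points into the labels of a
machine and `exit` is the label to continue with. -/
def stmt [Inhabited G] {Λ : Type} : (p : Prog K G) → (p.Lab → Λ) → Λ → p.Lab →
    TM2.Stmt (fun _ : K => G) Λ (Option G)
  | skip, _, exit, _ => .goto fun _ => exit
  | push k a, _, exit, _ => .push k (fun _ => a) (.goto fun _ => exit)
  | pop k, _, exit, _ => .pop k (fun _ _ => none) (.goto fun _ => exit)
  | move k k', _, exit, _ =>
    -- The default is never pushed, since `Run.move` requires a nonempty source stack. The state is
    -- reset to `none`, as by every other statement.
    .pop k (fun _ o => o) (.push k' (fun o => o.getD default)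
      (.load (fun _ => none) (.goto fun _ => exit)))
  | seq p q, emb, exit, l =>
    match (l : p.Lab ⊕ q.Lab) with
    | .inl l => p.stmt (fun l => emb (Sum.inl l)) (emb (Sum.inr q.entry)) l
    | .inr l => q.stmt (fun l => emb (Sum.inr l)) exit l
  | ite k c p q, emb, exit, l =>
    match (l : Option (p.Lab ⊕ q.Lab)) with
    | none => testStmt k c (emb (some (Sum.inl p.entry))) (emb (some (Sum.inr q.entry)))
    | some (.inl l) => p.stmt (fun l => emb (some (Sum.inl l))) exit l
    | some (.inr l) => q.stmt (fun l => emb (some (Sum.inr l))) exit l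
  | loop k c p, emb, exit, l =>
    match (l : Option p.Lab) with
    | none => testStmt k c (emb (some p.entry)) exit
    | some l => p.stmt (fun l => emb (some l)) (emb none) l

end Prog

-- Counting the steps of a transition function

section Steps

variable {C : Type*}

/-- `n` steps of the transition function `f` lead from `a` to `b`. -/
def Steps (f : C → Option C) (n : ℕ) (a b : C) : Prop :=
  (flip bind f)^[n] (some a) = some b

theorem Steps.zero (f : C → Option C) (a : C) : Steps f 0 a a := rfl

theorem Steps.one {f : C → Option C} {a b : C} (h : f a = some b) : Steps f 1 a b := h

theorem Steps.trans {f : C → Option C} {m n : ℕ} {a b c : C} (h : Steps f m a b)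
    (h' : Steps f n b c) : Steps f (m + n) a c := by
  unfold Steps at *
  rw [Nat.add_comm, Function.iterate_add_apply, h, h']

theorem flip_bind_iterate_none (f : C → Option C) (n : ℕ) :
    (flip bind f)^[n] none = none := by
  induction n with
  | zero => rfl
  | succ n ih => rw [Function.iterate_succ_apply]; exact ih

/-- The value `none` is absorbing, so a run that ends in a configuration has a defined first step.
-/
theorem Steps.succ_iff {f : C → Option C} {n : ℕ} {a c : C} :
    Steps f (n + 1) a c ↔ ∃ b, f a = some b ∧ Steps f n b c := by
  unfold Steps
  rw [Function.iterate_succ_apply]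
  change (flip bind f)^[n] (f a) = _ ↔ _
  cases h : f a with
  | none =>
    rw [flip_bind_iterate_none]
    simp
  | some b => simp

end Steps

/-- `Function.update` replaces the dependent case distinction in `initList`; all statements about
stacks below are in this form. -/
theorem initList_eq (tm : FinTM2) (s : List (tm.Γ tm.k₀)) :
    initList tm s = ⟨some tm.main, tm.initialState, Function.update (fun _ => []) tm.k₀ s⟩ := by
  unfold initList
  congr 1
  funext k
  by_cases hk : k = tm.k₀
  · subst hk
    rw [Function.update_self, dif_pos rfl]
    rfl
  · rw [Function.update_of_ne hk, dif_neg hk]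

theorem haltList_eq (tm : FinTM2) (s : List (tm.Γ tm.k₁)) :
    haltList tm s = ⟨none, tm.initialState, Function.update (fun _ => []) tm.k₁ s⟩ := by
  unfold haltList
  congr 1
  funext k
  by_cases hk : k = tm.k₁
  · subst hk
    rw [Function.update_self, dif_pos rfl]
    rfl
  · rw [Function.update_of_ne hk, dif_neg hk]

theorem nonempty_outputsInTime_iff {tm : FinTM2} {l : List (tm.Γ tm.k₀)}
    {l' : List (tm.Γ tm.k₁)} {t : ℕ} :
    Nonempty (TM2OutputsInTime tm l (some l') t) ↔
      ∃ t' ≤ t, Steps (TM2.step tm.m) t'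
        ⟨some tm.main, tm.initialState, Function.update (fun _ => []) tm.k₀ l⟩
        ⟨none, tm.initialState, Function.update (fun _ => []) tm.k₁ l'⟩ := by
  rw [← initList_eq, ← haltList_eq]
  exact ⟨fun ⟨h⟩ => ⟨h.steps, h.steps_le_m, h.evals_in_steps⟩,
    fun ⟨t', ht, h⟩ => ⟨⟨⟨t', h⟩, ht⟩⟩⟩

-- Compilation of stack programs to machines

namespace Prog

variable {K G : Type} [DecidableEq K] [Inhabited G]

/-- Compilation is compositional: `emb` and `exit` are arbitrary, so that the induction hypothesis
applies to a subprogram inside a larger label type. The count is exact because each primitive and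
each test is a single statement, while sequencing costs nothing. -/
theorem Run.steps {Λ : Type} {M : Λ → TM2.Stmt (fun _ : K => G) Λ (Option G)} {p : Prog K G}
    {S S' : K → List G} {t : ℕ} (h : Run p S S' t) :
    ∀ (emb : p.Lab → Λ) (exit : Λ), (∀ l, M (emb l) = p.stmt emb exit l) →
      Steps (TM2.step M) t ⟨some (emb p.entry), none, S⟩ ⟨some exit, none, S'⟩ := by
  induction h with
  | skip S => intro emb exit hM; apply Steps.one; simp [TM2.step, hM, stmt]
  | push S k a => intro emb exit hM; apply Steps.one; simp [TM2.step, hM, stmt]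
  | pop S k => intro emb exit hM; apply Steps.one; simp [TM2.step, hM, stmt]
  | move S k k' h => intro emb exit hM; apply Steps.one; simp [TM2.step, hM, stmt, h]
  | @seq p q S S' S'' t t' _ _ ih ih' =>
    intro emb exit hM
    exact (ih (fun l => emb (Sum.inl l)) (emb (Sum.inr q.entry)) fun l => hM (Sum.inl l)).trans
      (ih' (fun l => emb (Sum.inr l)) exit fun l => hM (Sum.inr l))
  | @ite_true k c p q S S' t hc _ ih =>
    intro emb exit hM
    refine Steps.trans (Steps.one ?_)
      (ih (fun l => emb (some (Sum.inl l))) exit fun l => hM (some (Sum.inl l)))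
    have : M (emb (ite k c p q).entry) = testStmt k c _ _ := hM none
    simp [TM2.step, this, testStmt, hc]
  | @ite_false k c p q S S' t hc _ ih =>
    intro emb exit hM
    refine Steps.trans (Steps.one ?_)
      (ih (fun l => emb (some (Sum.inr l))) exit fun l => hM (some (Sum.inr l)))
    have : M (emb (ite k c p q).entry) = testStmt k c _ _ := hM none
    simp [TM2.step, this, testStmt, hc]
  | @loop_done k c p S hc =>
    intro emb exit hM
    apply Steps.one
    have : M (emb (loop k c p).entry) = testStmt k c _ _ := hM none
    simp [TM2.step, this, testStmt, hc]
  | @loop_step k c p S S' S'' t t' hc _ _ ih ih' =>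
    intro emb exit hM
    refine Steps.trans (Steps.one ?_) (Steps.trans
      (ih (fun l => emb (some l)) (emb none) fun l => hM (some l)) (ih' emb exit hM))
    have : M (emb (loop k c p).entry) = testStmt k c _ _ := hM none
    simp [TM2.step, this, testStmt, hc]

/-- The machine that executes a program and then halts. -/
def machine [Fintype K] [Fintype G] (p : Prog K G) (k₀ k₁ : K) : FinTM2 where
  K := K
  k₀ := k₀
  k₁ := k₁
  Γ _ := G
  Λ := Option p.Lab
  main := some p.entry
  ΛFin := letI := p.labFintype; inferInstanceAs (Fintype (Option p.Lab))
  σ := Option G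
  initialState := none
  m
    | none => .halt
    | some l => p.stmt some none l

theorem machine_outputs [Fintype K] [Fintype G] {p : Prog K G} {k₀ k₁ : K} {l l' : List G} {t : ℕ}
    (h : Run p (Function.update (fun _ => []) k₀ l) (Function.update (fun _ => []) k₁ l') t) :
    Nonempty (TM2OutputsInTime (p.machine k₀ k₁) l (some l') (t + 1)) := by
  -- The additional step executes `.halt` at the exit label.
  refine nonempty_outputsInTime_iff.2 ⟨t + 1, le_rfl, ?_⟩
  have h₁ := Run.steps (M := (p.machine k₀ k₁).m) h some none fun _ => rfl
  have h₂ : Steps (TM2.step (p.machine k₀ k₁).m) 1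
      ⟨some none, none, Function.update (fun _ => []) k₁ l'⟩
      ⟨none, none, Function.update (fun _ => []) k₁ l'⟩ := rfl
  exact h₁.trans h₂

/-- The program `p` transforms the stacks `S` into `S'` in at most `t` steps. -/
def Runs (p : Prog K G) (S S' : K → List G) (t : ℕ) : Prop := ∃ t' ≤ t, Run p S S' t'

end Prog

end REWBEval

namespace REWBEval

/-! ## Composition of machines -/

namespace Compose

variable {K₁ K₂ : Type} (Γ₁ : K₁ → Type) (Γ₂ : K₂ → Type) (Λ₁ Λ₂ σ₁ σ₂ B : Type)

/-- The stack alphabets of the composition: those of both machines and of an auxiliary stack. -/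
abbrev Stk : K₁ ⊕ K₂ ⊕ Unit → Type
  | .inl k => Γ₁ k
  | .inr (.inl k) => Γ₂ k
  | .inr (.inr _) => B

/-- The labels of the composition; those in `Bool` belong to the transfer of the intermediate
word to the auxiliary stack and from there to the second machine. -/
abbrev Lbl : Type := Λ₁ ⊕ Λ₂ ⊕ Bool

/-- The internal states of the composition. -/
abbrev Var : Type := σ₁ × σ₂ × Option B

variable {Γ₁ Γ₂ Λ₁ Λ₂ σ₁ σ₂ B}

/-- A statement of the first machine; halting is replaced by starting the transfer. -/
def leftStmt : TM2.Stmt Γ₁ Λ₁ σ₁ → TM2.Stmt (Stk Γ₁ Γ₂ B) (Lbl Λ₁ Λ₂) (Var σ₁ σ₂ B)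
  | .push k f q => .push (Sum.inl k) (fun s => f s.1) (leftStmt q)
  | .peek k f q => .peek (Sum.inl k) (fun s o => (f s.1 o, s.2)) (leftStmt q)
  | .pop k f q => .pop (Sum.inl k) (fun s o => (f s.1 o, s.2)) (leftStmt q)
  | .load f q => .load (fun s => (f s.1, s.2)) (leftStmt q)
  | .branch f q q' => .branch (fun s => f s.1) (leftStmt q) (leftStmt q')
  | .goto f => .goto fun s => Sum.inl (f s.1)
  | .halt => .goto fun _ => Sum.inr (Sum.inr false)

/-- A statement of the second machine. -/
def rightStmt : TM2.Stmt Γ₂ Λ₂ σ₂ → TM2.Stmt (Stk Γ₁ Γ₂ B) (Lbl Λ₁ Λ₂) (Var σ₁ σ₂ B)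
  | .push k f q => .push (Sum.inr (Sum.inl k)) (fun s => f s.2.1) (rightStmt q)
  | .peek k f q => .peek (Sum.inr (Sum.inl k)) (fun s o => (s.1, f s.2.1 o, s.2.2)) (rightStmt q)
  | .pop k f q => .pop (Sum.inr (Sum.inl k)) (fun s o => (s.1, f s.2.1 o, s.2.2)) (rightStmt q)
  | .load f q => .load (fun s => (s.1, f s.2.1, s.2.2)) (rightStmt q)
  | .branch f q q' => .branch (fun s => f s.2.1) (rightStmt q) (rightStmt q')
  | .goto f => .goto fun s => Sum.inr (Sum.inl (f s.2.1))
  | .halt => .halt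

/-- The stacks of the composition. -/
def joinStk (S₁ : ∀ k, List (Γ₁ k)) (S₂ : ∀ k, List (Γ₂ k)) (T : List B) :
    ∀ k, List (Stk Γ₁ Γ₂ B k)
  | .inl k => S₁ k
  | .inr (.inl k) => S₂ k
  | .inr (.inr _) => T

/-- A configuration of the first machine. -/
def leftCfg (s₂ : σ₂) (S₂ : ∀ k, List (Γ₂ k)) (c : TM2.Cfg Γ₁ Λ₁ σ₁) :
    TM2.Cfg (Stk Γ₁ Γ₂ B) (Lbl Λ₁ Λ₂) (Var σ₁ σ₂ B) :=
  ⟨some (c.l.elim (Sum.inr (Sum.inr false)) Sum.inl), (c.var, s₂, none), joinStk c.stk S₂ []⟩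

/-- A configuration of the second machine. -/
def rightCfg (s₁ : σ₁) (S₁ : ∀ k, List (Γ₁ k)) (c : TM2.Cfg Γ₂ Λ₂ σ₂) :
    TM2.Cfg (Stk Γ₁ Γ₂ B) (Lbl Λ₁ Λ₂) (Var σ₁ σ₂ B) :=
  ⟨c.l.map fun l => Sum.inr (Sum.inl l), (s₁, c.var, none), joinStk S₁ c.stk []⟩

variable [DecidableEq K₁] [DecidableEq K₂]

theorem update_joinStk_left (S₁ : ∀ k, List (Γ₁ k)) (S₂ : ∀ k, List (Γ₂ k)) (T : List B) (k : K₁)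
    (x : List (Γ₁ k)) :
    Function.update (joinStk S₁ S₂ T) (Sum.inl k) x = joinStk (Function.update S₁ k x) S₂ T := by
  funext j
  rcases j with j | j | j
  · by_cases h : j = k
    · subst h
      simp [joinStk]
    · rw [Function.update_of_ne (by simpa using h)]
      simp [joinStk, Function.update_of_ne h]
  · rw [Function.update_of_ne (by simp)]
    rfl
  · rw [Function.update_of_ne (by simp)]
    rfl

theorem update_joinStk_right (S₁ : ∀ k, List (Γ₁ k)) (S₂ : ∀ k, List (Γ₂ k)) (T : List B) (k : K₂)
    (x : List (Γ₂ k)) :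
    Function.update (joinStk S₁ S₂ T) (Sum.inr (Sum.inl k)) x =
      joinStk S₁ (Function.update S₂ k x) T := by
  funext j
  rcases j with j | j | j
  · rw [Function.update_of_ne (by simp)]
    rfl
  · by_cases h : j = k
    · subst h
      simp [joinStk]
    · rw [Function.update_of_ne (by simpa using h)]
      simp [joinStk, Function.update_of_ne h]
  · rw [Function.update_of_ne (by simp)]
    rfl

theorem update_joinStk_aux (S₁ : ∀ k, List (Γ₁ k)) (S₂ : ∀ k, List (Γ₂ k)) (T x : List B) :
    Function.update (joinStk S₁ S₂ T) (Sum.inr (Sum.inr ())) x = joinStk S₁ S₂ x := by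
  funext j
  rcases j with j | j | j
  · rw [Function.update_of_ne (by simp)]
    rfl
  · rw [Function.update_of_ne (by simp)]
    rfl
  · simp [joinStk]

/-- The simulation is in lockstep, since the auxiliary stack and the third component of the state
are not touched. `leftCfg` sends the halted configuration to the label of the transfer, just as
`leftStmt` does with `.halt`. -/
theorem stepAux_leftStmt (q : TM2.Stmt Γ₁ Λ₁ σ₁) (s₁ : σ₁) (S₁ : ∀ k, List (Γ₁ k)) (s₂ : σ₂)
    (S₂ : ∀ k, List (Γ₂ k)) :
    TM2.stepAux (leftStmt (Λ₂ := Λ₂) (B := B) q) (s₁, s₂, none) (joinStk S₁ S₂ []) =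
      leftCfg s₂ S₂ (TM2.stepAux q s₁ S₁) := by
  induction q generalizing s₁ S₁ with
  | push k f q ih =>
    simp only [leftStmt, TM2.stepAux, update_joinStk_left]
    exact ih _ _
  | peek k f q ih => exact ih _ _
  | pop k f q ih =>
    simp only [leftStmt, TM2.stepAux, update_joinStk_left]
    exact ih _ _
  | load f q ih => exact ih _ _
  | branch f q q' ih ih' =>
    simp only [leftStmt, TM2.stepAux]
    cases f s₁
    · exact ih' _ _
    · exact ih _ _
  | goto f => rfl
  | halt => rfl

theorem stepAux_rightStmt (q : TM2.Stmt Γ₂ Λ₂ σ₂) (s₁ : σ₁) (S₁ : ∀ k, List (Γ₁ k)) (s₂ : σ₂)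
    (S₂ : ∀ k, List (Γ₂ k)) :
    TM2.stepAux (rightStmt (Λ₁ := Λ₁) (B := B) q) (s₁, s₂, none) (joinStk S₁ S₂ []) =
      rightCfg s₁ S₁ (TM2.stepAux q s₂ S₂) := by
  induction q generalizing s₂ S₂ with
  | push k f q ih =>
    simp only [rightStmt, TM2.stepAux, update_joinStk_right]
    exact ih _ _
  | peek k f q ih => exact ih _ _
  | pop k f q ih =>
    simp only [rightStmt, TM2.stepAux, update_joinStk_right]
    exact ih _ _
  | load f q ih => exact ih _ _
  | branch f q q' ih ih' =>
    simp only [rightStmt, TM2.stepAux]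
    cases f s₂
    · exact ih' _ _
    · exact ih _ _
  | goto f => rfl
  | halt => rfl

variable (m₁ : Λ₁ → TM2.Stmt Γ₁ Λ₁ σ₁) (m₂ : Λ₂ → TM2.Stmt Γ₂ Λ₂ σ₂) (k₁ : K₁) (k₂ : K₂)
  (e₁ : Γ₁ k₁ → B) (e₂ : B → Γ₂ k₂) (start : Λ₂)

/-- The program of the composition. -/
def prog [Inhabited B] : Lbl Λ₁ Λ₂ → TM2.Stmt (Stk Γ₁ Γ₂ B) (Lbl Λ₁ Λ₂) (Var σ₁ σ₂ B)
  | .inl l => leftStmt (m₁ l)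
  | .inr (.inl l) => rightStmt (m₂ l)
  | .inr (.inr false) =>
    .pop (Sum.inl k₁) (fun s o => (s.1, s.2.1, o.map e₁))
      (.branch (fun s => s.2.2.isSome)
        (.push (Sum.inr (Sum.inr ())) (fun s => s.2.2.getD default)
          (.load (fun s => (s.1, s.2.1, none)) (.goto fun _ => Sum.inr (Sum.inr false))))
        (.goto fun _ => Sum.inr (Sum.inr true)))
  | .inr (.inr true) =>
    .pop (Sum.inr (Sum.inr ())) (fun s o => (s.1, s.2.1, o))
      (.branch (fun s => s.2.2.isSome)
        (.push (Sum.inr (Sum.inl k₂)) (fun s => e₂ (s.2.2.getD default))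
          (.load (fun s => (s.1, s.2.1, none)) (.goto fun _ => Sum.inr (Sum.inr true))))
        (.goto fun _ => Sum.inr (Sum.inl start)))

variable [Inhabited B]

theorem steps_left {n : ℕ} {c c' : TM2.Cfg Γ₁ Λ₁ σ₁} (s₂ : σ₂) (S₂ : ∀ k, List (Γ₂ k))
    (h : Steps (TM2.step m₁) n c c') :
    Steps (TM2.step (prog m₁ m₂ k₁ k₂ e₁ e₂ start)) n (leftCfg s₂ S₂ c) (leftCfg s₂ S₂ c') := by
  induction n generalizing c with
  | zero =>
    obtain rfl : c = c' := by simpa [Steps] using h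
    exact Steps.zero _ _
  | succ n ih =>
    obtain ⟨d, hd, h⟩ := Steps.succ_iff.1 h
    refine Steps.succ_iff.2 ⟨leftCfg s₂ S₂ d, ?_, ih h⟩
    obtain ⟨_ | l, s, S⟩ := c
    · simp [TM2.step] at hd
    · simp only [TM2.step, Option.some.injEq] at hd
      subst hd
      exact congrArg some (stepAux_leftStmt (m₁ l) s S s₂ S₂)

theorem steps_right {n : ℕ} {c c' : TM2.Cfg Γ₂ Λ₂ σ₂} (s₁ : σ₁) (S₁ : ∀ k, List (Γ₁ k))
    (h : Steps (TM2.step m₂) n c c') :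
    Steps (TM2.step (prog m₁ m₂ k₁ k₂ e₁ e₂ start)) n (rightCfg s₁ S₁ c) (rightCfg s₁ S₁ c') := by
  induction n generalizing c with
  | zero =>
    obtain rfl : c = c' := by simpa [Steps] using h
    exact Steps.zero _ _
  | succ n ih =>
    obtain ⟨d, hd, h⟩ := Steps.succ_iff.1 h
    refine Steps.succ_iff.2 ⟨rightCfg s₁ S₁ d, ?_, ih h⟩
    obtain ⟨_ | l, s, S⟩ := c
    · simp [TM2.step] at hd
    · simp only [TM2.step, Option.some.injEq] at hd
      subst hd
      exact congrArg some (stepAux_rightStmt (m₂ l) s₁ S₁ s S)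

/-- Unloading reverses the intermediate word and loading reverses it back, so the second machine
receives it in its original order. -/
theorem steps_unload (s₁ : σ₁) (s₂ : σ₂) (S₁ : ∀ k, List (Γ₁ k)) (S₂ : ∀ k, List (Γ₂ k))
    (w : List (Γ₁ k₁)) (T : List B) :
    Steps (TM2.step (prog m₁ m₂ k₁ k₂ e₁ e₂ start)) (w.length + 1)
      ⟨some (Sum.inr (Sum.inr false)), (s₁, s₂, none), joinStk (Function.update S₁ k₁ w) S₂ T⟩
      ⟨some (Sum.inr (Sum.inr true)), (s₁, s₂, none),
        joinStk (Function.update S₁ k₁ []) S₂ ((w.map e₁).reverse ++ T)⟩ := by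
  induction w generalizing T with
  | nil =>
    apply Steps.one
    simp [TM2.step, prog, joinStk, update_joinStk_left]
  | cons a w ih =>
    refine Steps.succ_iff.2 ⟨_, ?_, by simpa using ih (e₁ a :: T)⟩
    simp [TM2.step, prog, joinStk, update_joinStk_left, update_joinStk_aux]

theorem steps_load (s₁ : σ₁) (s₂ : σ₂) (S₁ : ∀ k, List (Γ₁ k)) (S₂ : ∀ k, List (Γ₂ k))
    (T : List B) (w : List (Γ₂ k₂)) :
    Steps (TM2.step (prog m₁ m₂ k₁ k₂ e₁ e₂ start)) (T.length + 1)
      ⟨some (Sum.inr (Sum.inr true)), (s₁, s₂, none), joinStk S₁ (Function.update S₂ k₂ w) T⟩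
      ⟨some (Sum.inr (Sum.inl start)), (s₁, s₂, none),
        joinStk S₁ (Function.update S₂ k₂ ((T.map e₂).reverse ++ w)) []⟩ := by
  induction T generalizing w with
  | nil =>
    apply Steps.one
    simp [TM2.step, prog, joinStk, update_joinStk_aux]
  | cons a T ih =>
    refine Steps.succ_iff.2 ⟨_, ?_, by simpa using ih (e₂ a :: w)⟩
    simp [TM2.step, prog, joinStk, update_joinStk_right, update_joinStk_aux]

end Compose

/-- The machine is fixed before the words and the times, so one composition serves all instances. A
halted machine has emptied all stacks but its output, which lets the second machine start cleanly;
`2 * b.length + 2` pays for the two transfers. -/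
theorem exists_comp {A B C : Type} [Inhabited B] (M₁ : TM2ComputableAux A B) (M₂ : TM2ComputableAux B C) :
    ∃ M : TM2ComputableAux A C, ∀ (a : List A) (b : List B) (c : List C) (t₁ t₂ : ℕ),
      Nonempty (TM2OutputsInTime M₁.tm (a.map M₁.inputAlphabet.invFun)
        (some (b.map M₁.outputAlphabet.invFun)) t₁) →
      Nonempty (TM2OutputsInTime M₂.tm (b.map M₂.inputAlphabet.invFun)
        (some (c.map M₂.outputAlphabet.invFun)) t₂) →
      Nonempty (TM2OutputsInTime M.tm (a.map M.inputAlphabet.invFun)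
        (some (c.map M.outputAlphabet.invFun)) (t₁ + 2 * b.length + 2 + t₂)) := by
  classical
  let : Fintype (M₂.tm.Γ M₂.tm.k₀) := M₂.tm.Γk₀Fin
  -- A letter of `B` is kept in the internal state during the transfer, so `B` has to be finite; the
  -- input alphabet of the second machine provides this.
  let : Fintype B := Fintype.ofEquiv _ M₂.inputAlphabet
  let := M₁.tm.kFin
  let := M₂.tm.kFin
  let := M₁.tm.ΛFin
  let := M₂.tm.ΛFin
  let := M₁.tm.σFin
  let := M₂.tm.σFin
  let tm : FinTM2 :=
    { K := M₁.tm.K ⊕ M₂.tm.K ⊕ Unit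
      k₀ := Sum.inl M₁.tm.k₀
      k₁ := Sum.inr (Sum.inl M₂.tm.k₁)
      Γ := Compose.Stk M₁.tm.Γ M₂.tm.Γ B
      Λ := Compose.Lbl M₁.tm.Λ M₂.tm.Λ
      main := Sum.inl M₁.tm.main
      σ := Compose.Var M₁.tm.σ M₂.tm.σ B
      initialState := (M₁.tm.initialState, M₂.tm.initialState, none)
      Γk₀Fin := M₁.tm.Γk₀Fin
      m := Compose.prog M₁.tm.m M₂.tm.m M₁.tm.k₁ M₂.tm.k₀ M₁.outputAlphabet
        M₂.inputAlphabet.symm M₂.tm.main }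
  refine ⟨⟨tm, M₁.inputAlphabet, M₂.outputAlphabet⟩, fun a b c t₁ t₂ h₁ h₂ => ?_⟩
  obtain ⟨t₁', ht₁, h₁⟩ := nonempty_outputsInTime_iff.1 h₁
  obtain ⟨t₂', ht₂, h₂⟩ := nonempty_outputsInTime_iff.1 h₂
  refine nonempty_outputsInTime_iff.2
    ⟨t₁' + (((b.map M₁.outputAlphabet.invFun).length + 1) +
      ((((b.map M₁.outputAlphabet.invFun).map M₁.outputAlphabet).reverse).length + 1)) + t₂',
      by simp; omega, ?_⟩
  have g₁ := Compose.steps_left M₁.tm.m M₂.tm.m M₁.tm.k₁ M₂.tm.k₀ M₁.outputAlphabet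
        M₂.inputAlphabet.symm M₂.tm.main M₂.tm.initialState (fun _ => []) h₁
  have g₂ := Compose.steps_unload M₁.tm.m M₂.tm.m M₁.tm.k₁ M₂.tm.k₀ M₁.outputAlphabet
        M₂.inputAlphabet.symm M₂.tm.main M₁.tm.initialState M₂.tm.initialState (fun _ => [])
        (fun _ => []) (b.map M₁.outputAlphabet.invFun) []
  have g₃ := Compose.steps_load M₁.tm.m M₂.tm.m M₁.tm.k₁ M₂.tm.k₀ M₁.outputAlphabet
        M₂.inputAlphabet.symm M₂.tm.main M₁.tm.initialState M₂.tm.initialState (fun _ => [])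
        (fun _ => []) (((b.map M₁.outputAlphabet.invFun).map M₁.outputAlphabet).reverse) []
  have g₄ := Compose.steps_right M₁.tm.m M₂.tm.m M₁.tm.k₁ M₂.tm.k₀ M₁.outputAlphabet
        M₂.inputAlphabet.symm M₂.tm.main M₁.tm.initialState (fun _ => []) h₂
  have e₁ : ∀ S : ∀ k, List (M₁.tm.Γ k), S = (fun _ => []) →
      Compose.joinStk S (fun k => ([] : List (M₂.tm.Γ k))) ([] : List B) = fun _ => [] := by
    rintro _ rfl
    funext k
    rcases k with k | k | k <;> rfl
  have eq₁ : Function.update (fun k => ([] : List (M₁.tm.Γ k))) M₁.tm.k₁ [] = fun _ => [] :=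
    Function.update_eq_self _ _
  have eq₂ : Function.update (fun k => ([] : List (M₂.tm.Γ k))) M₂.tm.k₀ [] = fun _ => [] :=
    Function.update_eq_self _ _
  have e₀ := e₁ _ rfl
  have e₃ : (((b.map M₁.outputAlphabet.invFun).map M₁.outputAlphabet).reverse).map
      M₂.inputAlphabet.symm = (b.map M₂.inputAlphabet.invFun).reverse := by
    simp [Function.comp_def]
  rw [e₃, List.reverse_reverse, List.append_nil] at g₃
  rw [eq₁, List.append_nil] at g₂
  rw [eq₂] at g₃
  have g := (g₁.trans (g₂.trans g₃)).trans g₄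
  have i₁ := Compose.update_joinStk_left (fun k => ([] : List (M₁.tm.Γ k)))
    (fun k => ([] : List (M₂.tm.Γ k))) ([] : List B) M₁.tm.k₀ (a.map M₁.inputAlphabet.invFun)
  have i₂ := Compose.update_joinStk_right (fun k => ([] : List (M₁.tm.Γ k)))
    (fun k => ([] : List (M₂.tm.Γ k))) ([] : List B) M₂.tm.k₁ (c.map M₂.outputAlphabet.invFun)
  rw [e₀] at i₁ i₂
  have j₁ : Compose.leftCfg (B := B) (Λ₁ := M₁.tm.Λ) (Λ₂ := M₂.tm.Λ) M₂.tm.initialState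
      (fun k => ([] : List (M₂.tm.Γ k)))
      ⟨some M₁.tm.main, M₁.tm.initialState,
        Function.update (fun _ => []) M₁.tm.k₀ (a.map M₁.inputAlphabet.invFun)⟩ =
      ⟨some tm.main, tm.initialState,
        Function.update (fun _ => []) tm.k₀ (a.map M₁.inputAlphabet.invFun)⟩ := by
    unfold Compose.leftCfg
    rw [← i₁]
    rfl
  have j₂ : Compose.rightCfg (B := B) (Λ₁ := M₁.tm.Λ) (Λ₂ := M₂.tm.Λ) M₁.tm.initialState
      (fun k => ([] : List (M₁.tm.Γ k)))
      ⟨none, M₂.tm.initialState,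
        Function.update (fun _ => []) M₂.tm.k₁ (c.map M₂.outputAlphabet.invFun)⟩ =
      ⟨none, tm.initialState,
        Function.update (fun _ => []) tm.k₁ (c.map M₂.outputAlphabet.invFun)⟩ := by
    unfold Compose.rightCfg
    rw [← i₂]
    rfl
  exact j₁ ▸ j₂ ▸ g

/-! ## The length of the output -/

/-- An upper bound on the number of symbols that a statement pushes. -/
def pushes {K : Type} {Γ : K → Type} {Λ σ : Type} : TM2.Stmt Γ Λ σ → ℕ
  | .push _ _ q => pushes q + 1
  | .peek _ _ q => pushes q
  | .pop _ _ q => pushes q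
  | .load _ q => pushes q
  | .branch _ q q' => pushes q + pushes q'
  | .goto _ => 0
  | .halt => 0

theorem length_stepAux_le {K : Type} [DecidableEq K] {Γ : K → Type} {Λ σ : Type}
    (q : TM2.Stmt Γ Λ σ) (s : σ) (S : ∀ k, List (Γ k)) (k : K) :
    ((TM2.stepAux q s S).stk k).length ≤ (S k).length + pushes q := by
  induction q generalizing s S with
  | push k' f q ih =>
    refine (ih _ _).trans ?_
    by_cases h : k = k'
    · subst h
      simp [pushes]
      omega
    · simp [pushes, Function.update_of_ne h]
  | peek k' f q ih => exact ih _ _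
  | pop k' f q ih =>
    refine (ih _ _).trans ?_
    by_cases h : k = k'
    · subst h
      simp [pushes]
    · simp [pushes, Function.update_of_ne h]
  | load f q ih => exact ih _ _
  | branch f q q' ih ih' =>
    simp only [TM2.stepAux, pushes]
    cases f s
    · exact (ih' _ _).trans (by omega)
    · exact (ih _ _).trans (by omega)
  | goto f => simp [pushes]
  | halt => simp [pushes]

theorem Steps.length_le {K : Type} [DecidableEq K] {Γ : K → Type} {Λ σ : Type}
    {m : Λ → TM2.Stmt Γ Λ σ} {b : ℕ} (hb : ∀ l, pushes (m l) ≤ b) {n : ℕ} {c c' : TM2.Cfg Γ Λ σ}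
    (h : Steps (TM2.step m) n c c') (k : K) :
    (c'.stk k).length ≤ (c.stk k).length + b * n := by
  induction n generalizing c with
  | zero =>
    obtain rfl : c = c' := by simpa [Steps] using h
    simp
  | succ n ih =>
    obtain ⟨d, hd, h⟩ := Steps.succ_iff.1 h
    refine (ih h).trans ?_
    obtain ⟨_ | l, s, S⟩ := c
    · simp [TM2.step] at hd
    · simp only [TM2.step, Option.some.injEq] at hd
      subst hd
      have := length_stepAux_le (m l) s S k
      have := hb l
      rw [Nat.mul_succ]
      dsimp only
      omega

/-- One step pushes no more symbols than its statement contains, and there are finitely many labels;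
the sum over all of them is a crude bound per step. The input length enters because the input and
output stacks may coincide. -/
theorem exists_length_le (tm : FinTM2) : ∃ b : ℕ, ∀ (l : List (tm.Γ tm.k₀))
    (l' : List (tm.Γ tm.k₁)) (t : ℕ), Nonempty (TM2OutputsInTime tm l (some l') t) →
      l'.length ≤ l.length + b * t := by
  let := tm.ΛFin
  refine ⟨∑ l, pushes (tm.m l), fun l l' t h => ?_⟩
  obtain ⟨t', ht, h⟩ := nonempty_outputsInTime_iff.1 h
  have := h.length_le (b := ∑ l, pushes (tm.m l))
    (fun l => Finset.single_le_sum (f := fun l => pushes (tm.m l)) (fun _ _ => Nat.zero_le _)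
      (Finset.mem_univ l)) tm.k₁
  have hl : (Function.update (fun k => ([] : List (tm.Γ k))) tm.k₀ l tm.k₁).length ≤ l.length := by
    generalize tm.k₁ = k
    by_cases hk : k = tm.k₀
    · subst hk
      simp
    · simp [Function.update_of_ne hk]
  simp only [Function.update_self] at this
  have := Nat.mul_le_mul_left (∑ l, pushes (tm.m l)) ht
  omega

end REWBEval

namespace REWBEval

/-! ## Data paths matching an expression -/

theorem isDataPath_append {V A D : Type} {E : Set (V × A × D × V)} {u v : V}
    {w w' : List (A × D)} :
    IsDataPath E u (w ++ w') v ↔ ∃ m, IsDataPath E u w m ∧ IsDataPath E m w' v := by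
  induction w generalizing u with
  | nil => simp [IsDataPath]
  | cons a w ih =>
    obtain ⟨a, d⟩ := a
    simp only [List.cons_append, IsDataPath, ih]
    constructor
    · rintro ⟨x, hx, m, h, h'⟩
      exact ⟨m, ⟨x, hx, h⟩, h'⟩
    · rintro ⟨m, ⟨x, hx, h⟩, h'⟩
      exact ⟨x, hx, m, h, h'⟩

/-- Some data path from `u` to `v` is labelled by a word in `L(r, ν)`. -/
def Reach {V A X D : Type} (E : Set (V × A × D × V)) (r : REWB A X) (ν : X → Option D) (u v : V) :
    Prop :=
  ∃ w ∈ r.lang ν, IsDataPath E u w v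

section Reach

variable {V A X D : Type} {E : Set (V × A × D × V)} {ν : X → Option D} {u v : V}

/-- This lemma and the following ones turn the operators of expressions into operations on binary
relations between nodes, after which data words no longer appear. -/
theorem reach_letter {a : A} : Reach E (.letter a) ν u v ↔ ∃ d, (u, a, d, v) ∈ E := by
  unfold Reach REWB.lang
  constructor
  · rintro ⟨_, ⟨d, rfl⟩, h⟩
    simp only [IsDataPath, exists_eq_right] at h
    exact ⟨d, h⟩
  · rintro ⟨d, h⟩
    exact ⟨[(a, d)], ⟨d, rfl⟩, by simpa [IsDataPath] using h⟩

theorem reach_test {a : A} {c : Cond X} :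
    Reach E (.test a c) ν u v ↔ ∃ d, c.Sat d ν ∧ (u, a, d, v) ∈ E := by
  unfold Reach REWB.lang
  constructor
  · rintro ⟨_, ⟨d, hd, rfl⟩, h⟩
    simp only [IsDataPath, exists_eq_right] at h
    exact ⟨d, hd, h⟩
  · rintro ⟨d, hd, h⟩
    exact ⟨[(a, d)], ⟨d, hd, rfl⟩, by simpa [IsDataPath] using h⟩

theorem reach_plus {r s : REWB A X} :
    Reach E (.plus r s) ν u v ↔ Reach E r ν u v ∨ Reach E s ν u v := by
  simp only [Reach, REWB.lang, Language.mem_add, or_and_right, exists_or]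

theorem reach_comp {r s : REWB A X} :
    Reach E (.comp r s) ν u v ↔ ∃ m, Reach E r ν u m ∧ Reach E s ν m v := by
  simp only [Reach, REWB.lang, Language.mem_mul]
  constructor
  · rintro ⟨_, ⟨w, hw, w', hw', rfl⟩, h⟩
    obtain ⟨m, h, h'⟩ := isDataPath_append.1 h
    exact ⟨m, ⟨w, hw, h⟩, w', hw', h'⟩
  · rintro ⟨m, ⟨w, hw, h⟩, w', hw', h'⟩
    exact ⟨_, ⟨w, hw, w', hw', rfl⟩, isDataPath_append.2 ⟨m, h, h'⟩⟩

theorem reach_star {r : REWB A X} :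
    Reach E (.star r) ν u v ↔ Relation.ReflTransGen (Reach E r ν) u v := by
  simp only [Reach, REWB.lang, Language.mem_kstar]
  constructor
  · rintro ⟨_, ⟨L, rfl, hL⟩, h⟩
    induction L generalizing u with
    | nil =>
      obtain rfl : u = v := h
      exact .refl
    | cons w L ih =>
      rw [List.flatten_cons] at h
      obtain ⟨m, h, h'⟩ := isDataPath_append.1 h
      exact .head ⟨w, hL w (by simp), h⟩ (ih (fun y hy => hL y (by simp [hy])) h')
  · intro h
    induction h using Relation.ReflTransGen.head_induction_on with
    | refl => exact ⟨_, ⟨[], rfl, by simp⟩, rfl⟩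
    | head h _ ih =>
      obtain ⟨w, hw, h⟩ := h
      obtain ⟨_, ⟨L, rfl, hL⟩, h'⟩ := ih
      refine ⟨w ++ L.flatten, ⟨w :: L, rfl, ?_⟩, isDataPath_append.2 ⟨_, h, h'⟩⟩
      simpa using ⟨hw, hL⟩

theorem reach_bind [DecidableEq X] {a : A} {x : X} {r : REWB A X} :
    Reach E (.bind a x r) ν u v ↔
      ∃ d m, (u, a, d, m) ∈ E ∧ Reach E r (Function.update ν x (some d)) m v := by
  unfold Reach
  rw [REWB.lang]
  constructor
  · rintro ⟨_, ⟨d, w, hw, rfl⟩, m, hm, h⟩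
    refine ⟨d, m, hm, w, ?_, h⟩
    -- `REWB.lang` updates valuations by means of classical decidability, here an arbitrary instance
    -- is used.
    convert hw
  · rintro ⟨d, m, hm, w, hw, h⟩
    refine ⟨(a, d) :: w, ⟨d, w, ?_, rfl⟩, m, hm, h⟩
    convert hw

end Reach

/-! ## The query -/

section Query

variable {X : Type} (v : ℕ → X)

/-- The data value is that of one of the first `m` bound atoms. -/
def orCond : ℕ → Cond X
  -- A contradiction plays the empty disjunction, as conditions have no constants.
  | 0 => .and (.eq (v 0)) (.ne (v 0))
  | m + 1 => .or (.eq (v (m + 1))) (orCond m)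

/-- Check that the formula holds. -/
def checkExpr (m : ℕ) : REWB (Fin 8) X :=
  -- Letter 7 is available only at node 1, the sink of the formula graph, and leads back to the hub.
  .comp (.star (.plus (.test 0 (orCond v m)) (.test 1 (.not (orCond v m))))) (.letter 7)

/-- Choose an atom of the current block, different from the atoms chosen before. -/
def exExpr (m : ℕ) (r : REWB (Fin 8) X) : REWB (Fin 8) X :=
  -- Letter 5 leads from the hub to the gadget of any atom. The three edges with letter 2 there
  -- carry the atom, the atom again and the tag of its block.
  .comp (.letter 5) (.bind 2 (v (m + 1))
    (.comp (.test 2 (.not (orCond v m))) (.comp (.test 2 (.eq (v 0))) r)))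

/-- Iterate over all atoms of the current block, different from the atoms chosen before. -/
def allExpr (m : ℕ) (r : REWB (Fin 8) X) : REWB (Fin 8) X :=
  -- Letter 4 enters the chain of gadgets at the first atom and leaves it behind the last one.
  .comp (.letter 4) (.comp (.star (.bind 2 (v (m + 1))
    (.comp
      -- The alternatives: the atom was chosen before, it belongs to another block, or `r` succeeds
      -- with it. Each of them ends at the hub.
      (.plus
        (.plus (.comp (.test 2 (orCond v m)) (.letter 2))
          (.comp (.letter 2) (.test 2 (.ne (v 0)))))
        (.comp (.letter 2) (.comp (.letter 2) r)))
      -- The binding is still in force, so from the hub only the gadget of the next atom can be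
      -- reached and none can be skipped.
      (.test 3 (.eq (v (m + 1))))))) (.letter 4))

/-- Choose or iterate over the `k` atoms of a block. -/
def blockExpr (ex : Bool) : ℕ → ℕ → REWB (Fin 8) X → REWB (Fin 8) X
  | 0, _, r => r
  | k + 1, m, r => cond ex (exExpr v) (allExpr v) m (blockExpr ex k (m + 1) r)

/-- The query for the remaining blocks. -/
def queryExpr : Bool → List ℕ → ℕ → REWB (Fin 8) X
  | _, [], m => checkExpr v m
  | ex, k :: ks, m =>
    -- The tag is advanced by reading its old value and rebinding `v 0` to the value on the next
    -- edge.
    .comp (.test 6 (.eq (v 0))) (.bind 6 (v 0) (blockExpr v ex k m (queryExpr (!ex) ks (m + k))))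

/-- The query. -/
def mainExpr (ks : List ℕ) : REWB (Fin 8) X := .bind 6 (v 0) (queryExpr v true ks 0)

end Query

/-! ## The graph -/

/-- The edges for `ℓ` blocks, with `c` the first node. -/
def blockEdges (c : ℕ) : ℕ → List (ℕ × Fin 8 × ℕ × ℕ)
  | 0 => []
  -- Whoever holds the value `c` is led to node `c`, and from there the only edge with letter 6
  -- carries `c + 1`: the two edges form a counter.
  | l + 1 => (0, 6, c, c) :: (c, 6, c + 1, 0) :: blockEdges (c + 1) l

/-- The edges for the atoms from `i` on, with the given blocks, where `c` is the first node. -/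
def atomEdges (c i : ℕ) : List ℕ → List (ℕ × Fin 8 × ℕ × ℕ)
  | [] => []
  | b :: bs =>
    -- The tag `b + 4` is the value of `v 0` inside block `b`, because the counter starts at 3 and
    -- is advanced on entering a block.
    (0, 5, 0, c) :: (c, 2, i, c + 1) :: (c + 1, 2, i, c + 2) :: (c + 2, 2, b + 4, 0) ::
      (0, 3, i, c + 3) :: atomEdges (c + 3) (i + 1) bs

/-- The number of nodes set aside for a formula. -/
def formNodes {n : ℕ} : BForm n → ℕ
  | .atom _ => 0
  | .neg φ => formNodes φ
  | .conj φ ψ => formNodes φ + formNodes ψ + 1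
  | .disj φ ψ => formNodes φ + formNodes ψ + 1

/-- The series-parallel graph from `s` to `t` of a formula or its negation, where `f` is the first
fresh node. -/
def formEdges {n : ℕ} : BForm n → Bool → ℕ → ℕ → ℕ → List (ℕ × Fin 8 × ℕ × ℕ)
  | .atom p, pol, s, t, _ => [(s, cond pol 0 1, p, t)]
  | .neg φ, pol, s, t, f => formEdges φ (!pol) s t f
  -- A negated conjunction is a parallel connection. The node `f` is then set aside but not used, so
  -- the number of nodes does not depend on the polarity.
  | .conj φ ψ, pol, s, t, f =>
    formEdges φ pol s (cond pol f t) (f + 1) ++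
      formEdges ψ pol (cond pol f s) t (f + 1 + formNodes φ)
  | .disj φ ψ, pol, s, t, f =>
    formEdges φ pol s (cond pol t f) (f + 1) ++
      formEdges ψ pol (cond pol s f) t (f + 1 + formNodes φ)

/-- The edges of the data graph. -/
def graphEdges {n : ℕ} (l : ℕ) (bs : List ℕ) (φ : BForm n) : List (ℕ × Fin 8 × ℕ × ℕ) :=
  -- Node 0 is the hub and the source of the formula graph, node 1 is the sink of that graph, and
  -- the whole query starts at node 2.
  (1, 7, 0, 0) :: (2, 6, 3, 0) :: (blockEdges 3 l ++ (0, 4, 0, 3 + l) ::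
    (atomEdges (3 + l) 0 bs ++ (3 + l + 3 * bs.length, 4, 0, 0) ::
      formEdges φ true 0 1 (3 + l + 3 * bs.length + 1)))

/-- The number of nodes of the data graph. -/
def graphNodes {n : ℕ} (l : ℕ) (bs : List ℕ) (φ : BForm n) : ℕ :=
  3 + l + 3 * bs.length + 1 + formNodes φ

theorem mem_blockEdges {c l : ℕ} {e : ℕ × Fin 8 × ℕ × ℕ} :
    e ∈ blockEdges c l ↔ ∃ j < l, e = (0, 6, c + j, c + j) ∨ e = (c + j, 6, c + j + 1, 0) := by
  induction l generalizing c with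
  | zero => simp [blockEdges]
  | succ l ih =>
    simp only [blockEdges, List.mem_cons, ih]
    constructor
    · rintro (h | h | ⟨j, hj, h⟩)
      · exact ⟨0, by omega, Or.inl h⟩
      · exact ⟨0, by omega, Or.inr h⟩
      · exact ⟨j + 1, by omega, by rwa [show c + (j + 1) = c + 1 + j by omega]⟩
    · rintro ⟨_ | j, hj, h⟩
      · tauto
      · exact Or.inr (Or.inr ⟨j, by omega, by rwa [show c + 1 + j = c + (j + 1) by omega]⟩)

theorem mem_atomEdges {c i : ℕ} {bs : List ℕ} {e : ℕ × Fin 8 × ℕ × ℕ} :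
    e ∈ atomEdges c i bs ↔ ∃ j b, bs[j]? = some b ∧
      (e = (0, 5, 0, c + 3 * j) ∨ e = (c + 3 * j, 2, i + j, c + 3 * j + 1) ∨
        e = (c + 3 * j + 1, 2, i + j, c + 3 * j + 2) ∨ e = (c + 3 * j + 2, 2, b + 4, 0) ∨
        e = (0, 3, i + j, c + 3 * j + 3)) := by
  induction bs generalizing c i with
  | nil => simp [atomEdges]
  | cons b bs ih =>
    simp only [atomEdges, List.mem_cons, ih]
    constructor
    · rintro (h | h | h | h | h | ⟨j, b', hj, h⟩)
      iterate 5 exact ⟨0, b, rfl, by simp [h]⟩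
      refine ⟨j + 1, b', by simpa using hj, ?_⟩
      rwa [show c + 3 * (j + 1) = c + 3 + 3 * j by omega, show i + (j + 1) = i + 1 + j by omega]
    · rintro ⟨_ | j, b', hj, h⟩
      · simp only [List.getElem?_cons_zero, Option.some.injEq] at hj
        subst hj
        simp only [Nat.mul_zero, Nat.add_zero] at h
        tauto
      · refine Or.inr (Or.inr (Or.inr (Or.inr (Or.inr ⟨j, b', by simpa using hj, ?_⟩))))
        rwa [show c + 3 * (j + 1) = c + 3 + 3 * j by omega,
          show i + (j + 1) = i + 1 + j by omega] at h

theorem letter_of_mem_formEdges {n : ℕ} {φ : BForm n} {pol : Bool} {s t f u d v : ℕ} {a : Fin 8}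
    (h : (u, a, d, v) ∈ formEdges φ pol s t f) : a = 0 ∨ a = 1 := by
  induction φ generalizing pol s t f with
  | atom p => cases pol <;> simp_all [formEdges]
  | neg φ ih => exact ih h
  | conj φ ψ ih ih' => exact (List.mem_append.1 h).elim ih ih'
  | disj φ ψ ih ih' => exact (List.mem_append.1 h).elim ih ih'

theorem node_of_mem_formEdges {n : ℕ} {φ : BForm n} {pol : Bool} {s t f u d v : ℕ} {a : Fin 8}
    (h : (u, a, d, v) ∈ formEdges φ pol s t f) :
    (u = s ∨ f ≤ u ∧ u < f + formNodes φ) ∧ (v = t ∨ f ≤ v ∧ v < f + formNodes φ) := by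
  induction φ generalizing pol s t f with
  | atom p => cases pol <;> simp_all [formEdges]
  | neg φ ih => exact ih h
  | conj φ ψ ih ih' =>
    rcases List.mem_append.1 h with h | h
    · have := ih h
      cases pol <;> simp only [cond_true, cond_false, formNodes] at this ⊢ <;> omega
    · have := ih' h
      cases pol <;> simp only [cond_true, cond_false, formNodes] at this ⊢ <;> omega
  | disj φ ψ ih ih' =>
    rcases List.mem_append.1 h with h | h
    · have := ih h
      cases pol <;> simp only [cond_true, cond_false, formNodes] at this ⊢ <;> omega
    · have := ih' h
      cases pol <;> simp only [cond_true, cond_false, formNodes] at this ⊢ <;> omega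

-- Reachability in the graph of a formula

/-- A step in the graph of a formula that is allowed if exactly the atoms in `T` are true. -/
def FormStep (E : Set (ℕ × Fin 8 × ℕ × ℕ)) (T : ℕ → Prop) (u v : ℕ) : Prop :=
  ∃ d, (u, 0, d, v) ∈ E ∧ T d ∨ (u, 1, d, v) ∈ E ∧ ¬ T d

/-- A series connection is traversed through both parts, a parallel one through a part with the
required truth value. `E` may contain further edges, which makes the induction hypotheses applicable
to the two parts. -/
theorem reflTransGen_formStep {n : ℕ} {E : Set (ℕ × Fin 8 × ℕ × ℕ)} {T : Finset (Fin n)}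
    {T' : ℕ → Prop} (hT : ∀ p : Fin n, T' p ↔ p ∈ T) (φ : BForm n) {pol : Bool} {s t f : ℕ}
    (hE : ∀ e ∈ formEdges φ pol s t f, e ∈ E) (h : φ.Holds T ↔ pol = true) :
    Relation.ReflTransGen (FormStep E T') s t := by
  induction φ generalizing pol s t f with
  | atom p =>
    refine .single ⟨p, ?_⟩
    simp only [BForm.Holds, ← hT] at h
    cases pol
    · exact Or.inr ⟨hE _ (by simp [formEdges]), by simpa using h⟩
    · exact Or.inl ⟨hE _ (by simp [formEdges]), by simpa using h⟩
  | neg φ ih =>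
    refine ih hE ?_
    simp only [BForm.Holds] at h
    clear ih hE hT; cases pol <;> simp_all
  | conj φ ψ ih ih' =>
    simp only [formEdges, List.mem_append] at hE
    simp only [BForm.Holds] at h
    cases pol
    · by_cases hφ : φ.Holds T
      · exact ih' (fun e he => hE e (Or.inr he)) (by clear ih ih' hE hT; simp_all)
      · exact ih (fun e he => hE e (Or.inl he)) (by clear ih ih' hE hT; simp_all)
    · exact (ih (fun e he => hE e (Or.inl he)) (by clear ih ih' hE hT; simp_all)).trans
        (ih' (fun e he => hE e (Or.inr he)) (by clear ih ih' hE hT; simp_all))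
  | disj φ ψ ih ih' =>
    simp only [formEdges, List.mem_append] at hE
    simp only [BForm.Holds] at h
    cases pol
    · exact (ih (fun e he => hE e (Or.inl he)) (by clear ih ih' hE hT; simp_all)).trans
        (ih' (fun e he => hE e (Or.inr he)) (by clear ih ih' hE hT; simp_all))
    · by_cases hφ : φ.Holds T
      · exact ih (fun e he => hE e (Or.inl he)) (by clear ih ih' hE hT; simp_all)
      · exact ih' (fun e he => hE e (Or.inr he)) (by clear ih ih' hE hT; simp_all)

/-- The series connection of two graphs that transfer truth transfers truth, and so does their
parallel connection. -/
theorem exists_closed {n : ℕ} {T : Finset (Fin n)} {T' : ℕ → Prop}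
    (hT : ∀ p : Fin n, T' p ↔ p ∈ T) (φ : BForm n) {pol : Bool} {s t f : ℕ} (hs : s < f)
    (ht : t < f) (U : ℕ → Prop) (hU : U s → (φ.Holds T ↔ pol = true) → U t) :
    ∃ U' : ℕ → Prop, (∀ x, x < f ∨ f + formNodes φ ≤ x → (U' x ↔ U x)) ∧
      ∀ x y, FormStep {e | e ∈ formEdges φ pol s t f} T' x y → U' x → U' y := by
  -- Both connections at once: `t₁ = s₂ = f` gives the series connection, `t₁ = t` and `s₂ = s` the
  -- parallel one. The set is extended over the fresh nodes of `φ` and then over those of `ψ`.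
  have series : ∀ (φ ψ : BForm n) (pol : Bool) (s t f : ℕ), s < f → t < f →
      (∀ (s t f : ℕ), s < f → t < f → ∀ (U : ℕ → Prop),
        (U s → (φ.Holds T ↔ pol = true) → U t) →
        ∃ U' : ℕ → Prop, (∀ x, x < f ∨ f + formNodes φ ≤ x → (U' x ↔ U x)) ∧
        ∀ x y, FormStep {e | e ∈ formEdges φ pol s t f} T' x y → U' x → U' y) →
      (∀ (s t f : ℕ), s < f → t < f → ∀ (U : ℕ → Prop),
        (U s → (ψ.Holds T ↔ pol = true) → U t) →
        ∃ U' : ℕ → Prop, (∀ x, x < f ∨ f + formNodes ψ ≤ x → (U' x ↔ U x)) ∧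
        ∀ x y, FormStep {e | e ∈ formEdges ψ pol s t f} T' x y → U' x → U' y) →
      ∀ (t₁ s₂ : ℕ), (t₁ = f ∨ t₁ = t) → (s₂ = f ∨ s₂ = s) → ∀ (U : ℕ → Prop),
        (U s → (φ.Holds T ↔ pol = true) → U t₁) → (U s₂ → (ψ.Holds T ↔ pol = true) → U t) →
        ∃ U' : ℕ → Prop, (∀ x, x < f + 1 ∨ f + (formNodes φ + formNodes ψ + 1) ≤ x →
          (U' x ↔ U x)) ∧
        ∀ x y, FormStep {e | e ∈ formEdges φ pol s t₁ (f + 1) ++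
          formEdges ψ pol s₂ t (f + 1 + formNodes φ)} T' x y → U' x → U' y := by
    intro φ ψ pol s t f hs ht ih ih' t₁ s₂ ht₁ hs₂ U h h'
    obtain ⟨U₁, h₁, c₁⟩ := ih s t₁ (f + 1) (by omega) (by omega) U h
    obtain ⟨U₂, h₂, c₂⟩ := ih' s₂ t (f + 1 + formNodes φ) (by omega) (by omega) U₁ (by
      rw [h₁ _ (Or.inl (by omega)), h₁ _ (Or.inl (by omega))]
      exact h')
    refine ⟨U₂, fun x hx => by rw [h₂ x (by omega), h₁ x (by omega)], ?_⟩
    rintro x y ⟨d, hd⟩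
    simp only [Set.mem_ofPred_eq, List.mem_append] at hd
    have key : FormStep {e | e ∈ formEdges φ pol s t₁ (f + 1)} T' x y ∨
        FormStep {e | e ∈ formEdges ψ pol s₂ t (f + 1 + formNodes φ)} T' x y := by
      rcases hd with ⟨hd | hd, hT⟩ | ⟨hd | hd, hT⟩
      · exact Or.inl ⟨d, Or.inl ⟨hd, hT⟩⟩
      · exact Or.inr ⟨d, Or.inl ⟨hd, hT⟩⟩
      · exact Or.inl ⟨d, Or.inr ⟨hd, hT⟩⟩
      · exact Or.inr ⟨d, Or.inr ⟨hd, hT⟩⟩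
    rcases key with key | key
    -- An edge of the first part avoids the fresh nodes of the second, so the second extension
    -- changes nothing at its ends.
    · have : (x = s ∨ f + 1 ≤ x ∧ x < f + 1 + formNodes φ) ∧
          (y = t₁ ∨ f + 1 ≤ y ∧ y < f + 1 + formNodes φ) := by
        obtain ⟨d, ⟨hd, -⟩ | ⟨hd, -⟩⟩ := key
        · exact node_of_mem_formEdges hd
        · exact node_of_mem_formEdges hd
      rw [h₂ x (by omega), h₂ y (by omega)]
      exact c₁ x y key
    · exact c₂ x y key
  induction φ generalizing pol s t f U with
  | atom p =>
    refine ⟨U, fun x _ => Iff.rfl, ?_⟩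
    rintro x y ⟨d, ⟨hd, hT'⟩ | ⟨hd, hT'⟩⟩ <;> cases pol <;>
      simp only [formEdges, Set.mem_ofPred_eq, List.mem_singleton, Prod.mk.injEq, cond_true,
        cond_false, zero_ne_one, one_ne_zero, false_and, and_false, true_and] at hd
    · obtain ⟨rfl, rfl, rfl⟩ := hd
      intro h
      exact hU h (by simpa [BForm.Holds] using (hT p).1 hT')
    · obtain ⟨rfl, rfl, rfl⟩ := hd
      intro h
      exact hU h (by simpa [BForm.Holds] using fun h => hT' ((hT p).2 h))
  | neg φ ih =>
    refine ih hs ht U fun h h' => hU h ?_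
    simp only [BForm.Holds]
    clear ih series hU hT; cases pol <;> simp_all
  | conj φ ψ ih ih' =>
    simp only [BForm.Holds] at hU
    cases pol
    · obtain ⟨U', h, c⟩ := series φ ψ false s t f hs ht (fun s t f hs ht U hU => ih hs ht U hU)
        (fun s t f hs ht U hU => ih' hs ht U hU) t s (Or.inr rfl) (Or.inr rfl) U
        (fun h h' => hU h (by clear ih ih' series hU hT; simp_all)) (fun h h' => hU h (by clear ih ih' series hU hT; simp_all))
      exact ⟨U', fun x hx => h x (by simp only [formNodes] at hx; omega), c⟩
    · obtain ⟨U', h, c⟩ := series φ ψ true s t f hs ht (fun s t f hs ht U hU => ih hs ht U hU)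
        (fun s t f hs ht U hU => ih' hs ht U hU) f f (Or.inl rfl) (Or.inl rfl)
        -- The middle node belongs to the set iff the source does and the first part lets it
        -- through.
        (Function.update U f (U s ∧ φ.Holds T))
        (by
          rw [Function.update_self, Function.update_of_ne (by omega)]
          exact fun h h' => ⟨h, by simpa using h'⟩)
        (by
          rw [Function.update_self, Function.update_of_ne (by omega)]
          exact fun h h' => hU h.1 (by clear ih ih' series hU hT; simp_all))
      refine ⟨U', fun x hx => ?_, c⟩
      simp only [formNodes] at hx
      rw [h x (by omega), Function.update_of_ne (by omega)]
  | disj φ ψ ih ih' =>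
    simp only [BForm.Holds] at hU
    cases pol
    · obtain ⟨U', h, c⟩ := series φ ψ false s t f hs ht (fun s t f hs ht U hU => ih hs ht U hU)
        (fun s t f hs ht U hU => ih' hs ht U hU) f f (Or.inl rfl) (Or.inl rfl)
        (Function.update U f (U s ∧ ¬ φ.Holds T))
        (by
          rw [Function.update_self, Function.update_of_ne (by omega)]
          exact fun h h' => ⟨h, by simpa using h'⟩)
        (by
          rw [Function.update_self, Function.update_of_ne (by omega)]
          exact fun h h' => hU h.1 (by clear ih ih' series hU hT; simp_all))
      refine ⟨U', fun x hx => ?_, c⟩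
      simp only [formNodes] at hx
      rw [h x (by omega), Function.update_of_ne (by omega)]
    · obtain ⟨U', h, c⟩ := series φ ψ true s t f hs ht (fun s t f hs ht U hU => ih hs ht U hU)
        (fun s t f hs ht U hU => ih' hs ht U hU) t s (Or.inr rfl) (Or.inr rfl) U
        (fun h h' => hU h (by clear ih ih' series hU hT; simp_all)) (fun h h' => hU h (by clear ih ih' series hU hT; simp_all))
      exact ⟨U', fun x hx => h x (by simp only [formNodes] at hx; omega), c⟩

theorem reflTransGen_formStep_iff {n : ℕ} {T : Finset (Fin n)} {T' : ℕ → Prop}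
    (hT : ∀ p : Fin n, T' p ↔ p ∈ T) (φ : BForm n) {s t f : ℕ} (hst : s ≠ t) (hs : s < f)
    (ht : t < f) :
    Relation.ReflTransGen (FormStep {e | e ∈ formEdges φ true s t f} T') s t ↔ φ.Holds T := by
  refine ⟨fun h => ?_, fun h => reflTransGen_formStep hT φ (fun _ he => he) (by simpa using h)⟩
  by_contra hφ
  -- The set `{s}` transfers truth vacuously because `φ` fails; its closed extension contains `s`
  -- but not `t`.
  obtain ⟨U, hU, c⟩ := exists_closed hT φ (pol := true) hs ht (fun x => x = s) (by simp [hφ])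
  have key : ∀ y, Relation.ReflTransGen (FormStep {e | e ∈ formEdges φ true s t f} T') s y →
      U y := by
    intro y h
    induction h with
    | refl => exact (hU s (Or.inl hs)).2 rfl
    | tail _ h ih => exact c _ _ h ih
  exact hst ((hU t (Or.inl ht)).1 (key t h)).symm

end REWBEval

namespace REWBEval

-- Edges of the data graph, letter by letter

section GraphEdges

variable {n l : ℕ} {bs : List ℕ} {φ : BForm n} {u d v : ℕ}

theorem mem_graphEdges_two : (u, 2, d, v) ∈ graphEdges l bs φ ↔ ∃ i b, bs[i]? = some b ∧
    (u = 3 + l + 3 * i ∧ d = i ∧ v = 3 + l + 3 * i + 1 ∨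
      u = 3 + l + 3 * i + 1 ∧ d = i ∧ v = 3 + l + 3 * i + 2 ∨
      u = 3 + l + 3 * i + 2 ∧ d = b + 4 ∧ v = 0) := by
  have h : ¬ (u, 2, d, v) ∈ formEdges φ true 0 1 (3 + l + 3 * bs.length + 1) := fun h => by
    simpa using letter_of_mem_formEdges h
  simp [graphEdges, mem_blockEdges, mem_atomEdges, h]

theorem mem_graphEdges_three : (u, 3, d, v) ∈ graphEdges l bs φ ↔
    ∃ i < bs.length, u = 0 ∧ d = i ∧ v = 3 + l + 3 * (i + 1) := by
  have h : ¬ (u, 3, d, v) ∈ formEdges φ true 0 1 (3 + l + 3 * bs.length + 1) := fun h => by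
    simpa using letter_of_mem_formEdges h
  simp only [graphEdges, mem_blockEdges, mem_atomEdges, h, List.mem_cons, List.mem_append]
  simp
  constructor
  · rintro ⟨⟨b, hb⟩, rfl, rfl⟩
    exact ⟨(List.getElem?_eq_some_iff.1 hb).1, rfl, by omega⟩
  · rintro ⟨hi, rfl, rfl⟩
    exact ⟨⟨_, List.getElem?_eq_getElem hi⟩, rfl, by omega⟩

theorem mem_graphEdges_four : (u, 4, d, v) ∈ graphEdges l bs φ ↔
    u = 0 ∧ d = 0 ∧ v = 3 + l ∨ u = 3 + l + 3 * bs.length ∧ d = 0 ∧ v = 0 := by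
  have h : ¬ (u, 4, d, v) ∈ formEdges φ true 0 1 (3 + l + 3 * bs.length + 1) := fun h => by
    simpa using letter_of_mem_formEdges h
  simp [graphEdges, mem_blockEdges, mem_atomEdges, h]

theorem mem_graphEdges_five : (u, 5, d, v) ∈ graphEdges l bs φ ↔
    ∃ i < bs.length, u = 0 ∧ d = 0 ∧ v = 3 + l + 3 * i := by
  have h : ¬ (u, 5, d, v) ∈ formEdges φ true 0 1 (3 + l + 3 * bs.length + 1) := fun h => by
    simpa using letter_of_mem_formEdges h
  simp only [graphEdges, mem_blockEdges, mem_atomEdges, h, List.mem_cons, List.mem_append]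
  simp
  constructor
  · rintro ⟨i, ⟨b, hb⟩, rfl, rfl, rfl⟩
    exact ⟨i, (List.getElem?_eq_some_iff.1 hb).1, rfl, rfl, rfl⟩
  · rintro ⟨i, hi, rfl, rfl, rfl⟩
    exact ⟨i, ⟨_, List.getElem?_eq_getElem hi⟩, rfl, rfl, rfl⟩

theorem mem_graphEdges_six : (u, 6, d, v) ∈ graphEdges l bs φ ↔
    u = 2 ∧ d = 3 ∧ v = 0 ∨
      ∃ j < l, u = 0 ∧ d = 3 + j ∧ v = 3 + j ∨ u = 3 + j ∧ d = 3 + j + 1 ∧ v = 0 := by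
  have h : ¬ (u, 6, d, v) ∈ formEdges φ true 0 1 (3 + l + 3 * bs.length + 1) := fun h => by
    simpa using letter_of_mem_formEdges h
  simp [graphEdges, mem_blockEdges, mem_atomEdges, h]

theorem mem_graphEdges_seven : (u, 7, d, v) ∈ graphEdges l bs φ ↔ u = 1 ∧ d = 0 ∧ v = 0 := by
  have h : ¬ (u, 7, d, v) ∈ formEdges φ true 0 1 (3 + l + 3 * bs.length + 1) := fun h => by
    simpa using letter_of_mem_formEdges h
  simp [graphEdges, mem_blockEdges, mem_atomEdges, h]

theorem mem_graphEdges_form {a : Fin 8} (ha : a = 0 ∨ a = 1) : (u, a, d, v) ∈ graphEdges l bs φ ↔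
    (u, a, d, v) ∈ formEdges φ true 0 1 (3 + l + 3 * bs.length + 1) := by
  rcases ha with rfl | rfl <;> simp [graphEdges, mem_blockEdges, mem_atomEdges]

end GraphEdges

/-! ## Correctness of the query -/

theorem orCond_sat {X : Type} {v : ℕ → X} {m d : ℕ} {ν : X → Option ℕ} :
    (orCond v m).Sat d ν ↔ ∃ i < m, ν (v (i + 1)) = some d := by
  induction m with
  | zero => simp [orCond, Cond.Sat]
  | succ m ih =>
    simp only [orCond, Cond.Sat, ih, Nat.lt_succ_iff_lt_or_eq]
    constructor
    · rintro (h | ⟨i, hi, h⟩)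
      · exact ⟨m, Or.inr rfl, h⟩
      · exact ⟨i, Or.inl hi, h⟩
    · rintro ⟨i, hi | rfl, h⟩
      · exact Or.inr ⟨i, hi, h⟩
      · exact Or.inl h

/-- The quantifiers of one block, atom by atom. -/
def PickHolds {n : ℕ} (block : Fin n → ℕ) (j : ℕ) (P : Finset (Fin n) → Prop) :
    Bool → ℕ → Finset (Fin n) → Prop
  | _, 0, T => P T
  | true, k + 1, T => ∃ p, block p = j ∧ p ∉ T ∧ PickHolds block j P true k (insert p T)
  | false, k + 1, T => ∀ p, block p = j → p ∉ T → PickHolds block j P false k (insert p T)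

/-- This is the induction step on the weight: an arbitrary member `x` is split off a nonempty set,
and erasing it is what makes the remainder disjoint from `insert x T`. -/
theorem exists_finset_iff {n : ℕ} {p : Fin n → Prop} {k : ℕ} {T : Finset (Fin n)}
    {P : Finset (Fin n) → Prop} :
    (∃ S : Finset (Fin n), (∀ x ∈ S, p x ∧ x ∉ T) ∧ S.card = k + 1 ∧ P (T ∪ S)) ↔
      ∃ x, p x ∧ x ∉ T ∧ ∃ S : Finset (Fin n), (∀ y ∈ S, p y ∧ y ∉ insert x T) ∧ S.card = k ∧
        P (insert x T ∪ S) := by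
  constructor
  · rintro ⟨S, hS, hk, h⟩
    obtain ⟨x, hx⟩ : S.Nonempty := Finset.card_pos.1 (by omega)
    refine ⟨x, (hS x hx).1, (hS x hx).2, S.erase x, fun y hy => ?_, ?_, ?_⟩
    · obtain ⟨hy, hy'⟩ := Finset.mem_erase.1 hy
      refine ⟨(hS y hy').1, ?_⟩
      rw [Finset.mem_insert, not_or]
      exact ⟨hy, (hS y hy').2⟩
    · rw [Finset.card_erase_of_mem hx, hk]
      rfl
    · rwa [Finset.insert_union, ← Finset.union_insert, Finset.insert_erase hx]
  · rintro ⟨x, hx, hxT, S, hS, hk, h⟩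
    have hxS : x ∉ S := fun h => (hS x h).2 (Finset.mem_insert_self _ _)
    refine ⟨insert x S, fun y hy => ?_, ?_, ?_⟩
    · rcases Finset.mem_insert.1 hy with rfl | hy
      · exact ⟨hx, hxT⟩
      · exact ⟨(hS y hy).1, fun h => (hS y hy).2 (Finset.mem_insert_of_mem h)⟩
    · rw [Finset.card_insert_of_notMem hxS, hk]
    · rwa [Finset.union_insert, ← Finset.insert_union]

theorem pickHolds_true {n : ℕ} {block : Fin n → ℕ} {j : ℕ} {P : Finset (Fin n) → Prop} {k : ℕ}
    {T : Finset (Fin n)} : PickHolds block j P true k T ↔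
      ∃ S : Finset (Fin n), (∀ p ∈ S, block p = j ∧ p ∉ T) ∧ S.card = k ∧ P (T ∪ S) := by
  induction k generalizing T with
  | zero => simp [PickHolds]
  | succ k ih => simp only [PickHolds, ih, exists_finset_iff]

/-- De Morgan duality leaves only the existential case to be translated into sets. -/
theorem pickHolds_false {n : ℕ} {block : Fin n → ℕ} {j : ℕ} {P : Finset (Fin n) → Prop} {k : ℕ}
    {T : Finset (Fin n)} : PickHolds block j P false k T ↔
      ¬ PickHolds block j (fun S => ¬ P S) true k T := by
  induction k generalizing T with
  | zero => simp [PickHolds]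
  | succ k ih => simp only [PickHolds, ih, not_exists, not_and]

/-- By `hT` the atoms in `T` lie in earlier blocks. Avoiding the growing set of chosen atoms then
only means that the picks of this block are distinct, so `k` picks amount to a subset of `k` atoms.
-/
theorem qHolds_cons {n : ℕ} {block : Fin n → ℕ} {φ : BForm n} {ex : Bool} {j k : ℕ} {ks : List ℕ}
    {T : Finset (Fin n)} (hT : ∀ p ∈ T, block p < j) :
    QHolds block φ ex j (k :: ks) T ↔
      PickHolds block j (QHolds block φ (!ex) (j + 1) ks) ex k T := by
  have h : ∀ S : Finset (Fin n), (∀ p ∈ S, block p = j ∧ p ∉ T) ↔ ∀ p ∈ S, block p = j :=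
    fun S => ⟨fun h p hp => (h p hp).1, fun h p hp => ⟨h p hp, fun hp' => by
      have := h p hp
      have := hT p hp'
      omega⟩⟩
  cases ex
  · rw [pickHolds_false, pickHolds_true]
    simp only [QHolds, h, Bool.not_false]
    push Not
    rfl
  · rw [pickHolds_true]
    simp only [QHolds, h, Bool.not_true]

-- Reachability by the parts of the query

section Correct

variable {n l K : ℕ} {X : Type} {v : ℕ → X} {bs : List ℕ} {φ : BForm n} {block : Fin n → ℕ}

/-- The variables for the first `m` atoms are bound to the atoms in `T`. -/
def Bound {X : Type} {n : ℕ} (v : ℕ → X) (m : ℕ) (T : Finset (Fin n)) (ν : X → Option ℕ) : Prop :=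
  ∀ d, (∃ i < m, ν (v (i + 1)) = some d) ↔ ∃ p ∈ T, (p : ℕ) = d

theorem Bound.mem_iff {m : ℕ} {T : Finset (Fin n)} {ν : X → Option ℕ} (h : Bound v m T ν)
    (p : Fin n) : (orCond v m).Sat (p : ℕ) ν ↔ p ∈ T := by
  rw [orCond_sat, h]
  constructor
  · rintro ⟨q, hq, h⟩
    rwa [← Fin.ext h]
  · exact fun h => ⟨p, h, rfl⟩

/-- This covers the rebinding of `v 0` and that of a variable beyond the first `m` atoms. -/
theorem Bound.congr {m : ℕ} {T : Finset (Fin n)} {ν ν' : X → Option ℕ} (h : Bound v m T ν)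
    (hν : ∀ i < m, ν' (v (i + 1)) = ν (v (i + 1))) : Bound v m T ν' := by
  intro d
  rw [← h d]
  exact exists_congr fun i => and_congr_right fun hi => by rw [hν i hi]

/-- Letters 0 and 1 occur only in the formula graph, so the star is reachability by allowed steps
there, and letter 7 forces it to stop at the sink. -/
theorem reach_checkExpr {m : ℕ} {T : Finset (Fin n)} {ν : X → Option ℕ} (h : Bound v m T ν)
    (u : ℕ) :
    Reach {e | e ∈ graphEdges l bs φ} (checkExpr v m) ν 0 u ↔ u = 0 ∧ φ.Holds T := by
  have e : Reach {e | e ∈ graphEdges l bs φ}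
      (.plus (.test 0 (orCond v m)) (.test 1 (.not (orCond v m)))) ν =
      FormStep {e | e ∈ formEdges φ true 0 1 (3 + l + 3 * bs.length + 1)}
        (fun d => (orCond v m).Sat d ν) := by
    funext x y
    apply propext
    simp only [reach_plus, reach_test, FormStep, Set.mem_ofPred_eq,
      mem_graphEdges_form (Or.inl rfl), mem_graphEdges_form (Or.inr rfl), Cond.Sat, exists_or]
    simp only [and_comm]
  rw [checkExpr, reach_comp]
  simp only [reach_star, e, reach_letter, Set.mem_ofPred_eq, mem_graphEdges_seven]
  rw [← reflTransGen_formStep_iff (T' := fun d => (orCond v m).Sat d ν) h.mem_iff φ zero_ne_one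
    (show 0 < 3 + l + 3 * bs.length + 1 by omega) (show 1 < 3 + l + 3 * bs.length + 1 by omega)]
  constructor
  · rintro ⟨_, h, -, rfl, -, rfl⟩
    exact ⟨rfl, h⟩
  · rintro ⟨rfl, h⟩
    exact ⟨1, h, 0, rfl, rfl, rfl⟩

variable [DecidableEq X]
  -- Injectivity is asked for only up to `K`, as `v` will take values in a set of `K + 1` variables.
  -- In `hbs`, the list of blocks is matched with the atoms.
  (hv : ∀ i j, i ≤ K → j ≤ K → v i = v j → i = j)
  (hbs : ∀ i b : ℕ, bs[i]? = some b ↔ ∃ p : Fin n, (p : ℕ) = i ∧ block p = b)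

include hv in
theorem Bound.insert {m : ℕ} {T : Finset (Fin n)} {ν : X → Option ℕ} (h : Bound v m T ν)
    (hm : m + 1 ≤ K) (p : Fin n) :
    Bound v (m + 1) (insert p T) (Function.update ν (v (m + 1)) (some (p : ℕ))) := by
  intro d
  have h₁ : ∀ i < m, Function.update ν (v (m + 1)) (some (p : ℕ)) (v (i + 1)) = ν (v (i + 1)) :=
    fun i hi => Function.update_of_ne (fun e => by
      have := hv _ _ (by omega) hm e
      omega) _ _
  constructor
  · rintro ⟨i, hi, hd⟩
    rcases Nat.lt_succ_iff_lt_or_eq.1 hi with hi | rfl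
    · rw [h₁ i hi] at hd
      obtain ⟨q, hq, rfl⟩ := (h d).1 ⟨i, hi, hd⟩
      exact ⟨q, Finset.mem_insert_of_mem hq, rfl⟩
    · rw [Function.update_self, Option.some.injEq] at hd
      exact ⟨p, Finset.mem_insert_self _ _, hd⟩
  · rintro ⟨q, hq, rfl⟩
    rcases Finset.mem_insert.1 hq with rfl | hq
    · exact ⟨m, by omega, Function.update_self _ _ _⟩
    · obtain ⟨i, hi, hd⟩ := (h q).2 ⟨q, hq, rfl⟩
      exact ⟨i, by omega, by rw [h₁ i hi, hd]⟩

section Steps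

include hbs

/-- Gadget nodes are told apart by their remainder modulo 3 relative to `3 + l`, so letter 2 is
deterministic inside a gadget. -/
theorem mem_graphEdges_first (p : Fin n) {d u : ℕ} :
    (3 + l + 3 * (p : ℕ), 2, d, u) ∈ graphEdges l bs φ ↔
      d = p ∧ u = 3 + l + 3 * (p : ℕ) + 1 := by
  rw [mem_graphEdges_two]
  constructor
  · rintro ⟨i, b, -, h⟩
    omega
  · rintro ⟨rfl, rfl⟩
    exact ⟨p, block p, (hbs _ _).2 ⟨p, rfl, rfl⟩, by omega⟩

theorem mem_graphEdges_second (p : Fin n) {d u : ℕ} :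
    (3 + l + 3 * (p : ℕ) + 1, 2, d, u) ∈ graphEdges l bs φ ↔
      d = p ∧ u = 3 + l + 3 * (p : ℕ) + 2 := by
  rw [mem_graphEdges_two]
  constructor
  · rintro ⟨i, b, -, h⟩
    omega
  · rintro ⟨rfl, rfl⟩
    exact ⟨p, block p, (hbs _ _).2 ⟨p, rfl, rfl⟩, by omega⟩

theorem mem_graphEdges_third (p : Fin n) {d u : ℕ} :
    (3 + l + 3 * (p : ℕ) + 2, 2, d, u) ∈ graphEdges l bs φ ↔ d = block p + 4 ∧ u = 0 := by
  rw [mem_graphEdges_two]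
  constructor
  · rintro ⟨i, b, hb, h⟩
    obtain ⟨q, rfl, rfl⟩ := (hbs _ _).1 hb
    have : (q : ℕ) = p := by omega
    rw [Fin.ext this] at h
    omega
  · rintro ⟨rfl, rfl⟩
    exact ⟨p, block p, (hbs _ _).2 ⟨p, rfl, rfl⟩, by omega⟩

theorem lt_length_iff {i : ℕ} : i < bs.length ↔ ∃ p : Fin n, (p : ℕ) = i := by
  constructor
  · intro h
    obtain ⟨p, hp, -⟩ := (hbs i _).1 (List.getElem?_eq_getElem h)
    exact ⟨p, hp⟩
  · rintro ⟨p, rfl⟩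
    exact (List.getElem?_eq_some_iff.1 ((hbs p _).2 ⟨p, rfl, rfl⟩)).1

end Steps

include hv hbs

/-- After the jump, the gadget determines the rest of the walk, and the two tests select a new atom
of the block. The clause `u = 0`, in hypothesis and conclusion, records the return to the hub and
lets such statements be nested. -/
theorem reach_exExpr {m j : ℕ} {T : Finset (Fin n)} {ν : X → Option ℕ} {r : REWB (Fin 8) X}
    {P : Finset (Fin n) → Prop} (h : Bound v m T ν) (hj : ν (v 0) = some (j + 4)) (hm : m + 1 ≤ K)
    (hr : ∀ p : Fin n, block p = j → ∀ u, Reach {e | e ∈ graphEdges l bs φ} r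
      (Function.update ν (v (m + 1)) (some (p : ℕ))) 0 u ↔ u = 0 ∧ P (insert p T)) (u : ℕ) :
    Reach {e | e ∈ graphEdges l bs φ} (exExpr v m r) ν 0 u ↔
      u = 0 ∧ ∃ p, block p = j ∧ p ∉ T ∧ P (insert p T) := by
  have h₀ : ∀ p : Fin n, Function.update ν (v (m + 1)) (some (p : ℕ)) (v 0) = some (j + 4) :=
    fun p => by
      rw [Function.update_of_ne, hj]
      intro e
      have := hv _ _ (by omega) hm e
      omega
  have h₁ : ∀ p : Fin n, (orCond v m).Sat (p : ℕ) (Function.update ν (v (m + 1)) (some (p : ℕ))) ↔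
      p ∈ T := fun p => by
    refine Bound.mem_iff (h.congr fun i hi => Function.update_of_ne ?_ _ _) p
    intro e
    have := hv _ _ (by omega) hm e
    omega
  rw [exExpr, reach_comp]
  simp only [reach_letter, reach_bind, reach_comp, reach_test, Set.mem_ofPred_eq,
    mem_graphEdges_five, lt_length_iff hbs]
  constructor
  · rintro ⟨_, ⟨_, _, ⟨p, rfl⟩, -, -, rfl⟩, d, _, hd, _, ⟨d', hd', hm'⟩, _, ⟨d'', hd'', hm''⟩, hu⟩
    obtain ⟨rfl, rfl⟩ := (mem_graphEdges_first hbs p).1 hd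
    obtain ⟨rfl, rfl⟩ := (mem_graphEdges_second hbs p).1 hm'
    obtain ⟨rfl, rfl⟩ := (mem_graphEdges_third hbs p).1 hm''
    rw [Cond.Sat, h₁] at hd'
    rw [Cond.Sat, h₀, Option.some.injEq] at hd''
    have hp : block p = j := by omega
    rw [hr p hp] at hu
    exact ⟨hu.1, p, hp, hd', hu.2⟩
  · rintro ⟨rfl, p, hp, hpT, hP⟩
    refine ⟨_, ⟨0, _, ⟨p, rfl⟩, trivial, rfl, rfl⟩, _, _, (mem_graphEdges_first hbs p).2 ⟨rfl, rfl⟩, _,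
      ⟨_, ?_, (mem_graphEdges_second hbs p).2 ⟨rfl, rfl⟩⟩, _,
      ⟨_, ?_, (mem_graphEdges_third hbs p).2 ⟨rfl, rfl⟩⟩, (hr p hp 0).2 ⟨rfl, hP⟩⟩
    · rwa [Cond.Sat, h₁]
    · rw [Cond.Sat, h₀, hp]

/-- The star acts as a universal quantifier: a round leads exactly from one gadget to the next, and
only if the atom is ineligible or `r` succeeds, while the star can be left only behind the last
gadget. -/
theorem reach_allExpr {m j : ℕ} {T : Finset (Fin n)} {ν : X → Option ℕ} {r : REWB (Fin 8) X}
    {P : Finset (Fin n) → Prop} (h : Bound v m T ν) (hj : ν (v 0) = some (j + 4)) (hm : m + 1 ≤ K)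
    (hr : ∀ p : Fin n, block p = j → ∀ u, Reach {e | e ∈ graphEdges l bs φ} r
      (Function.update ν (v (m + 1)) (some (p : ℕ))) 0 u ↔ u = 0 ∧ P (insert p T)) (u : ℕ) :
    Reach {e | e ∈ graphEdges l bs φ} (allExpr v m r) ν 0 u ↔
      u = 0 ∧ ∀ p, block p = j → p ∉ T → P (insert p T) := by
  have h₀ : ∀ p : Fin n, Function.update ν (v (m + 1)) (some (p : ℕ)) (v 0) = some (j + 4) :=
    fun p => by
      rw [Function.update_of_ne, hj]
      intro e
      have := hv _ _ (by omega) hm e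
      omega
  have h₁ : ∀ p : Fin n, (orCond v m).Sat (p : ℕ)
      (Function.update ν (v (m + 1)) (some (p : ℕ))) ↔ p ∈ T := fun p => by
    refine Bound.mem_iff (h.congr fun i hi => Function.update_of_ne ?_ _ _) p
    intro e
    have := hv _ _ (by omega) hm e
    omega
  rw [allExpr, reach_comp]
  -- Only the composition that ends in letter 4 is unfolded further; the body of the star stays
  -- opaque as `B`.
  simp only [reach_comp (s := .letter (4 : Fin 8)), reach_star, reach_letter, Set.mem_ofPred_eq,
    mem_graphEdges_four]
  generalize hB : REWB.bind (2 : Fin 8) (v (m + 1)) _ = B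
  have hBody : ∀ (p : Fin n) (w : ℕ),
      Reach {e | e ∈ graphEdges l bs φ} B ν (3 + l + 3 * (p : ℕ)) w ↔
        w = 3 + l + 3 * ((p : ℕ) + 1) ∧ (block p = j → p ∉ T → P (insert p T)) := by
    intro p w
    have h₂ : ∀ {x : ℕ}, (∃ d, (Cond.eq (v (m + 1))).Sat d
        (Function.update ν (v (m + 1)) (some (p : ℕ))) ∧ (x, 3, d, w) ∈ graphEdges l bs φ) ↔
        x = 0 ∧ w = 3 + l + 3 * ((p : ℕ) + 1) := by
      intro x
      simp only [Cond.Sat, Function.update_self, Option.some.injEq, mem_graphEdges_three]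
      constructor
      · rintro ⟨_, rfl, i, -, rfl, rfl, rfl⟩
        exact ⟨rfl, rfl⟩
      · rintro ⟨rfl, rfl⟩
        exact ⟨_, rfl, p, (lt_length_iff hbs).2 ⟨p, rfl⟩, rfl, rfl, rfl⟩
    rw [← hB]
    simp only [reach_bind, reach_comp, reach_plus, reach_letter, reach_test, Set.mem_ofPred_eq]
    constructor
    · rintro ⟨_, _, hd, x, hx, hw⟩
      obtain ⟨rfl, rfl⟩ := (mem_graphEdges_first hbs p).1 hd
      obtain ⟨rfl, rfl⟩ := h₂.1 hw
      refine ⟨rfl, fun hp hpT => ?_⟩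
      rcases hx with (⟨_, ⟨_, hd', hm'⟩, -⟩ | ⟨_, ⟨_, hm'⟩, _, hd'', hm''⟩) |
        ⟨_, ⟨_, hm'⟩, _, ⟨_, hm''⟩, hx⟩
      · obtain ⟨rfl, rfl⟩ := (mem_graphEdges_second hbs p).1 hm'
        exact absurd ((h₁ p).1 hd') hpT
      · obtain ⟨rfl, rfl⟩ := (mem_graphEdges_second hbs p).1 hm'
        obtain ⟨rfl, -⟩ := (mem_graphEdges_third hbs p).1 hm''
        rw [Cond.Sat, h₀, hp] at hd''
        exact absurd rfl hd''
      · obtain ⟨rfl, rfl⟩ := (mem_graphEdges_second hbs p).1 hm'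
        obtain ⟨rfl, rfl⟩ := (mem_graphEdges_third hbs p).1 hm''
        exact ((hr p hp 0).1 hx).2
    · rintro ⟨rfl, hp⟩
      refine ⟨_, _, (mem_graphEdges_first hbs p).2 ⟨rfl, rfl⟩, 0, ?_, h₂.2 ⟨rfl, rfl⟩⟩
      have s₁ := (mem_graphEdges_second (l := l) (φ := φ) hbs p).2 ⟨rfl, rfl⟩
      have s₂ := (mem_graphEdges_third (l := l) (φ := φ) hbs p).2 ⟨rfl, rfl⟩
      by_cases hpT : p ∈ T
      · exact Or.inl (Or.inl ⟨_, ⟨_, (h₁ p).2 hpT, s₁⟩, _, s₂⟩)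
      by_cases hpj : block p = j
      · exact Or.inr ⟨_, ⟨_, s₁⟩, _, ⟨_, s₂⟩, (hr p hpj 0).2 ⟨rfl, hp hpj hpT⟩⟩
      · refine Or.inl (Or.inr ⟨_, ⟨_, s₁⟩, _, ?_, s₂⟩)
        rw [Cond.Sat, h₀, Ne, Option.some.injEq]
        omega
  -- No edge with letter 2 leaves the node behind the last gadget, so no round starts there.
  have hEnd : ∀ w, ¬ Reach {e | e ∈ graphEdges l bs φ} B ν (3 + l + 3 * bs.length) w := by
    intro w
    rw [← hB, reach_bind]
    rintro ⟨d, x, hd, -⟩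
    rw [Set.mem_ofPred_eq, mem_graphEdges_two] at hd
    obtain ⟨i, b, hb, hd⟩ := hd
    have := (List.getElem?_eq_some_iff.1 hb).1
    omega
  -- Invariant of the rounds: the walk stands at gadget `i` and the condition holds for every atom
  -- before `i`.
  have hForward : ∀ w, Relation.ReflTransGen (Reach {e | e ∈ graphEdges l bs φ} B ν) (3 + l) w →
      ∃ i ≤ bs.length, w = 3 + l + 3 * i ∧
        ∀ p : Fin n, (p : ℕ) < i → block p = j → p ∉ T → P (insert p T) := by
    intro w hw
    induction hw with
    | refl => exact ⟨0, Nat.zero_le _, by omega, fun p hp => by omega⟩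
    | tail _ hs ih =>
      obtain ⟨i, hi, rfl, hP⟩ := ih
      rcases hi.lt_or_eq with hi | rfl
      · obtain ⟨p, rfl⟩ := (lt_length_iff hbs).1 hi
        obtain ⟨rfl, hp⟩ := (hBody p _).1 hs
        refine ⟨p + 1, hi, rfl, fun q hq => ?_⟩
        rcases Nat.lt_succ_iff_lt_or_eq.1 hq with hq | hq
        · exact hP q hq
        · rwa [Fin.ext hq]
      · exact absurd hs (hEnd _)
  have hBackward : (∀ p, block p = j → p ∉ T → P (insert p T)) → ∀ i ≤ bs.length,
      Relation.ReflTransGen (Reach {e | e ∈ graphEdges l bs φ} B ν) (3 + l) (3 + l + 3 * i) := by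
    intro hP i
    induction i with
    | zero => exact fun _ => .refl
    | succ i ih =>
      intro hi
      obtain ⟨p, rfl⟩ := (lt_length_iff hbs).1 hi
      exact (ih (by omega)).tail ((hBody p _).2 ⟨rfl, hP p⟩)
  constructor
  · rintro ⟨x, ⟨d, hd⟩, w, hw, d', hd'⟩
    obtain rfl : x = 3 + l := by
      have : 0 < 3 + l + 3 * bs.length := by omega
      omega
    obtain ⟨i, hi, rfl, hP⟩ := hForward w hw
    obtain ⟨rfl, rfl⟩ : i = bs.length ∧ u = 0 := by omega
    exact ⟨rfl, fun p => hP p ((lt_length_iff hbs).2 ⟨p, rfl⟩)⟩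
  · rintro ⟨rfl, hP⟩
    exact ⟨3 + l, ⟨0, Or.inl ⟨trivial, rfl, rfl⟩⟩, _, hBackward hP _ le_rfl, 0,
      Or.inr ⟨rfl, rfl, rfl⟩⟩


/-- The continuation `r` must be understood for all `T'` and `ν'` that the choices within the block
can produce, as it is evaluated below their bindings. -/
theorem reach_blockExpr {m j k : ℕ} {ex : Bool} {T : Finset (Fin n)} {ν : X → Option ℕ}
    {r : REWB (Fin 8) X} {P : Finset (Fin n) → Prop} (h : Bound v m T ν)
    (hT : ∀ p ∈ T, block p < j + 1)
    (hj : ν (v 0) = some (j + 4)) (hm : m + k ≤ K)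
    (hr : ∀ T' ν', Bound v (m + k) T' ν' → (∀ p ∈ T', block p < j + 1) → ν' (v 0) = some (j + 4) →
      ∀ u, Reach {e | e ∈ graphEdges l bs φ} r ν' 0 u ↔ u = 0 ∧ P T') (u : ℕ) :
    Reach {e | e ∈ graphEdges l bs φ} (blockExpr v ex k m r) ν 0 u ↔
      u = 0 ∧ PickHolds block j P ex k T := by
  induction k generalizing m T ν u with
  | zero => cases ex <;> exact hr T ν h hT hj u
  | succ k ih =>
    have ih' : ∀ p : Fin n, block p = j → ∀ u, Reach {e | e ∈ graphEdges l bs φ}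
        (blockExpr v ex k (m + 1) r) (Function.update ν (v (m + 1)) (some (p : ℕ))) 0 u ↔
          u = 0 ∧ PickHolds block j P ex k (insert p T) := by
      intro p hp
      refine ih (h.insert hv (by omega) p) ?_ ?_ (by omega) ?_
      · intro q hq
        rcases Finset.mem_insert.1 hq with rfl | hq
        · omega
        · exact hT q hq
      · rw [Function.update_of_ne, hj]
        intro e
        have := hv _ _ (by omega) (by omega) e
        omega
      · rwa [show m + 1 + k = m + (k + 1) by omega]
    cases ex
    · exact reach_allExpr hv hbs h hj (by omega) ih' u
    · exact reach_exExpr hv hbs h hj (by omega) ih' u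

/-- The value `j + 3` of `v 0` announces block `j`. Reading letter 6 twice turns it into `j + 4`,
which is the tag of the atoms of block `j` and at the same time announces block `j + 1`. -/
theorem reach_queryExpr {m j : ℕ} {ex : Bool} {ks : List ℕ} {T : Finset (Fin n)}
    {ν : X → Option ℕ} (h : Bound v m T ν) (hT : ∀ p ∈ T, block p < j)
    (hj : ν (v 0) = some (j + 3)) (hm : m + ks.sum ≤ K) (hl : j + ks.length ≤ l) (u : ℕ) :
    Reach {e | e ∈ graphEdges l bs φ} (queryExpr v ex ks m) ν 0 u ↔
      u = 0 ∧ QHolds block φ ex j ks T := by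
  induction ks generalizing m j ex T ν u with
  | nil => cases ex <;> exact reach_checkExpr h u
  | cons k ks ih =>
    rw [List.sum_cons] at hm
    rw [List.length_cons] at hl
    rw [qHolds_cons hT, queryExpr, reach_comp]
    simp only [reach_test, reach_bind, Set.mem_ofPred_eq, Cond.Sat, hj, Option.some.injEq]
    have key := reach_blockExpr (ν := Function.update ν (v 0) (some (j + 4)))
      (r := queryExpr v (!ex) ks (m + k)) (φ := φ) (l := l) (k := k) (ex := ex) hv hbs
      (h.congr fun i hi => Function.update_of_ne (fun e => by
        have := hv _ _ (by omega) (by omega) e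
        omega) _ _) (fun p hp => (hT p hp).trans (Nat.lt_succ_self _)) (Function.update_self _ _ _)
      (by omega) (fun T' ν' h' hT' hj' => ih h' hT' hj' (by omega) (by omega)) u
    rw [← key]
    constructor
    · rintro ⟨_, ⟨_, rfl, hd⟩, d', x, hd', hr⟩
      rw [mem_graphEdges_six] at hd hd'
      obtain ⟨i, -, hd⟩ := hd.resolve_left (by omega)
      obtain ⟨i', -, hd'⟩ := hd'.resolve_left (by omega)
      obtain ⟨rfl, rfl⟩ : d' = j + 4 ∧ x = 0 := by omega
      exact hr
    · intro hr
      exact ⟨j + 3, ⟨_, rfl, mem_graphEdges_six.2 (Or.inr ⟨j, by omega, by omega⟩)⟩, j + 4, 0,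
        mem_graphEdges_six.2 (Or.inr ⟨j, by omega, by omega⟩), hr⟩

theorem reach_mainExpr {ks : List ℕ} (hm : ks.sum ≤ K) (hl : ks.length ≤ l) (ν : X → Option ℕ) :
    Reach {e | e ∈ graphEdges l bs φ} (mainExpr v ks) ν 2 0 ↔ QHolds block φ true 0 ks ∅ := by
  have key := reach_queryExpr (m := 0) (j := 0) (ex := true) (ks := ks) (T := ∅) (φ := φ) (l := l)
    (ν := Function.update ν (v 0) (some 3)) hv hbs (by intro d; simp) (by simp)
    (Function.update_self _ _ _) (by omega) (by omega) 0
  rw [eq_self, true_and] at key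
  rw [← key, mainExpr, reach_bind]
  constructor
  · rintro ⟨d, x, hd, hr⟩
    rw [Set.mem_ofPred_eq, mem_graphEdges_six] at hd
    rcases hd with ⟨-, rfl, rfl⟩ | ⟨i, -, hd⟩
    · exact hr
    · omega
  · exact fun hr => ⟨3, 0, mem_graphEdges_six.2 (Or.inl ⟨rfl, rfl, rfl⟩), hr⟩

end Correct

end REWBEval

namespace REWBEval

/-! ## Subroutines -/

namespace Prog

section Rules

variable {K G : Type} [DecidableEq K] {p q : Prog K G} {S S' S'' : K → List G} {t t' : ℕ}

theorem Runs.mono (h : Runs p S S' t) (ht : t ≤ t') : Runs p S S' t' := by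
  obtain ⟨u, hu, h⟩ := h
  exact ⟨u, hu.trans ht, h⟩

theorem Runs.congr (h : Runs p S S' t) (hS : S' = S'') (ht : t ≤ t') : Runs p S S'' t' :=
  hS ▸ h.mono ht

theorem Runs.seq (h : Runs p S S' t) (h' : Runs q S' S'' t') :
    Runs (.seq p q) S S'' (t + t') := by
  obtain ⟨u, hu, h⟩ := h
  obtain ⟨u', hu', h'⟩ := h'
  exact ⟨u + u', by omega, .seq h h'⟩

theorem runs_skip (S : K → List G) : Runs .skip S S 1 := ⟨1, le_rfl, .skip S⟩

theorem runs_push (S : K → List G) (k : K) (a : G) :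
    Runs (.push k a) S (Function.update S k (a :: S k)) 1 := ⟨1, le_rfl, .push S k a⟩

theorem runs_pop (k : K) {a : G} {l : List G} (h : S k = a :: l) :
    Runs (.pop k) S (Function.update S k l) 1 :=
  ⟨1, le_rfl, by simpa [h] using Run.pop S k⟩

theorem runs_ite_true {k : K} {c : Option G → Bool} (hc : c (S k).head? = true)
    (h : Runs p S S' t) : Runs (.ite k c p q) S S' (1 + t) := by
  obtain ⟨u, hu, h⟩ := h
  exact ⟨1 + u, by omega, .ite_true hc h⟩

theorem runs_ite_false {k : K} {c : Option G → Bool} (hc : c (S k).head? = false)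
    (h : Runs q S S' t) : Runs (.ite k c p q) S S' (1 + t) := by
  obtain ⟨u, hu, h⟩ := h
  exact ⟨1 + u, by omega, .ite_false hc h⟩

theorem runs_loop_done {k : K} {c : Option G → Bool} (hc : c (S k).head? = false) :
    Runs (.loop k c p) S S 1 := ⟨1, le_rfl, .loop_done hc⟩

theorem runs_loop_step {k : K} {c : Option G → Bool} (hc : c (S k).head? = true)
    (h : Runs p S S' t) (h' : Runs (.loop k c p) S' S'' t') :
    Runs (.loop k c p) S S'' (1 + (t + t')) := by
  obtain ⟨u, hu, h⟩ := h
  obtain ⟨u', hu', h'⟩ := h'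
  exact ⟨1 + (u + u'), by omega, .loop_step hc h h'⟩

/-- Remove symbols from the stack `k` as long as they satisfy `c`. -/
def drop (k : K) (c : Option G → Bool) : Prog K G := .loop k c (.pop k)

/-- Move symbols from the stack `k` to the stack `k'` as long as they satisfy `c`. -/
def transfer (k k' : K) (c : Option G → Bool) : Prog K G := .loop k c (.move k k')

theorem runs_drop {k : K} {c : Option G → Bool} {l r : List G} (hS : S k = l ++ r)
    (hl : ∀ a ∈ l, c (some a) = true) (hr : c r.head? = false) :
    Runs (drop k c) S (Function.update S k r) (2 * l.length + 1) := by
  induction l generalizing S with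
  | nil =>
    rw [List.nil_append] at hS
    subst hS
    rw [Function.update_eq_self]
    exact runs_loop_done hr
  | cons a l ih =>
    refine (runs_loop_step (by rw [hS]; exact hl a (by simp)) (runs_pop k hS)
      (ih (Function.update_self _ _ _) fun b hb => hl b (by simp [hb]))).congr (by simp) ?_
    simp
    omega

theorem runs_transfer {k k' : K} (hk : k ≠ k') {c : Option G → Bool} {l r : List G}
    (hS : S k = l ++ r) (hl : ∀ a ∈ l, c (some a) = true) (hr : c r.head? = false) :
    Runs (transfer k k' c) S (Function.update (Function.update S k r) k' (l.reverse ++ S k'))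
      (2 * l.length + 1) := by
  induction l generalizing S with
  | nil =>
    rw [List.nil_append] at hS
    subst hS
    simp only [Function.update_eq_self, List.reverse_nil, List.nil_append]
    exact runs_loop_done hr
  | cons a l ih =>
    refine (runs_loop_step (by rw [hS]; exact hl a (by simp)) ⟨1, le_rfl, .move S k k' hS⟩
      (ih (by rw [Function.update_of_ne hk, Function.update_self]; rfl)
        fun b hb => hl b (by simp [hb]))).congr ?_ ?_
    · rw [Function.update_comm hk.symm]
      simp [Function.update_of_ne hk.symm]
    · simp
      omega

end Rules

/-- The stack symbols are those used to write down instances and an extra one. -/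
abbrev SymOpt : Type := Option Sym

/-- The top of a stack is the symbol `s`. -/
def isSym (s : Sym) (o : Option SymOpt) : Bool := o == some (some s)

/-- A stack holding a number. -/
def ones (n : ℕ) : List SymOpt := List.replicate n (some Sym.one)

-- Copying numbers and writing texts

section Emit

variable {K : Type} [DecidableEq K]

/-- Push the number on the stack `k` to the stack `d`, with the help of the stack `aux`. -/
def copy (aux d k : K) : Prog K SymOpt :=
  .seq (.loop k (isSym .one) (.seq (.move k aux) (.push d (some .one))))
    (transfer aux k (isSym .one))

/-- The contents of `aux` and `d` are arbitrary, since in the induction a part of the number has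
already been moved. -/
theorem runs_copy_loop {aux d k : K} (h₁ : aux ≠ d) (h₂ : aux ≠ k) (h₃ : d ≠ k) {n : ℕ}
    {S : K → List SymOpt} (hk : S k = ones n) :
    Runs (.loop k (isSym .one) (.seq (.move k aux) (.push d (some .one)))) S
      (Function.update (Function.update (Function.update S k []) aux (ones n ++ S aux)) d
        (ones n ++ S d)) (3 * n + 1) := by
  induction n generalizing S with
  | zero =>
    simp only [ones, List.replicate_zero] at hk
    have : Function.update S k [] = S := by rw [← hk, Function.update_eq_self]
    simp only [ones, List.replicate_zero, List.nil_append, this, Function.update_eq_self]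
    exact runs_loop_done (by rw [hk]; rfl)
  | succ n ih =>
    have hk' : S k = some .one :: ones n := by rw [hk, ones, List.replicate_succ]; rfl
    refine (runs_loop_step (by rw [hk']; rfl)
      (Runs.seq ⟨1, le_rfl, .move S k aux hk'⟩ (runs_push _ d _))
      (ih (by simp [Function.update_of_ne, h₂.symm, h₃.symm]))).congr ?_ (by omega)
    funext j
    have hones : ∀ l : List SymOpt, ones n ++ some Sym.one :: l = ones (n + 1) ++ l := by
      intro l
      simp [ones, List.replicate_succ']
    by_cases hd : j = d
    · subst hd
      simp [Function.update_of_ne, h₁.symm, h₃, hones]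
    by_cases ha : j = aux
    · subst ha
      simp [Function.update_of_ne, hd, h₂, hones]
    by_cases hj : j = k
    · subst hj
      simp [Function.update_of_ne, hd, ha]
    · simp [Function.update_of_ne, hd, ha, hj]

theorem mem_ones {n : ℕ} {a : SymOpt} (h : a ∈ ones n) : a = some Sym.one :=
  List.eq_of_mem_replicate h

theorem reverse_ones (n : ℕ) : (ones n).reverse = ones n := List.reverse_replicate

/-- As `aux` is empty at first, the transfer back restores exactly the number that was on `k`. -/
theorem runs_copy {aux d k : K} (h₁ : aux ≠ d) (h₂ : aux ≠ k) (h₃ : d ≠ k) {n : ℕ}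
    {S : K → List SymOpt} (hk : S k = ones n) (ha : S aux = []) :
    Runs (copy aux d k) S (Function.update S d (ones n ++ S d)) (5 * n + 2) := by
  refine ((runs_copy_loop h₁ h₂ h₃ hk).seq (runs_transfer h₂ (l := ones n) (r := []) ?_
    (fun a ha => by rw [mem_ones ha]; rfl) rfl)).congr ?_ ?_
  · simp [Function.update_of_ne, h₁, ha]
  · funext j
    by_cases hj : j = k
    · subst hj
      simp [Function.update_of_ne, h₃.symm, h₂.symm, hk, reverse_ones]
    by_cases hj' : j = aux
    · subst hj'
      simp [Function.update_of_ne, h₁, h₂, ha]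
    by_cases hj'' : j = d
    · subst hj''
      simp [Function.update_of_ne, hj, hj']
    · simp [Function.update_of_ne, hj, hj', hj'']
  · simp [ones]
    omega

/-- A piece of text: a symbol or the number on a stack. -/
inductive Item (K : Type) : Type
  | lit (s : Sym)
  | num (k : K)

/-- The text described by a list of items. -/
def text (S : K → List SymOpt) : List (Item K) → List Sym
  | [] => []
  | .lit s :: l => s :: text S l
  | .num k :: l => List.replicate (S k).length Sym.one ++ text S l

/-- Push a text to the stack `d`. -/
def emit (aux d : K) : List (Item K) → Prog K SymOpt
  | [] => .skip
  | .lit s :: l => .seq (.push d (some s)) (emit aux d l)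
  | .num k :: l => .seq (copy aux d k) (emit aux d l)

theorem text_update {S : K → List SymOpt} {d : K} {x : List SymOpt} {l : List (Item K)}
    (hl : ∀ k, Item.num k ∈ l → d ≠ k) : text (Function.update S d x) l = text S l := by
  induction l with
  | nil => rfl
  | cons a l ih =>
    have ih := ih fun k hk => hl k (by simp [hk])
    cases a with
    | lit s => rw [text, text, ih]
    | num k => rw [text, text, ih, Function.update_of_ne (hl k (by simp)).symm]

theorem runs_emit {aux d : K} (h : aux ≠ d) {b : ℕ} {l : List (Item K)} {S : K → List SymOpt}
    (ha : S aux = [])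
    (hl : ∀ k, Item.num k ∈ l → aux ≠ k ∧ d ≠ k ∧ ∃ n ≤ b, S k = ones n) :
    Runs (emit aux d l) S (Function.update S d (((text S l).map some).reverse ++ S d))
      ((5 * b + 2) * l.length + 1) := by
  induction l generalizing S with
  | nil => simpa [text, emit] using runs_skip S
  | cons a l ih =>
    have key : ∀ x, Runs (emit aux d l) (Function.update S d x)
        (Function.update S d (((text S l).map some).reverse ++ x)) ((5 * b + 2) * l.length + 1) := by
      intro x
      refine (ih (S := Function.update S d x) ?_ ?_).congr ?_ le_rfl
      · rw [Function.update_of_ne h, ha]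
      · intro k hk
        obtain ⟨h₁, h₂, h₃⟩ := hl k (by simp [hk])
        exact ⟨h₁, h₂, by rwa [Function.update_of_ne h₂.symm]⟩
      · rw [text_update fun k hk => (hl k (by simp [hk])).2.1]
        simp
    cases a with
    | lit s =>
      refine ((runs_push S d (some s)).seq (key _)).congr (by simp [text]) ?_
      rw [List.length_cons]
      ring_nf
      omega
    | num k =>
      obtain ⟨h₁, h₂, n, hn, hk⟩ := hl k (by simp)
      refine ((runs_copy h h₁ h₂ hk ha).seq (key _)).congr ?_ ?_
      · simp [text, hk, ones]
      · rw [List.length_cons]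
        ring_nf
        omega

/-- Push `n` copies of the extra symbol to the stack `k`. -/
def pad (k : K) : ℕ → Prog K SymOpt
  | 0 => .skip
  | n + 1 => .seq (.push k none) (pad k n)

theorem runs_pad (k : K) (n : ℕ) (S : K → List SymOpt) :
    Runs (pad k n) S (Function.update S k (List.replicate n none ++ S k)) (n + 1) := by
  induction n generalizing S with
  | zero => simpa [pad] using runs_skip S
  | succ n ih =>
    refine ((runs_push S k none).seq (ih _)).congr ?_ (by omega)
    simp only [Function.update_self, Function.update_idem]
    rw [List.replicate_succ']
    simp

end Emit

end Prog

end REWBEval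

namespace REWBEval

open Prog

/-! ## The program computing the reduction: stacks -/

/-- The stacks: input, output, the edges and the expression written so far, the closing part of
the expression, the numbers of variables, nodes and atoms, the stack of pending subformulas, two
nodes, an auxiliary stack and the kind of the next quantifier. -/
inductive Stk : Type
  | inp | out | g | e | cl | m | c | p | fr | s | t | tmp | flag
  deriving DecidableEq

instance : Fintype Stk where
  elems := {.inp, .out, .g, .e, .cl, .m, .c, .p, .fr, .s, .t, .tmp, .flag}
  complete k := by cases k <;> decide

/-- The contents of the stacks; `g` and `e` are listed from the bottom to the top. There are `pad`
extra symbols at the bottom of the output stack. -/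
structure Conf : Type where
  inp : List SymOpt
  out : List Sym
  pad : ℕ
  g : List Sym
  e : List Sym
  cl : List Sym
  m : ℕ
  c : ℕ
  p : ℕ
  fr : List Sym
  s : ℕ
  t : ℕ
  tmp : ℕ
  flag : Bool

/-- The stacks as words. -/
def Conf.stk (S : Conf) : Stk → List SymOpt
  | .inp => S.inp
  | .out => S.out.map some ++ List.replicate S.pad none
  | .g => (S.g.map some).reverse
  | .e => (S.e.map some).reverse
  | .cl => S.cl.map some
  | .m => ones S.m
  | .c => ones S.c
  | .p => ones S.p
  | .fr => S.fr.map some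
  | .s => ones S.s
  | .t => ones S.t
  | .tmp => ones S.tmp
  | .flag => cond S.flag [some .one] []

/-- The program `p` leads from `S` to `S'` in at most `t` steps. -/
def Does (p : Prog Stk SymOpt) (S S' : Conf) (t : ℕ) : Prop := Runs p S.stk S'.stk t

section Rules

variable {p q : Prog Stk SymOpt} {S S' S'' : Conf} {t t' : ℕ}

theorem Does.mono (h : Does p S S' t) (ht : t ≤ t') : Does p S S' t' := Runs.mono h ht

theorem Does.congr (h : Does p S S' t) (hS : S' = S'') (ht : t ≤ t') : Does p S S'' t' :=
  hS ▸ h.mono ht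

theorem Does.seq (h : Does p S S' t) (h' : Does q S' S'' t') : Does (.seq p q) S S'' (t + t') :=
  Runs.seq h h'

theorem does_skip (S : Conf) : Does .skip S S 1 := runs_skip _

theorem does_ite {k : Stk} {c : Option SymOpt → Bool} (h : Does (cond (c (S.stk k).head?) p q) S S' t) :
    Does (.ite k c p q) S S' (1 + t) := by
  cases hc : c (S.stk k).head? with
  | false => exact runs_ite_false hc (by rwa [hc] at h)
  | true => exact runs_ite_true hc (by rwa [hc] at h)

theorem does_loop_done {k : Stk} {c : Option SymOpt → Bool} (hc : c (S.stk k).head? = false) :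
    Does (.loop k c p) S S 1 := runs_loop_done hc

theorem does_loop_step {k : Stk} {c : Option SymOpt → Bool} (hc : c (S.stk k).head? = true)
    (h : Does p S S' t) (h' : Does (.loop k c p) S' S'' t') :
    Does (.loop k c p) S S'' (1 + (t + t')) := runs_loop_step hc h h'

end Rules

-- Elementary programs on configurations

section Basic

variable (S : Conf)

theorem does_pop_inp {a : SymOpt} {l : List SymOpt} (h : S.inp = a :: l) :
    Does (.pop .inp) S { S with inp := l } 1 :=
  (runs_pop (S := S.stk) .inp (l := l) h).congr (by funext k; cases k <;> simp [Conf.stk]) le_rfl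

theorem does_pop_fr {a : Sym} {l : List Sym} (h : S.fr = a :: l) :
    Does (.pop .fr) S { S with fr := l } 1 :=
  (runs_pop (S := S.stk) .fr (a := some a) (l := l.map some) (by simp [Conf.stk, h])).congr
    (by funext k; cases k <;> simp [Conf.stk]) le_rfl

theorem does_push_m : Does (.push .m (some .one)) S { S with m := S.m + 1 } 1 :=
  (runs_push _ _ _).congr
    (by funext k; cases k <;> simp [Conf.stk, ones, List.replicate_succ]) le_rfl

theorem does_push_c : Does (.push .c (some .one)) S { S with c := S.c + 1 } 1 :=
  (runs_push _ _ _).congr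
    (by funext k; cases k <;> simp [Conf.stk, ones, List.replicate_succ]) le_rfl

theorem does_push_p : Does (.push .p (some .one)) S { S with p := S.p + 1 } 1 :=
  (runs_push _ _ _).congr
    (by funext k; cases k <;> simp [Conf.stk, ones, List.replicate_succ]) le_rfl

theorem does_push_out (a : Sym) : Does (.push .out (some a)) S { S with out := a :: S.out } 1 :=
  (runs_push _ _ _).congr (by funext k; cases k <;> simp [Conf.stk]) le_rfl

/-- Change the kind of the next quantifier. -/
def flip : Prog Stk SymOpt := .ite .flag (isSym .one) (.pop .flag) (.push .flag (some .one))

theorem does_flip : Does flip S { S with flag := !S.flag } 2 := by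
  refine does_ite (t := 1) ?_
  cases h : S.flag with
  | true =>
    have : isSym .one (S.stk .flag).head? = true := by simp [Conf.stk, h, isSym]
    rw [this]
    exact (runs_pop (S := S.stk) .flag (a := some .one) (l := []) (by simp [Conf.stk, h])).congr
      (by funext k; cases k <;> simp [Conf.stk]) le_rfl
  | false =>
    have : isSym .one (S.stk .flag).head? = false := by simp [Conf.stk, h, isSym]
    rw [this]
    exact (runs_push _ _ _).congr (by funext k; cases k <;> simp [Conf.stk, h]) le_rfl

theorem does_drop_inp {c : Option SymOpt → Bool} {l r : List SymOpt} (h : S.inp = l ++ r)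
    (hl : ∀ a ∈ l, c (some a) = true) (hr : c r.head? = false) :
    Does (drop .inp c) S { S with inp := r } (2 * l.length + 1) :=
  (runs_drop (S := S.stk) (k := .inp) (l := l) (r := r) h hl hr).congr (by funext k; cases k <;> simp [Conf.stk]) le_rfl

theorem does_drop_flag : Does (drop .flag Option.isSome) S { S with flag := false } 3 :=
  (runs_drop (S := S.stk) (k := .flag) (l := S.stk .flag) (r := []) (by simp) (fun _ _ => rfl)
    rfl).congr (by funext k; cases k <;> simp [Conf.stk])
    (by cases h : S.flag <;> simp [Conf.stk, h])

theorem does_drop_p : Does (drop .p Option.isSome) S { S with p := 0 } (2 * S.p + 1) :=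
  (runs_drop (S := S.stk) (k := .p) (l := S.stk .p) (r := []) (by simp) (fun _ _ => rfl)
    rfl).congr (by funext k; cases k <;> simp [Conf.stk, ones]) (by simp [Conf.stk, ones])

theorem does_drop_s : Does (drop .s Option.isSome) S { S with s := 0 } (2 * S.s + 1) :=
  (runs_drop (S := S.stk) (k := .s) (l := S.stk .s) (r := []) (by simp) (fun _ _ => rfl)
    rfl).congr (by funext k; cases k <;> simp [Conf.stk, ones]) (by simp [Conf.stk, ones])

theorem does_drop_t : Does (drop .t Option.isSome) S { S with t := 0 } (2 * S.t + 1) :=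
  (runs_drop (S := S.stk) (k := .t) (l := S.stk .t) (r := []) (by simp) (fun _ _ => rfl)
    rfl).congr (by funext k; cases k <;> simp [Conf.stk, ones]) (by simp [Conf.stk, ones])

theorem isSym_one_of_mem_ones {n : ℕ} : ∀ a ∈ ones n, isSym .one (some a) = true :=
  fun a ha => by rw [mem_ones ha]; rfl

theorem does_transfer_s_m :
    Does (transfer .s .m (isSym .one)) S { S with s := 0, m := S.s + S.m } (2 * S.s + 1) :=
  (runs_transfer (S := S.stk) (k := .s) (k' := .m) (by decide) (l := ones S.s) (r := [])
    (by simp [Conf.stk]) isSym_one_of_mem_ones rfl).congr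
    (by funext k; cases k <;> simp [Conf.stk, ones]) (by simp [ones])

theorem does_transfer_cl_e :
    Does (transfer .cl .e Option.isSome) S { S with cl := [], e := S.e ++ S.cl }
      (2 * S.cl.length + 1) :=
  (runs_transfer (S := S.stk) (k := .cl) (k' := .e) (by decide) (l := S.cl.map some) (r := [])
    (by simp [Conf.stk]) (fun _ _ => rfl) rfl).congr
    (by funext k; cases k <;> simp [Conf.stk]) (by simp)

theorem does_transfer_e_out :
    Does (transfer .e .out Option.isSome) S { S with e := [], out := S.e ++ S.out }
      (2 * S.e.length + 1) :=
  (runs_transfer (S := S.stk) (k := .e) (k' := .out) (by decide) (l := (S.e.map some).reverse)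
    (r := []) (by simp [Conf.stk]) (fun _ _ => rfl) rfl).congr
    (by funext k; cases k <;> simp [Conf.stk]) (by simp)

theorem does_transfer_g_out :
    Does (transfer .g .out Option.isSome) S { S with g := [], out := S.g ++ S.out }
      (2 * S.g.length + 1) :=
  (runs_transfer (S := S.stk) (k := .g) (k' := .out) (by decide) (l := (S.g.map some).reverse)
    (r := []) (by simp [Conf.stk]) (fun _ _ => rfl) rfl).congr
    (by funext k; cases k <;> simp [Conf.stk]) (by simp)

theorem does_transfer_c_out :
    Does (transfer .c .out Option.isSome) S { S with c := 0, out := List.replicate S.c .one ++ S.out }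
      (2 * S.c + 1) :=
  (runs_transfer (S := S.stk) (k := .c) (k' := .out) (by decide) (l := ones S.c)
    (r := []) (by simp [Conf.stk]) (fun _ _ => rfl) rfl).congr
    (by funext k; cases k <;> simp [Conf.stk, ones]) (by simp [ones])

theorem does_transfer_tmp_out :
    Does (transfer .tmp .out Option.isSome) S { S with tmp := 0, out := List.replicate S.tmp .one ++ S.out }
      (2 * S.tmp + 1) :=
  (runs_transfer (S := S.stk) (k := .tmp) (k' := .out) (by decide) (l := ones S.tmp)
    (r := []) (by simp [Conf.stk]) (fun _ _ => rfl) rfl).congr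
    (by funext k; cases k <;> simp [Conf.stk, ones]) (by simp [ones])

theorem does_transfer_inp_g {n : ℕ} {r : List SymOpt} (h : S.inp = ones n ++ r)
    (hr : isSym .one r.head? = false) :
    Does (transfer .inp .g (isSym .one)) S
      { S with inp := r, g := S.g ++ List.replicate n Sym.one } (2 * n + 1) :=
  (runs_transfer (S := S.stk) (k := .inp) (k' := .g) (by decide) (l := ones n) (r := r)
    (by simp [Conf.stk, h]) isSym_one_of_mem_ones hr).congr
    (by funext k; cases k <;> simp [Conf.stk, ones]) (by simp [ones])

theorem does_transfer_fr_s {n : ℕ} {r : List Sym} (h : S.fr = encNat n ++ r) (hs : S.s = 0) :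
    Does (transfer .fr .s (isSym .one)) S { S with fr := Sym.done :: r, s := n } (2 * n + 1) :=
  (runs_transfer (S := S.stk) (k := .fr) (k' := .s) (by decide) (l := ones n)
    (r := (Sym.done :: r).map some) (by simp [Conf.stk, h, encNat, ones]) isSym_one_of_mem_ones
    rfl).congr (by funext k; cases k <;> simp [Conf.stk, ones, hs]) (by simp [ones])

theorem does_transfer_fr_t {n : ℕ} {r : List Sym} (h : S.fr = encNat n ++ r) (hs : S.t = 0) :
    Does (transfer .fr .t (isSym .one)) S { S with fr := Sym.done :: r, t := n } (2 * n + 1) :=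
  (runs_transfer (S := S.stk) (k := .fr) (k' := .t) (by decide) (l := ones n)
    (r := (Sym.done :: r).map some) (by simp [Conf.stk, h, encNat, ones]) isSym_one_of_mem_ones
    rfl).congr (by funext k; cases k <;> simp [Conf.stk, ones, hs]) (by simp [ones])

theorem does_move_m_s {n : ℕ} (h : S.m = n + 1) :
    Does (.move .m .s) S { S with m := n, s := S.s + 1 } 1 :=
  Runs.congr ⟨1, le_rfl, Run.move S.stk .m .s (a := some .one) (l := ones n)
    (by simp [Conf.stk, h, ones, List.replicate_succ])⟩
    (by funext k; cases k <;> simp [Conf.stk, ones, List.replicate_succ]) le_rfl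

theorem does_move_m_tmp {n : ℕ} (h : S.m = n + 1) :
    Does (.move .m .tmp) S { S with m := n, tmp := S.tmp + 1 } 1 :=
  Runs.congr ⟨1, le_rfl, Run.move S.stk .m .tmp (a := some .one) (l := ones n)
    (by simp [Conf.stk, h, ones, List.replicate_succ])⟩
    (by funext k; cases k <;> simp [Conf.stk, ones, List.replicate_succ]) le_rfl

end Basic

/-! ## Texts -/

section Text

/-- Constant text. -/
def lits (l : List Sym) : List (Item Stk) := l.map .lit

/-- The code of the sum of the number on the stack `k` and `i`. -/
def nm (k : Stk) (i : ℕ) : List (Item Stk) := .num k :: lits (encNat i)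

/-- The code of an edge. -/
def rawEdge (e : ℕ × Fin 8 × ℕ × ℕ) : List Sym :=
  Sym.item :: (encNat e.1 ++ (encNat e.2.1 ++ (encNat e.2.2.1 ++ encNat e.2.2.2)))

variable {K : Type} (S : Stk → List SymOpt)

theorem text_append (l l' : List (Item Stk)) : text S (l ++ l') = text S l ++ text S l' := by
  induction l with
  | nil => rfl
  | cons a l ih => cases a <;> simp [text, ih]

theorem text_lits (l : List Sym) : text S (lits l) = l := by
  induction l with
  | nil => rfl
  | cons a l ih => rw [lits, List.map_cons, text, ← lits, ih]

theorem text_nm (k : Stk) (i : ℕ) : text S (nm k i) = encNat ((S k).length + i) := by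
  rw [nm, text, text_lits, encNat, encNat, ← List.append_assoc, List.replicate_append_replicate]

/-- The contribution of a symbol to the size of an expression. -/
def wt : Sym → ℕ
  | .one => 0
  | .done => 0
  | .item => 0
  -- `REWB.size` charges two for a binding; the numbers of letters and variables are not charged
  -- separately.
  | .bind => 2
  | _ => 1

/-- The contribution of a text to the size of an expression. -/
def weight (l : List Sym) : ℕ := (l.map wt).sum

theorem weight_append (l l' : List Sym) : weight (l ++ l') = weight l + weight l' := by
  simp [weight]

theorem weight_encNat (n : ℕ) : weight (encNat n) = 0 := by
  simp [weight, encNat, wt]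

/-- The contribution of an item to the size of an expression. -/
def itemWt : Item Stk → ℕ
  | .lit s => wt s
  | .num _ => 0

theorem weight_text (l : List (Item Stk)) : weight (text S l) = (l.map itemWt).sum := by
  induction l with
  | nil => rfl
  | cons a l ih =>
    cases a with
    | lit s => simp [text, itemWt, ← ih, weight]
    | num k => simp [text, itemWt, ← ih, weight, wt]

/-- The stacks whose numbers are copied. -/
def isCounter : Item Stk → Bool
  | .lit _ => true
  | .num .m => true
  | .num .c => true
  | .num .p => true
  | .num .s => true
  | .num .t => true
  | _ => false

end Text

/-- All numbers are bounded by `b`, and the auxiliary stack is empty,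
and so is the output apart from extra symbols. -/
structure Conf.Bdd (S : Conf) (b : ℕ) : Prop where
  m : S.m ≤ b
  c : S.c ≤ b
  p : S.p ≤ b
  s : S.s ≤ b
  t : S.t ≤ b
  tmp : S.tmp = 0
  out : S.out = []

theorem Conf.Bdd.counter {S : Conf} {b : ℕ} (h : S.Bdd b) {l : List (Item Stk)}
    (hl : l.all isCounter = true) {d : Stk} (hd : isCounter (.num d) = false) :
    ∀ k, Item.num k ∈ l → Stk.tmp ≠ k ∧ d ≠ k ∧ ∃ n ≤ b, S.stk k = ones n := by
  intro k hk
  have hk := List.all_eq_true.1 hl _ hk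
  refine ⟨?_, ?_, ?_⟩
  · rintro rfl
    simp [isCounter] at hk
  · rintro rfl
    rw [hd] at hk
    simp at hk
  · cases k <;> simp only [isCounter, Bool.false_eq_true] at hk
    exacts [⟨_, h.m, rfl⟩, ⟨_, h.c, rfl⟩, ⟨_, h.p, rfl⟩, ⟨_, h.s, rfl⟩, ⟨_, h.t, rfl⟩]

section Emit

variable {S : Conf} {b : ℕ} (h : S.Bdd b) {l : List (Item Stk)} (hl : l.all isCounter = true)

include h hl

theorem does_emit_g : Does (emit .tmp .g l) S { S with g := S.g ++ text S.stk l }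
    ((5 * b + 2) * l.length + 1) :=
  (runs_emit (by decide) (by simp [Conf.stk, h.tmp, ones]) (h.counter hl rfl)).congr
    (by funext k; cases k <;> simp [Conf.stk]) le_rfl

theorem does_emit_fr : Does (emit .tmp .fr l.reverse) S
    { S with fr := (text S.stk l.reverse).reverse ++ S.fr } ((5 * b + 2) * l.length + 1) :=
  (runs_emit (by decide) (by simp [Conf.stk, h.tmp, ones])
    (h.counter (by simpa using hl) rfl)).congr
    (by funext k; cases k <;> simp [Conf.stk]) (by simp)

end Emit

/-- Emitting leaves the last symbol on top. To have a text in reading order from the top, as on `cl`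
and `fr`, its items are emitted backwards; a number is a block of ones and equals its own reversal.
-/
theorem reverse_text_reverse (S : Stk → List SymOpt) (l : List (Item Stk)) :
    (text S l.reverse).reverse = text S l := by
  induction l with
  | nil => rfl
  | cons a l ih =>
    cases a with
    | lit s => simp [text_append, text, ih]
    | num k => simp [text_append, text, ih]

/-- Push text to the expression, and as many extra symbols to the output as it contributes to
the size. -/
def emitE (l : List (Item Stk)) : Prog Stk SymOpt :=
  .seq (emit .tmp .e l) (pad .out (l.map itemWt).sum)

/-- Push text to the closing part of the expression, and as many extra symbols to the output as it
contributes to the size. -/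
def emitCl (l : List (Item Stk)) : Prog Stk SymOpt :=
  .seq (emit .tmp .cl l.reverse) (pad .out (l.map itemWt).sum)

/-- The effect of writing text to the expression. -/
def Conf.write (S : Conf) (l : List Sym) : Conf :=
  { S with e := S.e ++ l, pad := S.pad + weight l }

/-- The effect of writing text to the closing part of the expression. -/
def Conf.writeCl (S : Conf) (l : List Sym) : Conf :=
  { S with cl := l ++ S.cl, pad := S.pad + weight l }

theorem sum_itemWt_le (l : List (Item Stk)) : (l.map itemWt).sum ≤ 2 * l.length := by
  induction l with
  | nil => simp
  | cons a l ih =>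
    have : itemWt a ≤ 2 := by
      rcases a with s | k
      · cases s <;> simp [itemWt, wt]
      · simp [itemWt]
    simp only [List.map_cons, List.sum_cons, List.length_cons]
    omega

/-- `pad` pushes on top of the output stack. This leaves the extra symbols below the later output
because `out` is still empty, as `Conf.Bdd` demands. -/
theorem does_emitE {S : Conf} {b : ℕ} (h : S.Bdd b) {l : List (Item Stk)}
    (hl : l.all isCounter = true) :
    Does (emitE l) S (S.write (text S.stk l)) ((5 * b + 4) * l.length + 2) := by
  refine Runs.congr (Runs.seq (runs_emit (b := b) (by decide) (by simp [Conf.stk, h.tmp, ones])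
    (h.counter hl rfl)) (runs_pad _ _ _)) ?_ ?_
  · rw [← weight_text S.stk]
    funext k
    cases k <;> simp [Conf.stk, Conf.write, h.out, Nat.add_comm]
  · have := sum_itemWt_le l
    ring_nf
    omega

theorem does_emitCl {S : Conf} {b : ℕ} (h : S.Bdd b) {l : List (Item Stk)}
    (hl : l.all isCounter = true) :
    Does (emitCl l) S (S.writeCl (text S.stk l)) ((5 * b + 4) * l.length + 2) := by
  refine Runs.congr (Runs.seq (runs_emit (b := b) (by decide) (by simp [Conf.stk, h.tmp, ones])
    (h.counter (by simpa using hl) rfl)) (runs_pad _ _ _)) ?_ ?_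
  · rw [← weight_text S.stk, ← reverse_text_reverse]
    funext k
    cases k <;> simp [Conf.stk, Conf.writeCl, h.out, Nat.add_comm]
  · have := sum_itemWt_le l
    rw [List.length_reverse]
    ring_nf
    omega

end REWBEval

namespace REWBEval

open Prog

/-! ## The program computing the reduction: the expression -/

/-- The code of `orCond`. -/
def orToks : ℕ → List Sym
  | 0 => [Sym.conj, Sym.eq, Sym.done, Sym.ne, Sym.done]
  | m + 1 => [Sym.disj, Sym.eq] ++ encNat (m + 1) ++ orToks m

/-- Write `orCond` for the number of variables bound so far. -/
def emitOr : Prog Stk SymOpt :=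
  .seq (.loop .m (isSym .one) (.seq (emitE (lits [Sym.disj, Sym.eq] ++ nm .m 0)) (.move .m .s)))
    (.seq (emitE (lits (orToks 0))) (transfer .s .m (isSym .one)))

theorem weight_cons (a : Sym) (l : List Sym) : weight (a :: l) = wt a + weight l := by
  simp [weight]

theorem Conf.write_write (S : Conf) (l l' : List Sym) :
    (S.write l).write l' = S.write (l ++ l') := by
  simp [Conf.write, weight_append, Nat.add_assoc]

theorem isSym_one_ones (n : ℕ) : isSym .one (ones n).head? = decide (0 < n) := by
  cases n <;> simp [ones, List.replicate_succ, isSym]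

/-- The counter `m` is emptied into `s` while its current value is written, which yields the
descending indices of `orCond`. The bound on `S.s + S.m`, invariant under the loop, keeps `s` within
`b`. -/
theorem does_emitOr_loop {S : Conf} {b : ℕ} (h : S.Bdd b) (hs : S.s + S.m ≤ b) :
    ∃ l, (l ++ orToks 0 = orToks S.m) ∧
    Does (.loop .m (isSym .one) (.seq (emitE (lits [Sym.disj, Sym.eq] ++ nm .m 0)) (.move .m .s))) S
      { S.write l with m := 0, s := S.s + S.m } (S.m * (20 * b + 20) + 1) := by
  obtain ⟨n, hn⟩ : ∃ n, n = S.m := ⟨_, rfl⟩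
  induction n generalizing S with
  | zero =>
    refine ⟨[], by rw [← hn]; rfl, (does_loop_done ?_).congr ?_ (by omega)⟩
    · rw [Conf.stk, isSym_one_ones, ← hn]
      rfl
    · obtain ⟨⟩ := S
      simp_all [Conf.write, weight]
  | succ n ih =>
    have h₁ := does_emitE h (l := lits [Sym.disj, Sym.eq] ++ nm .m 0) rfl
    have h₂ := does_move_m_s (S.write (text S.stk (lits [Sym.disj, Sym.eq] ++ nm .m 0))) hn.symm
    obtain ⟨l, hl, h₃⟩ := ih (S := { S.write (text S.stk (lits [Sym.disj, Sym.eq] ++ nm .m 0)) with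
      m := n, s := S.s + 1 }) ⟨by have := h.m; simp only; omega, h.c, h.p, by simp only; omega, h.t,
        h.tmp, h.out⟩ (by simp only; omega) rfl
    refine ⟨[Sym.disj, Sym.eq] ++ encNat (n + 1) ++ l, ?_,
      (does_loop_step ?_ (h₁.seq h₂) h₃).congr ?_ ?_⟩
    · rw [List.append_assoc, hl, ← hn, orToks]
    · rw [Conf.stk, isSym_one_ones, ← hn]
      simp
    · have : S.s + 1 + n = S.s + S.m := by omega
      simp [Conf.write, text_append, text_lits, text_nm, Conf.stk, ones, weight_append, ← hn,
        this, Nat.add_assoc, weight_cons, weight_encNat, wt]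
      omega
    · rw [← hn]
      simp [lits, nm, encNat]
      ring_nf
      omega

theorem does_emitOr {S : Conf} {b : ℕ} (h : S.Bdd b) (hs : S.s = 0) :
    Does emitOr S (S.write (orToks S.m)) (24 * (b + 1) ^ 2) := by
  have hm := h.m
  obtain ⟨l, hl, h₁⟩ := does_emitOr_loop h (by omega)
  have h₂ := does_emitE (S := { S.write l with m := 0, s := S.s + S.m }) (b := b)
    ⟨Nat.zero_le _, h.c, h.p, by simp only; omega, h.t, h.tmp, h.out⟩ (l := lits (orToks 0)) rfl
  refine (h₁.seq (h₂.seq (does_transfer_s_m _))).congr ?_ ?_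
  · rw [← hl]
    obtain ⟨⟩ := S
    simp_all [Conf.write, text_lits, Nat.add_assoc]
    rw [← hl, weight_append]
  · have := Nat.mul_le_mul_right (20 * b + 20) hm
    simp [lits, orToks, Conf.write, hs]
    nlinarith

/-- The code of `exExpr`, without the last subexpression. -/
def exToks (m : ℕ) : List Sym :=
  [Sym.comp, Sym.letter] ++ encNat 5 ++ [Sym.bind] ++ encNat 2 ++ encNat (m + 1) ++ [Sym.comp, Sym.test] ++
    encNat 2 ++ [Sym.neg] ++ orToks m ++ [Sym.comp, Sym.test] ++ encNat 2 ++ [Sym.eq] ++ encNat 0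

/-- The code of `allExpr` up to the innermost subexpression. -/
def allToks (m : ℕ) : List Sym :=
  Sym.comp :: Sym.letter :: (encNat 4 ++ Sym.comp :: Sym.star :: Sym.bind :: (encNat 2 ++
    (encNat (m + 1) ++ Sym.comp :: Sym.plus :: Sym.plus :: Sym.comp :: Sym.test :: (encNat 2 ++
    (orToks m ++ Sym.letter :: (encNat 2 ++ Sym.comp :: Sym.letter :: (encNat 2 ++
    Sym.test :: (encNat 2 ++ Sym.ne :: (encNat 0 ++ Sym.comp :: Sym.letter :: (encNat 2 ++
    Sym.comp :: Sym.letter :: encNat 2))))))))))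

/-- The code of `allExpr` after the innermost subexpression. -/
def allClose (m : ℕ) : List Sym :=
  [Sym.test] ++ encNat 3 ++ [Sym.eq] ++ encNat (m + 1) ++ [Sym.letter] ++ encNat 4

/-- Write the code for an existentially quantified atom. -/
def exProg : Prog Stk SymOpt :=
  .seq (emitE (lits ([Sym.comp, Sym.letter] ++ encNat 5 ++ [Sym.bind] ++ encNat 2) ++ nm .m 1 ++
    lits ([Sym.comp, Sym.test] ++ encNat 2 ++ [Sym.neg])))
  (.seq emitOr (emitE (lits ([Sym.comp, Sym.test] ++ encNat 2 ++ [Sym.eq] ++ encNat 0))))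

/-- Write the code for a universally quantified atom. -/
def allProg : Prog Stk SymOpt :=
  .seq (emitE (lits ([Sym.comp, Sym.letter] ++ encNat 4 ++ [Sym.comp, Sym.star, Sym.bind] ++ encNat 2) ++
    nm .m 1 ++ lits ([Sym.comp, Sym.plus, Sym.plus, Sym.comp, Sym.test] ++ encNat 2)))
  (.seq emitOr
  (.seq (emitE (lits ([Sym.letter] ++ encNat 2 ++ [Sym.comp, Sym.letter] ++ encNat 2 ++ [Sym.test] ++ encNat 2 ++
    [Sym.ne] ++ encNat 0 ++ [Sym.comp, Sym.letter] ++ encNat 2 ++ [Sym.comp, Sym.letter] ++ encNat 2)))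
  (emitCl (lits ([Sym.test] ++ encNat 3 ++ [Sym.eq]) ++ nm .m 1 ++ lits ([Sym.letter] ++ encNat 4)))))

theorem Conf.Bdd.write {S : Conf} {b : ℕ} (h : S.Bdd b) (l : List Sym) : (S.write l).Bdd b :=
  ⟨h.m, h.c, h.p, h.s, h.t, h.tmp, h.out⟩

theorem all_isCounter_lits (l : List Sym) : (lits l).all isCounter = true := by
  simp [lits, isCounter]

theorem all_isCounter_lits_nm_m (u v : List Sym) (i : ℕ) :
    (lits u ++ nm .m i ++ lits v).all isCounter = true := by
  simp [lits, nm, isCounter]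

theorem text_lits_nm_m (S : Conf) (u v : List Sym) (i : ℕ) :
    text S.stk (lits u ++ nm .m i ++ lits v) = u ++ encNat (S.m + i) ++ v := by
  simp [text_append, text_lits, text_nm, Conf.stk, ones]

section Write

variable {S : Conf} {b : ℕ} (h : S.Bdd b)

include h

theorem does_emitE_lits (w u : List Sym) {n : ℕ} (hn : u.length ≤ n) :
    Does (emitE (lits u)) (S.write w) (S.write (w ++ u)) ((5 * b + 4) * n + 2) := by
  refine (does_emitE (h.write w) (all_isCounter_lits u)).congr
    (by rw [text_lits, Conf.write_write]) ?_
  gcongr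
  simpa [lits]

theorem does_emitE_lits_nm_m (u v : List Sym) (i : ℕ) {n : ℕ}
    (hn : u.length + v.length + i + 2 ≤ n) :
    Does (emitE (lits u ++ nm .m i ++ lits v)) S (S.write (u ++ encNat (S.m + i) ++ v))
      ((5 * b + 4) * n + 2) := by
  refine (does_emitE h (all_isCounter_lits_nm_m u v i)).congr (by rw [text_lits_nm_m]) ?_
  gcongr
  simp [lits, nm, encNat]
  omega

theorem does_emitCl_lits_nm_m (w u v : List Sym) (i : ℕ) {n : ℕ}
    (hn : u.length + v.length + i + 2 ≤ n) :
    Does (emitCl (lits u ++ nm .m i ++ lits v)) (S.write w)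
      ((S.write w).writeCl (u ++ encNat (S.m + i) ++ v)) ((5 * b + 4) * n + 2) := by
  refine (does_emitCl (h.write w) (all_isCounter_lits_nm_m u v i)).congr
    (by rw [text_lits_nm_m]; rfl) ?_
  gcongr
  simp [lits, nm, encNat]
  omega

theorem does_emitOr_write (hs : S.s = 0) (w : List Sym) :
    Does emitOr (S.write w) (S.write (w ++ orToks S.m)) (24 * (b + 1) ^ 2) := by
  rw [← Conf.write_write]
  exact does_emitOr (h.write w) hs

end Write

theorem does_exProg {S : Conf} {b : ℕ} (h : S.Bdd b) (hs : S.s = 0) :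
    Does exProg S (S.write (exToks S.m)) (400 * (b + 1) ^ 2) := by
  refine Does.congr (Does.seq (does_emitE_lits_nm_m h _ _ _ (n := 30) ?_)
    (Does.seq (does_emitOr_write h hs _) (does_emitE_lits h _ _ (n := 10) ?_))) ?_ ?_
  · simp [encNat]
  · simp [encNat]
  · simp [exToks]
  · nlinarith

theorem does_allProg {S : Conf} {b : ℕ} (h : S.Bdd b) (hs : S.s = 0) :
    Does allProg S ((S.write (allToks S.m)).writeCl (allClose S.m)) (700 * (b + 1) ^ 2) := by
  refine Does.congr (Does.seq (does_emitE_lits_nm_m h _ _ _ (n := 30) ?_)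
    (Does.seq (does_emitOr_write h hs _) (Does.seq (does_emitE_lits h _ _ (n := 40) ?_)
    (does_emitCl_lits_nm_m h _ _ _ _ (n := 20) ?_)))) ?_ ?_
  · simp [encNat]
  · simp [encNat]
  · simp [encNat]
  · refine congrArg₂ (fun u v => (S.write u).writeCl v) ?_ ?_
    · simp only [allToks, List.append_assoc, List.cons_append, List.nil_append]
    · simp only [allClose, List.append_assoc, List.cons_append, List.nil_append]
  · nlinarith

/-- The code for one atom, up to the innermost subexpression. -/
def levToks (ex : Bool) (m : ℕ) : List Sym := cond ex (exToks m) (allToks m)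

/-- The code for one atom, after the innermost subexpression. -/
def levClose (ex : Bool) (m : ℕ) : List Sym := cond ex [] (allClose m)

/-- Write the code for one atom. -/
def levProg : Prog Stk SymOpt :=
  .seq (.pop .inp) (.seq (.ite .flag (isSym .one) exProg allProg) (.push .m (some .one)))

theorem does_levProg {S : Conf} {b : ℕ} (h : S.Bdd b) (hs : S.s = 0) {r : List SymOpt}
    (hr : S.inp = some .one :: r) :
    Does levProg S ({ (S.write (levToks S.flag S.m)).writeCl (levClose S.flag S.m) with
      inp := r, m := S.m + 1 }) (710 * (b + 1) ^ 2) := by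
  have h' : Conf.Bdd { S with inp := r } b := ⟨h.m, h.c, h.p, h.s, h.t, h.tmp, h.out⟩
  have key : Does (.ite .flag (isSym .one) exProg allProg) { S with inp := r }
      ((Conf.write { S with inp := r } (levToks S.flag S.m)).writeCl (levClose S.flag S.m))
      (1 + 700 * (b + 1) ^ 2) := by
    refine does_ite (t := 700 * (b + 1) ^ 2) ?_
    have hf : isSym .one (Conf.stk { S with inp := r } .flag).head? = S.flag := by
      simp only [Conf.stk]
      cases S.flag <;> rfl
    rw [hf]
    by_cases hf : S.flag = true
    · have : cond S.flag exProg allProg = exProg := by rw [hf]; rfl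
      rw [this]
      refine (does_exProg h' hs).congr ?_ (Nat.mul_le_mul_right _ (by norm_num))
      simp [levToks, levClose, Conf.write, Conf.writeCl, weight, hf]
    · have : cond S.flag exProg allProg = allProg := by rw [Bool.eq_false_of_not_eq_true hf]; rfl
      rw [this]
      refine (does_allProg h' hs).congr ?_ le_rfl
      simp [levToks, levClose, hf]
  refine ((does_pop_inp S hr).seq (key.seq (does_push_m _))).congr rfl ?_
  have := Nat.one_le_pow 2 (b + 1) (by omega)
  omega

/-- The code for `k` atoms, up to the innermost subexpression. -/
def blockToks (ex : Bool) : ℕ → ℕ → List Sym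
  | 0, _ => []
  | k + 1, m => levToks ex m ++ blockToks ex k (m + 1)

/-- The code for `k` atoms, after the innermost subexpression. -/
def blockClose (ex : Bool) : ℕ → ℕ → List Sym
  | 0, _ => []
  -- Inner subexpressions are closed before outer ones, which is the order in which a stack returns
  -- the closing parts.
  | k + 1, m => blockClose ex k (m + 1) ++ levClose ex m

theorem does_levProg_loop {S : Conf} {b k : ℕ} (h : S.Bdd b) (hs : S.s = 0) (hk : S.m + k ≤ b)
    {r : List SymOpt} (hS : S.inp = ones k ++ r) (hr : isSym .one r.head? = false) :
    Does (.loop .inp (isSym .one) levProg) S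
      ({ (S.write (blockToks S.flag k S.m)).writeCl (blockClose S.flag k S.m) with
        inp := r, m := S.m + k }) (k * (710 * (b + 1) ^ 2 + 1) + 1) := by
  induction k generalizing S with
  | zero =>
    obtain rfl : S.inp = r := hS
    refine (does_loop_done hr).congr ?_ (by omega)
    simp [Conf.write, Conf.writeCl, blockToks, blockClose, weight]
  | succ k ih =>
    have h₁ := does_levProg h hs (r := ones k ++ r)
      (by rw [hS, ones, List.replicate_succ]; rfl)
    have h₂ := ih (S := { (S.write (levToks S.flag S.m)).writeCl (levClose S.flag S.m) with
      inp := ones k ++ r, m := S.m + 1 })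
      ⟨by simp only; omega, h.c, h.p, h.s, h.t, h.tmp, h.out⟩ hs (by simp only; omega) rfl
    refine (does_loop_step ?_ h₁ h₂).congr ?_ (by ring_nf; omega)
    · rw [Conf.stk, hS, ones, List.replicate_succ]
      rfl
    · simp [Conf.write, Conf.writeCl, blockToks, blockClose, weight_append]
      omega

-- Writing a block of the query and the innermost check

/-- The code of an edge, where the nodes and the data value are given by texts. -/
def edgeText (u : List (Item Stk)) (a : ℕ) (d v : List (Item Stk)) : List (Item Stk) :=
  lits [Sym.item] ++ u ++ lits (encNat a) ++ d ++ v

/-- The code of the binding of the number of a block. -/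
def bumpToks : List Sym :=
  [Sym.comp, Sym.test] ++ encNat 6 ++ [Sym.eq] ++ encNat 0 ++ [Sym.bind] ++ encNat 6 ++ encNat 0

/-- Write the code for a block. -/
def blockProg : Prog Stk SymOpt :=
  .seq (.pop .inp)
  (.seq (emit .tmp .g (edgeText (lits (encNat 0)) 6 (nm .c 0) (nm .c 0) ++
    edgeText (nm .c 0) 6 (nm .c 1) (lits (encNat 0))))
  (.seq (.push .c (some .one))
  (.seq (emitE (lits bumpToks))
  (.seq (.loop .inp (isSym .one) levProg)
  (.seq (.pop .inp) flip)))))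

theorem does_blockProg {S : Conf} {b k : ℕ} (h : S.Bdd b) (hs : S.s = 0) (hk : S.m + k ≤ b)
    (hc : S.c + 1 ≤ b) {r : List SymOpt}
    (hS : S.inp = some Sym.item :: (encNat k).map some ++ r) :
    Does blockProg S
      ({ (S.write (bumpToks ++ blockToks S.flag k S.m)).writeCl (blockClose S.flag k S.m) with
        inp := r, m := S.m + k, c := S.c + 1, flag := !S.flag,
        g := S.g ++ (rawEdge (0, 6, S.c, S.c) ++ rawEdge (S.c, 6, S.c + 1, 0)) })
      (1000 * (b + 1) ^ 3) := by
  have h₁ := does_pop_inp S (l := (encNat k).map some ++ r) (by rw [hS]; rfl)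
  have b₁ : Conf.Bdd { S with inp := (encNat k).map some ++ r } b :=
    ⟨h.m, h.c, h.p, h.s, h.t, h.tmp, h.out⟩
  have h₂ := does_emit_g b₁ (l := edgeText (lits (encNat 0)) 6 (nm .c 0) (nm .c 0) ++
    edgeText (nm .c 0) 6 (nm .c 1) (lits (encNat 0))) (by simp [edgeText, lits, nm, isCounter])
  have h₃ := does_push_c { S with
    inp := (encNat k).map some ++ r,
    g := S.g ++ (rawEdge (0, 6, S.c, S.c) ++ rawEdge (S.c, 6, S.c + 1, 0)) }
  have h₄ := does_emitE (S := { S with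
    inp := (encNat k).map some ++ r, c := S.c + 1,
    g := S.g ++ (rawEdge (0, 6, S.c, S.c) ++ rawEdge (S.c, 6, S.c + 1, 0)) }) (b := b)
    ⟨h.m, hc, h.p, h.s, h.t, h.tmp, h.out⟩ (l := lits bumpToks) (all_isCounter_lits _)
  have h₅ := does_levProg_loop (S := Conf.write { S with
    inp := (encNat k).map some ++ r, c := S.c + 1,
    g := S.g ++ (rawEdge (0, 6, S.c, S.c) ++ rawEdge (S.c, 6, S.c + 1, 0)) } bumpToks) (b := b)
    (k := k) (r := some Sym.done :: r) ⟨h.m, hc, h.p, h.s, h.t, h.tmp, h.out⟩ hs hk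
    (by simp [Conf.write, encNat, ones]) rfl
  rw [text_lits] at h₄
  have e₂ : text (Conf.stk { S with inp := (encNat k).map some ++ r })
      (edgeText (lits (encNat 0)) 6 (nm .c 0) (nm .c 0) ++
        edgeText (nm .c 0) 6 (nm .c 1) (lits (encNat 0))) =
      rawEdge (0, 6, S.c, S.c) ++ rawEdge (S.c, 6, S.c + 1, 0) := by
    simp [text_append, edgeText, text_lits, text_nm, rawEdge, Conf.stk, ones]
  rw [e₂] at h₂
  refine (h₁.seq (h₂.seq (h₃.seq (h₄.seq (h₅.seq
    ((does_pop_inp _ rfl).seq (does_flip _))))))).congr ?_ ?_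
  · simp [Conf.write, Conf.writeCl, weight_append]
    omega
  · have : k * (710 * (b + 1) ^ 2 + 1) ≤ b * (710 * (b + 1) ^ 2 + 1) :=
      Nat.mul_le_mul_right _ (by omega)
    simp [edgeText, lits, nm, encNat, bumpToks]
    nlinarith

/-- The code for the remaining blocks, up to the innermost subexpression. -/
def queryToks : Bool → List ℕ → ℕ → List Sym
  | _, [], _ => []
  | ex, k :: ks, m => bumpToks ++ blockToks ex k m ++ queryToks (!ex) ks (m + k)

/-- The code for the remaining blocks, after the innermost subexpression. -/
def queryClose : Bool → List ℕ → ℕ → List Sym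
  | _, [], _ => []
  | ex, k :: ks, m => queryClose (!ex) ks (m + k) ++ blockClose ex k m

/-- The final flag depends on the parity of the number of blocks. It is left unspecified because it
is discarded later. -/
theorem does_blockProg_loop {S : Conf} {b : ℕ} {ks : List ℕ} (h : S.Bdd b) (hs : S.s = 0)
    (hk : S.m + ks.sum ≤ b) (hc : S.c + ks.length ≤ b) {r : List SymOpt}
    (hS : S.inp = (encList encNat ks).map some ++ r) : ∃ f : Bool,
    Does (.loop .inp (isSym Sym.item) blockProg) S
      ({ (S.write (queryToks S.flag ks S.m)).writeCl (queryClose S.flag ks S.m) with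
        inp := some Sym.done :: r, m := S.m + ks.sum, c := S.c + ks.length, flag := f,
        g := S.g ++ (blockEdges S.c ks.length).flatMap rawEdge })
      (ks.length * (1000 * (b + 1) ^ 3 + 1) + 1) := by
  induction ks generalizing S with
  | nil =>
    refine ⟨S.flag, (does_loop_done ?_).congr ?_ (by omega)⟩
    · rw [Conf.stk, hS]
      rfl
    · obtain ⟨⟩ := S
      simp_all [Conf.write, Conf.writeCl, queryToks, queryClose, weight, encList, blockEdges]
  | cons k ks ih =>
    rw [List.sum_cons] at hk
    rw [List.length_cons] at hc
    have h₁ := does_blockProg h hs (k := k) (r := (encList encNat ks).map some ++ r) (by omega)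
      (by omega) (by rw [hS, encList]; simp)
    have hb : Conf.Bdd
        { (S.write (bumpToks ++ blockToks S.flag k S.m)).writeCl (blockClose S.flag k S.m) with
          inp := (encList encNat ks).map some ++ r, m := S.m + k, c := S.c + 1, flag := !S.flag,
          g := S.g ++ (rawEdge (0, 6, S.c, S.c) ++ rawEdge (S.c, 6, S.c + 1, 0)) } b := by
      obtain ⟨_, _, _, _, _, _, _⟩ := h
      constructor <;> dsimp only [Conf.write, Conf.writeCl] <;> first | assumption | omega
    obtain ⟨f, h₂⟩ := ih (S :=
      { (S.write (bumpToks ++ blockToks S.flag k S.m)).writeCl (blockClose S.flag k S.m) with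
        inp := (encList encNat ks).map some ++ r, m := S.m + k, c := S.c + 1, flag := !S.flag,
        g := S.g ++ (rawEdge (0, 6, S.c, S.c) ++ rawEdge (S.c, 6, S.c + 1, 0)) })
      hb
      (by dsimp only [Conf.write, Conf.writeCl]; exact hs) (by simp only; omega)
      (by simp only; omega) rfl
    refine ⟨f, (does_loop_step ?_ h₁ h₂).congr ?_ ?_⟩
    · rw [Conf.stk, hS, encList]
      rfl
    · simp [Conf.write, Conf.writeCl, queryToks, queryClose, weight_append, blockEdges]
      omega
    · rw [List.length_cons]
      ring_nf
      omega

/-- The code of `checkExpr`. -/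
def checkToks (m : ℕ) : List Sym :=
  [Sym.comp, Sym.star, Sym.plus, Sym.test] ++ encNat 0 ++ orToks m ++ [Sym.test] ++ encNat 1 ++ [Sym.neg] ++
    orToks m ++ [Sym.letter] ++ encNat 7

/-- Write the innermost subexpression. -/
def checkProg : Prog Stk SymOpt :=
  .seq (emitE (lits ([Sym.comp, Sym.star, Sym.plus, Sym.test] ++ encNat 0)))
  (.seq emitOr (.seq (emitE (lits ([Sym.test] ++ encNat 1 ++ [Sym.neg])))
  (.seq emitOr (emitE (lits ([Sym.letter] ++ encNat 7))))))

theorem does_checkProg {S : Conf} {b : ℕ} (h : S.Bdd b) (hs : S.s = 0) :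
    Does checkProg S (S.write (checkToks S.m)) (400 * (b + 1) ^ 2) := by
  refine Does.congr (Does.seq (does_emitE h (all_isCounter_lits _))
    (Does.seq (does_emitOr_write h hs _) (Does.seq (does_emitE_lits h _ _ (n := 10) ?_)
    (Does.seq (does_emitOr_write h hs _) (does_emitE_lits h _ _ (n := 10) ?_))))) ?_ ?_
  · simp [encNat]
  · simp [encNat]
  · simp [text_lits, checkToks]
  · simp [lits, encNat]
    nlinarith

end REWBEval

namespace REWBEval

open Prog

/-! ## The program computing the reduction: the graph -/

theorem rawEdge_mk (u : ℕ) (a : Fin 8) (d v : ℕ) :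
    rawEdge (u, a, d, v) = Sym.item :: (encNat u ++ (encNat a ++ (encNat d ++ encNat v))) := rfl

/-- Write the edges for an atom. -/
def atomProg : Prog Stk SymOpt :=
  .seq (.pop .inp)
  (.seq (emit .tmp .g (edgeText (lits (encNat 0)) 5 (lits (encNat 0)) (nm .c 0) ++
    edgeText (nm .c 0) 2 (nm .p 0) (nm .c 1) ++ edgeText (nm .c 1) 2 (nm .p 0) (nm .c 2) ++
    -- The tag `b + 4` is written as four ones, followed by the unary digits of `b` moved over from
    -- the input.
    (lits [Sym.item] ++ nm .c 2 ++ lits (encNat 2) ++ lits (List.replicate 4 Sym.one))))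
  (.seq (transfer .inp .g (isSym .one))
  (.seq (.pop .inp)
  (.seq (emit .tmp .g (lits (Sym.done :: encNat 0) ++
    edgeText (lits (encNat 0)) 3 (nm .p 0) (nm .c 3)))
  (.seq (.push .p (some .one))
  (.seq (.push .c (some .one)) (.seq (.push .c (some .one)) (.push .c (some .one)))))))))

theorem does_emit_g_of {S : Conf} {b n : ℕ} (h : S.Bdd b) {l : List (Item Stk)} {v : List Sym}
    (hl : l.all isCounter = true) (hv : text S.stk l = v) (hn : l.length ≤ n) :
    Does (emit .tmp .g l) S { S with g := S.g ++ v } ((5 * b + 2) * n + 1) :=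
  (does_emit_g h hl).congr (by rw [hv]) (by gcongr)

theorem does_atomProg {S : Conf} {b k : ℕ} (h : S.Bdd b) (hk : k ≤ b) {r : List SymOpt}
    (hS : S.inp = some .item :: (encNat k).map some ++ r) :
    Does atomProg S
      { S with
        inp := r, p := S.p + 1, c := S.c + 3,
        g := S.g ++ (rawEdge (0, 5, 0, S.c) ++ rawEdge (S.c, 2, S.p, S.c + 1) ++
          rawEdge (S.c + 1, 2, S.p, S.c + 2) ++ rawEdge (S.c + 2, 2, k + 4, 0) ++
          rawEdge (0, 3, S.p, S.c + 3)) }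
      (500 * (b + 1)) := by
  have h₁ := does_pop_inp S (a := some .item) (l := ones k ++ some .done :: r) (by rw [hS]; simp [encNat, ones])
  have h₂ := does_emit_g_of (S := { S with inp := ones k ++ some .done :: r }) (n := 50)
    ⟨h.m, h.c, h.p, h.s, h.t, h.tmp, h.out⟩
    (l := edgeText (lits (encNat 0)) 5 (lits (encNat 0)) (nm .c 0) ++
    edgeText (nm .c 0) 2 (nm .p 0) (nm .c 1) ++ edgeText (nm .c 1) 2 (nm .p 0) (nm .c 2) ++
    (lits [Sym.item] ++ nm .c 2 ++ lits (encNat 2) ++ lits (List.replicate 4 Sym.one)))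
    (v := rawEdge (0, 5, 0, S.c) ++ rawEdge (S.c, 2, S.p, S.c + 1) ++
      rawEdge (S.c + 1, 2, S.p, S.c + 2) ++
      (Sym.item :: encNat (S.c + 2) ++ encNat 2 ++ List.replicate 4 Sym.one))
    (by simp [edgeText, lits, nm, isCounter])
    (by simp [text_append, edgeText, text_lits, text_nm, rawEdge_mk, Conf.stk, ones])
    (by simp [edgeText, lits, nm, encNat])
  generalize hw : rawEdge (0, 5, 0, S.c) ++ rawEdge (S.c, 2, S.p, S.c + 1) ++
    rawEdge (S.c + 1, 2, S.p, S.c + 2) ++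
    (Sym.item :: encNat (S.c + 2) ++ encNat 2 ++ List.replicate 4 Sym.one) = w at h₂
  have h₃ := does_transfer_inp_g { S with inp := ones k ++ some .done :: r, g := S.g ++ w } rfl rfl
  have h₄ := does_pop_inp { S with
    inp := some .done :: r, g := S.g ++ w ++ List.replicate k Sym.one } rfl
  have h₅ := does_emit_g_of (n := 20)
    (S := { S with inp := r, g := S.g ++ w ++ List.replicate k Sym.one })
    ⟨h.m, h.c, h.p, h.s, h.t, h.tmp, h.out⟩
    (l := lits (Sym.done :: encNat 0) ++ edgeText (lits (encNat 0)) 3 (nm .p 0) (nm .c 3))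
    (v := Sym.done :: encNat 0 ++ rawEdge (0, 3, S.p, S.c + 3))
    (by simp [edgeText, lits, nm, isCounter])
    (by simp [text_append, edgeText, text_lits, text_nm, rawEdge_mk, Conf.stk, ones])
    (by simp [edgeText, lits, nm, encNat])
  refine (h₁.seq (h₂.seq (h₃.seq (h₄.seq (h₅.seq ((does_push_p _).seq
    ((does_push_c _).seq ((does_push_c _).seq (does_push_c _))))))))).congr ?_ ?_
  · have e : encNat (k + 4) = List.replicate 4 Sym.one ++ (List.replicate k Sym.one ++ [Sym.done]) := by
      rw [encNat, ← List.append_assoc, List.replicate_append_replicate, Nat.add_comm]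
    have e' : S.g ++ w ++ List.replicate k Sym.one ++
        (Sym.done :: encNat 0 ++ rawEdge (0, 3, S.p, S.c + 3)) =
        S.g ++ (rawEdge (0, 5, 0, S.c) ++ rawEdge (S.c, 2, S.p, S.c + 1) ++
          rawEdge (S.c + 1, 2, S.p, S.c + 2) ++ rawEdge (S.c + 2, 2, k + 4, 0) ++
          rawEdge (0, 3, S.p, S.c + 3)) := by
      rw [← hw, rawEdge_mk (S.c + 2), e]
      simp only [List.append_assoc, List.cons_append, List.nil_append]
      rfl
    exact congrArg (fun g => { S with inp := r, p := S.p + 1, c := S.c + 3, g := g }) e'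
  · ring_nf
    omega

theorem does_atomProg_loop {S : Conf} {b : ℕ} {bs : List ℕ} (h : S.Bdd b) (hb : ∀ k ∈ bs, k ≤ b)
    (hp : S.p + bs.length ≤ b) (hc : S.c + 3 * bs.length ≤ b) {r : List SymOpt}
    (hS : S.inp = (encList encNat bs).map some ++ r) :
    Does (.loop .inp (isSym .item) atomProg) S
      { S with
        inp := some .done :: r, p := S.p + bs.length, c := S.c + 3 * bs.length,
        g := S.g ++ (atomEdges S.c S.p bs).flatMap rawEdge }
      (bs.length * (500 * (b + 1) + 1) + 1) := by
  induction bs generalizing S with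
  | nil =>
    refine (does_loop_done ?_).congr ?_ (by omega)
    · rw [Conf.stk, hS]
      rfl
    · obtain ⟨⟩ := S
      simp_all [encList, atomEdges]
  | cons k bs ih =>
    rw [List.length_cons] at hp hc
    have h₁ := does_atomProg h (k := k) (hb _ (by simp)) (r := (encList encNat bs).map some ++ r)
      (by rw [hS, encList]; simp)
    have h₂ := ih (S := { S with
        inp := (encList encNat bs).map some ++ r, p := S.p + 1, c := S.c + 3,
        g := S.g ++ (rawEdge (0, 5, 0, S.c) ++ rawEdge (S.c, 2, S.p, S.c + 1) ++
          rawEdge (S.c + 1, 2, S.p, S.c + 2) ++ rawEdge (S.c + 2, 2, k + 4, 0) ++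
          rawEdge (0, 3, S.p, S.c + 3)) })
      ⟨h.m, by simp only; omega, by simp only; omega, h.s, h.t, h.tmp, h.out⟩
      (fun k hk => hb k (by simp [hk])) (by simp only; omega) (by simp only; omega) rfl
    refine (does_loop_step ?_ h₁ h₂).congr ?_ ?_
    · rw [Conf.stk, hS, encList]
      rfl
    · simp [atomEdges]
      omega
    · rw [List.length_cons]
      ring_nf
      omega

-- Traversing the formula with a stack of pending subformulas

/-- The code of a pending subformula. -/
def frame (pol : Bool) (s t : ℕ) : List Sym := cond pol Sym.one Sym.done :: (encNat s ++ encNat t)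

/-- The code of a pending subformula, where the nodes are given by texts. -/
def frameText (pol : Bool) (s t : List (Item Stk)) : List (Item Stk) :=
  lits [cond pol Sym.one Sym.done] ++ s ++ t

/-- Write the edge for an atom of the formula. -/
def leafProg (pol : Bool) : Prog Stk SymOpt :=
  .seq (.pop .inp)
  (.seq (emit .tmp .g (lits [Sym.item] ++ nm .s 0 ++ lits (encNat (cond pol 0 1))))
  (.seq (transfer .inp .g (isSym .one))
  (.seq (.pop .inp) (emit .tmp .g (lits [Sym.done] ++ nm .t 0)))))

/-- Process a negation. -/
def negProg (pol : Bool) : Prog Stk SymOpt :=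
  .seq (.pop .inp) (emit .tmp .fr (frameText (!pol) (nm .s 0) (nm .t 0)).reverse)

/-- Process a conjunction or disjunction that gives rise to a series composition. -/
def seriesProg (pol : Bool) : Prog Stk SymOpt :=
  .seq (.pop .inp)
  (.seq (emit .tmp .fr (frameText pol (nm .s 0) (nm .c 0) ++ frameText pol (nm .c 0) (nm .t 0)).reverse)
  (.push .c (some .one)))

/-- Process a conjunction or disjunction that gives rise to a parallel composition. -/
def parallelProg (pol : Bool) : Prog Stk SymOpt :=
  .seq (.pop .inp)
  (.seq (emit .tmp .fr (frameText pol (nm .s 0) (nm .t 0) ++ frameText pol (nm .s 0) (nm .t 0)).reverse)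
  (.push .c (some .one)))

/-- Process the root of a subformula. -/
def nodeProg (pol : Bool) : Prog Stk SymOpt :=
  .ite .inp (isSym .atom) (leafProg pol)
  (.ite .inp (isSym .neg) (negProg pol)
  (.ite .inp (isSym (cond pol Sym.conj Sym.disj)) (seriesProg pol) (parallelProg pol)))

/-- Take a subformula from the stack and process it with `q`. -/
def loadProg (q : Prog Stk SymOpt) : Prog Stk SymOpt :=
  .seq (.pop .fr)
  (.seq (transfer .fr .s (isSym .one))
  (.seq (.pop .fr)
  (.seq (transfer .fr .t (isSym .one))
  (.seq (.pop .fr)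
  (.seq q
  (.seq (drop .s Option.isSome) (drop .t Option.isSome)))))))

/-- Take a subformula from the stack and process its root. -/
def stepProg : Prog Stk SymOpt :=
  .ite .fr (isSym .one) (loadProg (nodeProg true)) (loadProg (nodeProg false))

theorem does_leafProg {S : Conf} {b k : ℕ} (h : S.Bdd b) (hk : k ≤ b) (pol : Bool)
    {r : List SymOpt} (hS : S.inp = some .atom :: (encNat k).map some ++ r) :
    Does (leafProg pol) S
      { S with inp := r, g := S.g ++ rawEdge (S.s, cond pol 0 1, k, S.t) } (80 * (b + 1)) := by
  have h₁ := does_pop_inp S (a := some .atom) (l := ones k ++ some .done :: r) (by rw [hS]; simp [encNat, ones])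
  have h₂ := does_emit_g_of (S := { S with inp := ones k ++ some .done :: r }) (n := 5)
    ⟨h.m, h.c, h.p, h.s, h.t, h.tmp, h.out⟩
    (l := lits [Sym.item] ++ nm .s 0 ++ lits (encNat (cond pol 0 1)))
    (v := Sym.item :: encNat S.s ++ encNat (cond pol 0 1))
    (by simp [lits, nm, isCounter])
    (by simp [text_append, text_lits, text_nm, Conf.stk, ones])
    (by cases pol <;> simp [lits, nm, encNat])
  generalize hw : Sym.item :: encNat S.s ++ encNat (cond pol 0 1) = w at h₂
  have h₃ := does_transfer_inp_g { S with inp := ones k ++ some .done :: r, g := S.g ++ w } rfl rfl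
  have h₄ := does_pop_inp { S with
    inp := some .done :: r, g := S.g ++ w ++ List.replicate k Sym.one } rfl
  have h₅ := does_emit_g_of (n := 3)
    (S := { S with inp := r, g := S.g ++ w ++ List.replicate k Sym.one })
    ⟨h.m, h.c, h.p, h.s, h.t, h.tmp, h.out⟩
    (l := lits [Sym.done] ++ nm .t 0) (v := Sym.done :: encNat S.t)
    (by simp [lits, nm, isCounter])
    (by simp [text_append, text_lits, text_nm, Conf.stk, ones])
    (by simp [lits, nm, encNat])
  refine (h₁.seq (h₂.seq (h₃.seq (h₄.seq h₅)))).congr ?_ ?_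
  · have e' : S.g ++ w ++ List.replicate k Sym.one ++ (Sym.done :: encNat S.t) =
        S.g ++ rawEdge (S.s, cond pol 0 1, k, S.t) := by
      have : ((cond pol 0 1 : Fin 8) : ℕ) = cond pol 0 1 := by cases pol <;> rfl
      rw [← hw, rawEdge_mk, this, encNat.eq_def k]
      simp only [List.append_assoc, List.cons_append, List.nil_append]
    exact congrArg (fun g => { S with inp := r, g := g }) e'
  · ring_nf
    omega

theorem does_emit_fr_of {S : Conf} {b n : ℕ} (h : S.Bdd b) {l : List (Item Stk)} {v : List Sym}
    (hl : l.all isCounter = true) (hv : text S.stk l = v) (hn : l.length ≤ n) :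
    Does (emit .tmp .fr l.reverse) S { S with fr := v ++ S.fr } ((5 * b + 2) * n + 1) :=
  (does_emit_fr h hl).congr (by rw [reverse_text_reverse, hv]) (by gcongr)

theorem does_negProg {S : Conf} {b : ℕ} (h : S.Bdd b) (pol : Bool) {a : SymOpt} {r : List SymOpt}
    (hS : S.inp = a :: r) :
    Does (negProg pol) S { S with inp := r, fr := frame (!pol) S.s S.t ++ S.fr }
      (80 * (b + 1)) := by
  have h₁ := does_pop_inp S hS
  have h₂ := does_emit_fr_of (n := 5) (S := { S with inp := r })
    ⟨h.m, h.c, h.p, h.s, h.t, h.tmp, h.out⟩ (l := frameText (!pol) (nm .s 0) (nm .t 0))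
    (v := frame (!pol) S.s S.t) (by simp [frameText, lits, nm, isCounter])
    (by simp [frameText, frame, text_append, text_lits, text_nm, Conf.stk, ones])
    (by simp [frameText, lits, nm, encNat])
  exact (h₁.seq h₂).mono (by ring_nf; omega)

theorem does_seriesProg {S : Conf} {b : ℕ} (h : S.Bdd b) (pol : Bool) {a : SymOpt}
    {r : List SymOpt} (hS : S.inp = a :: r) :
    Does (seriesProg pol) S
      { S with inp := r, c := S.c + 1, fr := frame pol S.s S.c ++ frame pol S.c S.t ++ S.fr }
      (80 * (b + 1)) := by
  have h₁ := does_pop_inp S hS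
  have h₂ := does_emit_fr_of (n := 10) (S := { S with inp := r })
    ⟨h.m, h.c, h.p, h.s, h.t, h.tmp, h.out⟩
    (l := frameText pol (nm .s 0) (nm .c 0) ++ frameText pol (nm .c 0) (nm .t 0))
    (v := frame pol S.s S.c ++ frame pol S.c S.t) (by simp [frameText, lits, nm, isCounter])
    (by simp [frameText, frame, text_append, text_lits, text_nm, Conf.stk, ones])
    (by simp [frameText, lits, nm, encNat])
  exact (h₁.seq (h₂.seq (does_push_c _))).mono (by ring_nf; omega)

theorem does_parallelProg {S : Conf} {b : ℕ} (h : S.Bdd b) (pol : Bool) {a : SymOpt}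
    {r : List SymOpt} (hS : S.inp = a :: r) :
    Does (parallelProg pol) S
      { S with inp := r, c := S.c + 1, fr := frame pol S.s S.t ++ frame pol S.s S.t ++ S.fr }
      (80 * (b + 1)) := by
  have h₁ := does_pop_inp S hS
  have h₂ := does_emit_fr_of (n := 10) (S := { S with inp := r })
    ⟨h.m, h.c, h.p, h.s, h.t, h.tmp, h.out⟩
    (l := frameText pol (nm .s 0) (nm .t 0) ++ frameText pol (nm .s 0) (nm .t 0))
    (v := frame pol S.s S.t ++ frame pol S.s S.t) (by simp [frameText, lits, nm, isCounter])
    (by simp [frameText, frame, text_append, text_lits, text_nm, Conf.stk, ones])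
    (by simp [frameText, lits, nm, encNat])
  exact (h₁.seq (h₂.seq (does_push_c _))).mono (by ring_nf; omega)

theorem does_ite_true {k : Stk} {c : Option SymOpt → Bool} {p q : Prog Stk SymOpt} {S S' : Conf}
    {t : ℕ} (hc : c (S.stk k).head? = true) (h : Does p S S' t) :
    Does (.ite k c p q) S S' (1 + t) := by
  refine does_ite ?_
  rwa [hc]

theorem does_ite_false {k : Stk} {c : Option SymOpt → Bool} {p q : Prog Stk SymOpt} {S S' : Conf}
    {t : ℕ} (hc : c (S.stk k).head? = false) (h : Does q S S' t) :
    Does (.ite k c p q) S S' (1 + t) := by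
  refine does_ite ?_
  rwa [hc]

theorem isSym_inp {S : Conf} {a b : Sym} {r : List SymOpt} (hS : S.inp = some a :: r) :
    isSym b (S.stk .inp).head? = decide (a = b) := by
  rw [Conf.stk, hS, List.head?_cons, isSym, Bool.eq_iff_iff]
  simp

/-- The program `q` must leave the endpoints on `s` and `t` in place, since they are erased only
afterwards and their length enters the cost. -/
theorem does_loadProg {S X : Conf} {b s t τ : ℕ} {q : Prog Stk SymOpt} {a : Sym} {fr : List Sym}
    (hfr : S.fr = a :: (encNat s ++ (encNat t ++ fr))) (hs : S.s = 0) (ht : S.t = 0) (hsb : s ≤ b)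
    (htb : t ≤ b) (h : Does q { S with fr := fr, s := s, t := t } X τ) (hXs : X.s = s)
    (hXt : X.t = t) : Does (loadProg q) S { X with s := 0, t := 0 } (τ + 8 * b + 7) := by
  have h₁ := does_pop_fr S hfr
  have h₂ := does_transfer_fr_s { S with fr := encNat s ++ (encNat t ++ fr) } rfl hs
  have h₃ := does_pop_fr { S with fr := Sym.done :: (encNat t ++ fr), s := s } rfl
  have h₄ := does_transfer_fr_t { S with fr := encNat t ++ fr, s := s } rfl ht
  have h₅ := does_pop_fr { S with fr := Sym.done :: fr, s := s, t := t } rfl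
  refine (h₁.seq (h₂.seq (h₃.seq (h₄.seq (h₅.seq (h.seq
    ((does_drop_s _).seq (does_drop_t _)))))))).congr rfl ?_
  simp only [hXs, hXt]
  omega

theorem does_stepProg {S X : Conf} {b s t τ : ℕ} {pol : Bool} {fr : List Sym}
    (hfr : S.fr = frame pol s t ++ fr) (hs : S.s = 0) (ht : S.t = 0) (hsb : s ≤ b)
    (htb : t ≤ b) (h : Does (nodeProg pol) { S with fr := fr, s := s, t := t } X τ)
    (hXs : X.s = s) (hXt : X.t = t) :
    Does stepProg S { X with s := 0, t := 0 } (τ + 8 * b + 8) := by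
  have hfr' : S.fr = cond pol Sym.one Sym.done :: (encNat s ++ (encNat t ++ fr)) := by
    rw [hfr, frame]
    simp
  have h' := does_loadProg hfr' hs ht hsb htb h hXs hXt
  cases pol with
  | true =>
    refine (does_ite_true ?_ h').mono (by omega)
    rw [Conf.stk, hfr']
    rfl
  | false =>
    refine (does_ite_false ?_ h').mono (by omega)
    rw [Conf.stk, hfr']
    rfl

/-- The number of nodes of the syntax tree of a formula. -/
def formSize {n : ℕ} : BForm n → ℕ
  | .atom _ => 1
  | .neg φ => formSize φ + 1
  | .conj φ ψ => formSize φ + formSize ψ + 1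
  | .disj φ ψ => formSize φ + formSize ψ + 1

theorem does_nodeProg_leaf {S : Conf} {b k : ℕ} (h : S.Bdd b) (hk : k ≤ b) (pol : Bool)
    {r : List SymOpt} (hS : S.inp = some .atom :: (encNat k).map some ++ r) :
    Does (nodeProg pol) S
      { S with inp := r, g := S.g ++ rawEdge (S.s, cond pol 0 1, k, S.t) } (80 * (b + 1) + 3) :=
  (does_ite_true ((isSym_inp hS).trans rfl) (does_leafProg h hk pol hS)).mono (by omega)

theorem does_nodeProg_neg {S : Conf} {b : ℕ} (h : S.Bdd b) (pol : Bool) {r : List SymOpt}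
    (hS : S.inp = some .neg :: r) :
    Does (nodeProg pol) S { S with inp := r, fr := frame (!pol) S.s S.t ++ S.fr }
      (80 * (b + 1) + 3) :=
  (does_ite_false ((isSym_inp hS).trans rfl) (does_ite_true ((isSym_inp hS).trans rfl)
    (does_negProg h pol hS))).mono (by omega)

theorem does_nodeProg_series {S : Conf} {b : ℕ} (h : S.Bdd b) (pol : Bool) {r : List SymOpt}
    (hS : S.inp = some (cond pol .conj .disj) :: r) :
    Does (nodeProg pol) S
      { S with inp := r, c := S.c + 1, fr := frame pol S.s S.c ++ frame pol S.c S.t ++ S.fr }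
      (80 * (b + 1) + 3) := by
  refine (does_ite_false ?_ (does_ite_false ?_ (does_ite_true ?_
    (does_seriesProg h pol hS)))).mono (by omega)
  all_goals
    rw [isSym_inp hS]
    cases pol <;> rfl

theorem does_nodeProg_parallel {S : Conf} {b : ℕ} (h : S.Bdd b) (pol : Bool) {r : List SymOpt}
    (hS : S.inp = some (cond pol .disj .conj) :: r) :
    Does (nodeProg pol) S
      { S with inp := r, c := S.c + 1, fr := frame pol S.s S.t ++ frame pol S.s S.t ++ S.fr }
      (80 * (b + 1) + 3) := by
  refine (does_ite_false ?_ (does_ite_false ?_ (does_ite_false ?_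
    (does_parallelProg h pol hS)))).mono (by omega)
  all_goals
    rw [isSym_inp hS]
    cases pol <;> rfl

/-- The loop processes the formula `φ`. -/
def Processes {n : ℕ} (b : ℕ) (φ : BForm n) : Prop :=
  -- Continuation form: any run of the loop from the point where `φ` has been consumed is extended
  -- backwards. The induction can then treat a left subformula while the frame of the right one
  -- waits below it.
  ∀ (S S' : Conf) (pol : Bool) (s t τ : ℕ) (fr : List Sym) (r : List SymOpt), S.Bdd b →
    S.c + formNodes φ ≤ b → S.s = 0 → S.t = 0 → s ≤ b → t ≤ b → S.fr = frame pol s t ++ fr →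
    S.inp = (encForm φ).map some ++ r →
    Does (.loop .fr Option.isSome stepProg)
      { S with
        inp := r, fr := fr, c := S.c + formNodes φ,
        g := S.g ++ (formEdges φ pol s t S.c).flatMap rawEdge } S' τ →
    Does (.loop .fr Option.isSome stepProg) S S' (formSize φ * (100 * (b + 1)) + τ)

theorem isSome_fr {S : Conf} {pol : Bool} {s t : ℕ} {fr : List Sym} (h : S.fr = frame pol s t ++ fr) :
    Option.isSome (S.stk .fr).head? = true := by
  rw [Conf.stk, h]
  rfl

/-- One step exchanges the frame for those of the two subformulas, and the two hypotheses are
chained through their continuations. With arbitrary endpoints this covers series and parallel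
connections alike. -/
theorem processes_bin {n b : ℕ} {φ ψ : BForm n} (ih₁ : Processes b φ) (ih₂ : Processes b ψ)
    {S S' : Conf} {pol : Bool} {s₁ t₁ s₂ t₂ τ τ₁ : ℕ} {fr : List Sym} {r : List SymOpt}
    (h : S.Bdd b) (hc : S.c + (formNodes φ + formNodes ψ + 1) ≤ b) (hs : S.s = 0) (ht : S.t = 0)
    (hs₁ : s₁ ≤ b) (ht₁ : t₁ ≤ b) (hs₂ : s₂ ≤ b) (ht₂ : t₂ ≤ b)
    (hfr : Option.isSome (S.stk .fr).head? = true)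
    (h₁ : Does stepProg S
      { S with
        inp := (encForm φ).map some ++ ((encForm ψ).map some ++ r), c := S.c + 1,
        fr := frame pol s₁ t₁ ++ frame pol s₂ t₂ ++ fr, s := 0, t := 0 } τ₁)
    (hτ : τ₁ < 100 * (b + 1))
    (h' : Does (.loop .fr Option.isSome stepProg)
      { S with
        inp := r, fr := fr, c := S.c + (formNodes φ + formNodes ψ + 1),
        g := S.g ++ (formEdges φ pol s₁ t₁ (S.c + 1) ++
          formEdges ψ pol s₂ t₂ (S.c + 1 + formNodes φ)).flatMap rawEdge } S' τ) :
    Does (.loop .fr Option.isSome stepProg) S S'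
      ((formSize φ + formSize ψ + 1) * (100 * (b + 1)) + τ) := by
  have hb := h.c
  refine (does_loop_step hfr h₁ (ih₁ _ _ pol s₁ t₁ _ (frame pol s₂ t₂ ++ fr) _
    ⟨h.m, by simp only; omega, h.p, Nat.zero_le _, Nat.zero_le _, h.tmp, h.out⟩ (by simp only; omega)
    rfl rfl hs₁ ht₁ (List.append_assoc _ _ _) rfl (ih₂ _ _ pol s₂ t₂ τ fr r
    ⟨h.m, by simp only; omega, h.p, Nat.zero_le _, Nat.zero_le _, h.tmp, h.out⟩ (by simp only; omega)
    rfl rfl hs₂ ht₂ rfl rfl ?_))).mono ?_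
  · convert h' using 2
    · simp
    · simp only
      omega
    · exact hs.symm
    · exact ht.symm
  · ring_nf at hτ ⊢
    omega

theorem processes {n b : ℕ} (hn : n ≤ b) (φ : BForm n) : Processes b φ := by
  induction φ with
  | atom p =>
    intro S S' pol s t τ fr r h hc hs ht hsb htb hfr hS h'
    have h₁ := does_nodeProg_leaf (S := { S with fr := fr, s := s, t := t })
      ⟨h.m, h.c, h.p, hsb, htb, h.tmp, h.out⟩ (k := p) (by omega) pol hS
    refine (does_loop_step (isSome_fr hfr) (does_stepProg hfr hs ht hsb htb h₁ rfl rfl)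
      (S'' := S') (t' := τ) ?_).mono ?_
    · convert h' using 2
      · simp [formEdges]
      · rfl
      · exact hs.symm
      · exact ht.symm
    · rw [formSize]
      omega
  | neg φ ih =>
    intro S S' pol s t τ fr r h hc hs ht hsb htb hfr hS h'
    have h₁ := does_nodeProg_neg (S := { S with fr := fr, s := s, t := t })
      ⟨h.m, h.c, h.p, hsb, htb, h.tmp, h.out⟩ pol hS
    refine (does_loop_step (isSome_fr hfr) (does_stepProg hfr hs ht hsb htb h₁ rfl rfl)
      (ih _ _ (!pol) s t τ fr r ⟨h.m, h.c, h.p, Nat.zero_le _, Nat.zero_le _, h.tmp, h.out⟩ hc rfl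
        rfl hsb htb rfl rfl ?_)).mono ?_
    · convert h' using 2
      · rfl
      · rfl
      · exact hs.symm
      · exact ht.symm
    · rw [formSize]
      ring_nf
      omega
  | conj φ ψ ih₁ ih₂ =>
    intro S S' pol s t τ fr r h hc hs ht hsb htb hfr hS h'
    have hin : S.inp = some .conj :: ((encForm φ).map some ++ ((encForm ψ).map some ++ r)) := by
      rw [hS, encForm]
      simp
    have hcb := h.c
    have hB : Conf.Bdd { S with fr := fr, s := s, t := t } b :=
      ⟨h.m, h.c, h.p, hsb, htb, h.tmp, h.out⟩
    cases pol with
    | true =>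
      exact processes_bin ih₁ ih₂ h hc hs ht hsb hcb hcb htb (isSome_fr hfr)
        (does_stepProg hfr hs ht hsb htb (does_nodeProg_series hB true hin) rfl rfl) (by omega) h'
    | false =>
      exact processes_bin ih₁ ih₂ h hc hs ht hsb htb hsb htb (isSome_fr hfr)
        (does_stepProg hfr hs ht hsb htb (does_nodeProg_parallel hB false hin) rfl rfl) (by omega) h'
  | disj φ ψ ih₁ ih₂ =>
    intro S S' pol s t τ fr r h hc hs ht hsb htb hfr hS h'
    have hin : S.inp = some .disj :: ((encForm φ).map some ++ ((encForm ψ).map some ++ r)) := by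
      rw [hS, encForm]
      simp
    have hcb := h.c
    have hB : Conf.Bdd { S with fr := fr, s := s, t := t } b :=
      ⟨h.m, h.c, h.p, hsb, htb, h.tmp, h.out⟩
    cases pol with
    | true =>
      exact processes_bin ih₁ ih₂ h hc hs ht hsb htb hsb htb (isSome_fr hfr)
        (does_stepProg hfr hs ht hsb htb (does_nodeProg_parallel hB true hin) rfl rfl) (by omega) h'
    | false =>
      exact processes_bin ih₁ ih₂ h hc hs ht hsb hcb hcb htb (isSome_fr hfr)
        (does_stepProg hfr hs ht hsb htb (does_nodeProg_series hB false hin) rfl rfl) (by omega) h'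

end REWBEval

namespace REWBEval

open Prog

/-! ## The program computing the reduction: the whole program -/

/-- Push a text to the output. -/
def pushOut : List Sym → Prog Stk SymOpt
  | [] => .skip
  | a :: l => .seq (pushOut l) (.push .out (some a))

theorem does_pushOut (l : List Sym) (S : Conf) :
    Does (pushOut l) S { S with out := l ++ S.out } (l.length + 1) := by
  induction l with
  | nil => exact does_skip S
  | cons a l ih => exact ih.seq (does_push_out _ a)

/-- The code of the valuation that is undefined on `m` variables. -/
def valToks : ℕ → List Sym
  | 0 => [Sym.done]
  | m + 1 => Sym.item :: Sym.done :: valToks m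

/-- The number is saved on `tmp` because it is needed again for the number of variables. -/
theorem does_valLoop {S : Conf} {m : ℕ} {l : List Sym} (hl : S.out = valToks m ++ l) :
    Does (.loop .m (isSym .one) (.seq (.move .m .tmp) (pushOut [Sym.item, Sym.done]))) S
      { S with m := 0, tmp := S.tmp + S.m, out := valToks (m + S.m) ++ l } (5 * S.m + 1) := by
  obtain ⟨k, hk⟩ : ∃ k, k = S.m := ⟨_, rfl⟩
  induction k generalizing S m with
  | zero =>
    refine (does_loop_done ?_).congr ?_ (by omega)
    · rw [Conf.stk, isSym_one_ones, ← hk]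
      rfl
    · obtain ⟨⟩ := S
      simp only at hk hl
      simp [← hk, hl]
  | succ k ih =>
    have h₁ := (does_move_m_tmp S hk.symm).seq (does_pushOut [Sym.item, Sym.done] _)
    have h₂ := ih (S := { S with
      m := k, tmp := S.tmp + 1, out := [Sym.item, Sym.done] ++ S.out }) (m := m + 1)
      (by rw [hl]; rfl) rfl
    refine (does_loop_step ?_ h₁ h₂).congr ?_ ?_
    · rw [Conf.stk, isSym_one_ones, ← hk]
      simp
    · have e₁ : S.tmp + 1 + k = S.tmp + S.m := by omega
      have e₂ : m + 1 + k = m + S.m := by omega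
      simp only [e₁, e₂]
    · simp only [List.length_cons, List.length_nil]
      omega

-- Assembling the output from its end

/-- Assemble the output. -/
def finishProg : Prog Stk SymOpt :=
  .seq (drop .inp Option.isSome)
  (.seq (drop .p Option.isSome)
  -- The last two numbers are the source 2 and the target 0 of the query.
  (.seq (pushOut (valToks 0 ++ (encNat 2 ++ encNat 0)))
  (.seq (.loop .m (isSym .one) (.seq (.move .m .tmp) (pushOut [Sym.item, Sym.done])))
  -- One entry more than there are atoms to choose, for `v 0`; below, the number of variables is
  -- increased by one for the same reason.
  (.seq (pushOut [Sym.item, Sym.done])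
  (.seq (transfer .e .out Option.isSome)
  (.seq (pushOut [Sym.done])
  (.seq (transfer .g .out Option.isSome)
  (.seq (pushOut [Sym.one, Sym.done])
  (.seq (transfer .tmp .out Option.isSome)
  (.seq (pushOut (Sym.done :: encNat 8))
  (transfer .c .out Option.isSome)))))))))))

/-- The configuration with empty stacks apart from the input and the output. -/
def ioConf (inp : List SymOpt) (out : List Sym) (pad : ℕ) : Conf :=
  ⟨inp, out, pad, [], [], [], 0, 0, 0, [], 0, 0, 0, false⟩

theorem does_finishProg_end (o g e : List Sym) (pad m c : ℕ) :
    Does (.seq (pushOut [Sym.item, Sym.done])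
      (.seq (transfer .e .out Option.isSome)
      (.seq (pushOut [Sym.done])
      (.seq (transfer .g .out Option.isSome)
      (.seq (pushOut [Sym.one, Sym.done])
      (.seq (transfer .tmp .out Option.isSome)
      (.seq (pushOut (Sym.done :: encNat 8))
      (transfer .c .out Option.isSome))))))))
      ⟨[], o, pad, g, e, [], 0, c, 0, [], 0, 0, m, false⟩
      (ioConf [] (encNat c ++ (encNat 8 ++ (encNat (m + 1) ++ (g ++ Sym.done :: (e ++
        Sym.item :: Sym.done :: o))))) pad)
      (2 * m + 2 * e.length + 2 * g.length + 2 * c + 50) := by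
  have h₁ : Does (pushOut [Sym.item, Sym.done]) ⟨[], o, pad, g, e, [], 0, c, 0, [], 0, 0, m, false⟩
    ⟨[], Sym.item :: Sym.done :: o, pad, g, e, [], 0, c, 0, [], 0, 0, m, false⟩ 3 := does_pushOut _ _
  generalize hu₁ : Sym.item :: Sym.done :: o = o₁ at h₁ ⊢
  have h₂ : Does (transfer .e .out Option.isSome)
    ⟨[], o₁, pad, g, e, [], 0, c, 0, [], 0, 0, m, false⟩
    ⟨[], e ++ o₁, pad, g, [], [], 0, c, 0, [], 0, 0, m, false⟩ (2 * e.length + 1) :=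
    does_transfer_e_out _
  generalize hu₂ : e ++ o₁ = o₂ at h₂ ⊢
  have h₃ : Does (pushOut [Sym.done]) ⟨[], o₂, pad, g, [], [], 0, c, 0, [], 0, 0, m, false⟩
    ⟨[], Sym.done :: o₂, pad, g, [], [], 0, c, 0, [], 0, 0, m, false⟩ 2 := does_pushOut _ _
  generalize hu₃ : Sym.done :: o₂ = o₃ at h₃ ⊢
  have h₄ : Does (transfer .g .out Option.isSome)
    ⟨[], o₃, pad, g, [], [], 0, c, 0, [], 0, 0, m, false⟩
    ⟨[], g ++ o₃, pad, [], [], [], 0, c, 0, [], 0, 0, m, false⟩ (2 * g.length + 1) :=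
    does_transfer_g_out _
  generalize hu₄ : g ++ o₃ = o₄ at h₄ ⊢
  have h₅ : Does (pushOut [Sym.one, Sym.done]) ⟨[], o₄, pad, [], [], [], 0, c, 0, [], 0, 0, m, false⟩
    ⟨[], [Sym.one, Sym.done] ++ o₄, pad, [], [], [], 0, c, 0, [], 0, 0, m, false⟩ 3 :=
    does_pushOut _ _
  generalize hu₅ : [Sym.one, Sym.done] ++ o₄ = o₅ at h₅
  have h₆ : Does (transfer .tmp .out Option.isSome)
    ⟨[], o₅, pad, [], [], [], 0, c, 0, [], 0, 0, m, false⟩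
    ⟨[], List.replicate m Sym.one ++ o₅, pad, [], [], [], 0, c, 0, [], 0, 0, 0, false⟩
    (2 * m + 1) := does_transfer_tmp_out _
  generalize hu₆ : List.replicate m Sym.one ++ o₅ = o₆ at h₆
  have h₇ : Does (pushOut (Sym.done :: encNat 8))
    ⟨[], o₆, pad, [], [], [], 0, c, 0, [], 0, 0, 0, false⟩
    ⟨[], Sym.done :: encNat 8 ++ o₆, pad, [], [], [], 0, c, 0, [], 0, 0, 0, false⟩ 11 :=
    does_pushOut _ _
  generalize hu₇ : Sym.done :: encNat 8 ++ o₆ = o₇ at h₇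
  have h₈ : Does (transfer .c .out Option.isSome)
    ⟨[], o₇, pad, [], [], [], 0, c, 0, [], 0, 0, 0, false⟩
    ⟨[], List.replicate c Sym.one ++ o₇, pad, [], [], [], 0, 0, 0, [], 0, 0, 0, false⟩
    (2 * c + 1) := does_transfer_c_out _
  refine Does.congr (Does.seq h₁ (Does.seq h₂ (Does.seq h₃ (Does.seq h₄ (Does.seq h₅
    (Does.seq h₆ (Does.seq h₇ h₈))))))) ?_ (by omega)
  have e₁ : encNat (m + 1) = List.replicate m Sym.one ++ [Sym.one, Sym.done] := by
    simp [encNat, List.replicate_succ']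
  have e₂ : List.replicate c Sym.one ++ o₇ = encNat c ++ (encNat 8 ++ (encNat (m + 1) ++ o₄)) := by
    rw [← hu₇, ← hu₆, ← hu₅, e₁, encNat.eq_def c]
    simp only [List.append_assoc, List.cons_append, List.nil_append]
  rw [e₂]
  rfl

theorem does_finishProg {S : Conf} {k : ℕ} (hinp : S.inp = List.replicate k none)
    (hout : S.out = []) (hcl : S.cl = []) (hfr : S.fr = []) (hs : S.s = 0) (ht : S.t = 0)
    (htmp : S.tmp = 0) (hflag : S.flag = false) :
    Does finishProg S
      (ioConf [] (encNat S.c ++ (encNat 8 ++ (encNat (S.m + 1) ++ (S.g ++ Sym.done :: (S.e ++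
        (valToks (S.m + 1) ++ (encNat 2 ++ encNat 0))))))) S.pad)
      (2 * k + 2 * S.p + 9 * S.m + 2 * S.e.length + 2 * S.g.length + 2 * S.c + 100) := by
  obtain ⟨inp, out, pad, g, e, cl, m, c, p, fr, s, t, tmp, flag⟩ := S
  simp only at *
  subst hinp hout hcl hfr hs ht htmp hflag
  unfold finishProg
  have h₁ : Does (drop .inp Option.isSome)
    ⟨List.replicate k none, [], pad, g, e, [], m, c, p, [], 0, 0, 0, false⟩
    ⟨[], [], pad, g, e, [], m, c, p, [], 0, 0, 0, false⟩ (2 * k + 1) :=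
    (does_drop_inp _ (c := Option.isSome) (l := List.replicate k none) (r := []) (by simp)
      (fun _ _ => rfl) rfl).mono (by simp)
  have h₂ : Does (drop .p Option.isSome) ⟨[], [], pad, g, e, [], m, c, p, [], 0, 0, 0, false⟩
    ⟨[], [], pad, g, e, [], m, c, 0, [], 0, 0, 0, false⟩ (2 * p + 1) := does_drop_p _
  have h₃ : Does (pushOut (valToks 0 ++ (encNat 2 ++ encNat 0)))
    ⟨[], [], pad, g, e, [], m, c, 0, [], 0, 0, 0, false⟩
    ⟨[], valToks 0 ++ (encNat 2 ++ encNat 0), pad, g, e, [], m, c, 0, [], 0, 0, 0, false⟩ 6 :=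
    (does_pushOut _ _).congr (by rw [List.append_nil]) le_rfl
  generalize encNat 2 ++ encNat 0 = o at h₃ ⊢
  have h₄ := does_valLoop (S := ⟨[], valToks 0 ++ o, pad, g, e, [], m, c, 0, [],
    0, 0, 0, false⟩) (m := 0) (l := o) rfl
  have h₅ := does_finishProg_end (valToks (0 + m) ++ o) g e pad m c
  rw [Nat.zero_add] at h₅
  simp only [Nat.zero_add] at h₄
  refine Does.congr (Does.seq h₁ (Does.seq h₂ (Does.seq h₃ (Does.seq h₄ h₅)))) rfl ?_
  omega

/-- A step pushes at most one symbol. The texts on the stacks are thus bounded by the time spent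
writing them, and their lengths need not be computed. -/
theorem Runs.length_le {K G : Type} [DecidableEq K] {p : Prog K G} {S S' : K → List G} {t : ℕ}
    (h : Runs p S S' t) (k : K) : (S' k).length ≤ (S k).length + t := by
  obtain ⟨t', ht, h⟩ := h
  refine le_trans ?_ (Nat.add_le_add_left ht _)
  clear ht
  induction h with
  | skip => omega
  | push S k' a =>
    by_cases hk : k = k'
    · subst hk
      simp
    · simp [hk]
  | pop S k' =>
    by_cases hk : k = k'
    · subst hk
      simp
      omega
    · simp [hk]
  | move S k' k'' hl =>
    by_cases hk : k = k''
    · subst hk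
      by_cases hk' : k = k'
      · subst hk'
        simp [hl]
      · simp [hk']
    · by_cases hk' : k = k'
      · subst hk'
        simp [hk, hl]
        omega
      · simp [hk, hk']
  | seq _ _ ih₁ ih₂ => omega
  | ite_true _ _ ih => omega
  | ite_false _ _ ih => omega
  | loop_done => omega
  | loop_step _ _ _ ih₁ ih₂ => omega

-- The stages of the program

/-- The code of `mainExpr`. -/
def exprToks (ks : List ℕ) : List Sym :=
  Sym.bind :: (encNat 6 ++ encNat 0) ++ queryToks true ks 0 ++ checkToks ks.sum ++
    queryClose true ks 0

/-- Write the expression and the edges for the blocks. -/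
def exprProg : Prog Stk SymOpt :=
  .seq (emit .tmp .g (lits (rawEdge (1, 7, 0, 0) ++ rawEdge (2, 6, 3, 0))))
  (.seq (.push .c (some .one)) (.seq (.push .c (some .one)) (.seq (.push .c (some .one))
  (.seq (emitE (lits (Sym.bind :: (encNat 6 ++ encNat 0))))
  (.seq flip
  (.seq (.loop .inp (isSym .item) blockProg)
  (.seq (.pop .inp)
  (.seq checkProg
  (.seq (transfer .cl .e Option.isSome) (drop .flag Option.isSome))))))))))

theorem does_exprProg {b : ℕ} {ks : List ℕ} (hk : ks.sum ≤ b) (hl : 3 + ks.length ≤ b)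
    (r : List SymOpt) :
    Does exprProg (ioConf ((encList encNat ks).map some ++ r) [] 0)
      ⟨r, [], weight (exprToks ks), rawEdge (1, 7, 0, 0) ++ rawEdge (2, 6, 3, 0) ++
        (blockEdges 3 ks.length).flatMap rawEdge, exprToks ks, [], ks.sum, 3 + ks.length, 0, [],
        0, 0, 0, false⟩ (5000 * (b + 1) ^ 4) := by
  unfold exprProg
  generalize hi : (encList encNat ks).map some ++ r = inp
  have h₁ : Does (emit .tmp .g (lits (rawEdge (1, 7, 0, 0) ++ rawEdge (2, 6, 3, 0))))
      (ioConf inp [] 0)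
      ⟨inp, [], 0, rawEdge (1, 7, 0, 0) ++ rawEdge (2, 6, 3, 0), [], [], 0, 0, 0, [], 0, 0, 0, false⟩
      ((5 * b + 2) * 30 + 1) :=
    does_emit_g_of (S := ioConf inp [] 0) ⟨Nat.zero_le _, Nat.zero_le _, Nat.zero_le _,
      Nat.zero_le _, Nat.zero_le _, rfl, rfl⟩ (all_isCounter_lits _) (text_lits _ _)
      (by simp [lits, rawEdge_mk, encNat])
  generalize rawEdge (1, 7, 0, 0) ++ rawEdge (2, 6, 3, 0) = g at h₁ ⊢
  have h₂ : ∀ c, Does (.push .c (some .one))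
      ⟨inp, [], 0, g, [], [], 0, c, 0, [], 0, 0, 0, false⟩
      ⟨inp, [], 0, g, [], [], 0, c + 1, 0, [], 0, 0, 0, false⟩ 1 := fun c => does_push_c _
  have h₃ : Does (emitE (lits (Sym.bind :: (encNat 6 ++ encNat 0))))
      ⟨inp, [], 0, g, [], [], 0, 3, 0, [], 0, 0, 0, false⟩
      ⟨inp, [], 2, g, Sym.bind :: (encNat 6 ++ encNat 0), [], 0, 3, 0, [], 0, 0, 0, false⟩
      ((5 * b + 4) * 9 + 2) := by
    refine (does_emitE (b := b) ⟨Nat.zero_le _, by simp only; omega, Nat.zero_le _,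
      Nat.zero_le _, Nat.zero_le _, rfl, rfl⟩ (all_isCounter_lits _)).congr ?_ ?_
    · rw [text_lits]
      simp [Conf.write, weight_cons, weight_append, weight_encNat, wt]
    · simp [lits, encNat]
  have hw : weight (exprToks ks) = 2 + weight (queryToks true ks 0) + weight (queryClose true ks 0) +
      weight (checkToks ks.sum) := by
    simp only [exprToks, weight_append, weight_cons, weight_encNat, wt]
    omega
  have he : exprToks ks = Sym.bind :: (encNat 6 ++ encNat 0) ++ queryToks true ks 0 ++
    checkToks ks.sum ++ queryClose true ks 0 := rfl
  generalize exprToks ks = E at hw he ⊢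
  generalize Sym.bind :: (encNat 6 ++ encNat 0) = e at h₃ he ⊢
  have h₄ := does_flip ⟨inp, [], 2, g, e, [], 0, 3, 0, [], 0, 0, 0, false⟩
  obtain ⟨f, h₅⟩ := does_blockProg_loop (S := ⟨inp, [], 2, g, e, [], 0, 3, 0, [], 0, 0, 0, true⟩)
    (b := b) (ks := ks) ⟨Nat.zero_le _, by simp only; omega, Nat.zero_le _, Nat.zero_le _,
      Nat.zero_le _, rfl, rfl⟩ rfl (by simpa using hk) hl hi.symm
  simp only [Conf.write, Conf.writeCl, Nat.zero_add, List.append_nil] at h₅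
  generalize queryToks true ks 0 = q at h₅ hw he
  generalize queryClose true ks 0 = cl at h₅ hw he
  generalize (blockEdges 3 ks.length).flatMap rawEdge = g' at h₅ ⊢
  have hcl := Runs.length_le h₅ .cl
  have h₆ := does_pop_inp ⟨some .done :: r, [], 2 + weight q + weight cl, g ++ g', e ++ q, cl,
    ks.sum, 3 + ks.length, 0, [], 0, 0, 0, f⟩ rfl
  have h₇ := does_checkProg (S := ⟨r, [], 2 + weight q + weight cl, g ++ g', e ++ q, cl,
    ks.sum, 3 + ks.length, 0, [], 0, 0, 0, f⟩) (b := b)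
    ⟨hk, hl, Nat.zero_le _, Nat.zero_le _, Nat.zero_le _, rfl, rfl⟩ rfl
  simp only [Conf.write, ← hw] at h₇
  have h₈ := does_transfer_cl_e ⟨r, [], 2 + weight q + weight cl + weight (checkToks ks.sum),
    g ++ g', e ++ q ++ checkToks ks.sum, cl, ks.sum, 3 + ks.length, 0, [], 0, 0, 0, f⟩
  have h₉ := does_drop_flag ⟨r, [], 2 + weight q + weight cl + weight (checkToks ks.sum),
    g ++ g', e ++ q ++ checkToks ks.sum ++ cl, [], ks.sum, 3 + ks.length, 0, [], 0, 0, 0, f⟩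
  rw [← he, ← hw] at h₉
  simp only [← he, ← hw] at h₈
  refine Does.congr (Does.seq h₁ (Does.seq (h₂ 0) (Does.seq (h₂ 1) (Does.seq (h₂ 2) (Does.seq h₃
    (Does.seq h₄ (Does.seq h₅ (Does.seq h₆ (Does.seq h₇ (Does.seq h₈ h₉)))))))))) rfl ?_
  simp only [Conf.stk, List.length_map, List.length_nil] at hcl
  have h₁₀ : ks.length * (1000 * (b + 1) ^ 3 + 1) ≤ b * (1000 * (b + 1) ^ 3 + 1) :=
    Nat.mul_le_mul_right _ (by omega)
  have h₁₁ : (b + 1) ^ 2 ≤ (b + 1) ^ 4 := Nat.pow_le_pow_right (by omega) (by norm_num)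
  have h₁₂ : b + 1 ≤ (b + 1) ^ 4 := Nat.le_self_pow (by norm_num) _
  have h₁₃ : b * (1000 * (b + 1) ^ 3 + 1) ≤ 1001 * (b + 1) ^ 4 := by
    have : 1 ≤ (b + 1) ^ 3 := Nat.one_le_pow _ _ (by omega)
    calc b * (1000 * (b + 1) ^ 3 + 1) ≤ (b + 1) * (1001 * (b + 1) ^ 3) :=
          Nat.mul_le_mul (by omega) (by omega)
      _ = _ := by ring
  omega

/-- Write the edges for the atoms. -/
def atomsProg : Prog Stk SymOpt :=
  -- The number of atoms is skipped; the list of blocks has one entry for each of them.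
  .seq (drop .inp (isSym .one))
  (.seq (.pop .inp)
  (.seq (emit .tmp .g (edgeText (lits (encNat 0)) 4 (lits (encNat 0)) (nm .c 0)))
  (.seq (.loop .inp (isSym .item) atomProg)
  (.seq (.pop .inp)
  (.seq (emit .tmp .g (edgeText (nm .c 0) 4 (lits (encNat 0)) (lits (encNat 0))))
  (.push .c (some .one)))))))

theorem does_atomsProg {b n : ℕ} {bs : List ℕ} (hn : n ≤ b) (hbs : ∀ x ∈ bs, x ≤ b) {c m : ℕ}
    (hm : m ≤ b) (hc : c + 3 * bs.length ≤ b) (r : List SymOpt) (pad : ℕ) (g e : List Sym) :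
    Does atomsProg
      ⟨(encNat n).map some ++ ((encList encNat bs).map some ++ r), [], pad, g, e, [], m, c, 0, [],
        0, 0, 0, false⟩
      ⟨r, [], pad, g ++ rawEdge (0, 4, 0, c) ++ (atomEdges c 0 bs).flatMap rawEdge ++
        rawEdge (c + 3 * bs.length, 4, 0, 0), e, [], m, c + 3 * bs.length + 1, bs.length, [],
        0, 0, 0, false⟩ (1000 * (b + 1) ^ 2) := by
  unfold atomsProg
  generalize hi : (encList encNat bs).map some ++ r = inp
  have h₁ : Does (drop .inp (isSym .one))
      ⟨(encNat n).map some ++ inp, [], pad, g, e, [], m, c, 0, [], 0, 0, 0, false⟩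
      ⟨some .done :: inp, [], pad, g, e, [], m, c, 0, [], 0, 0, 0, false⟩ (2 * n + 1) := by
    have := does_drop_inp ⟨(encNat n).map some ++ inp, [], pad, g, e, [], m, c, 0, [], 0, 0, 0,
      false⟩ (c := isSym .one) (l := ones n) (r := some .done :: inp) (by simp [encNat, ones])
      isSym_one_of_mem_ones rfl
    simpa only [ones, List.length_replicate] using this
  have h₂ := does_pop_inp ⟨some .done :: inp, [], pad, g, e, [], m, c, 0, [], 0, 0, 0, false⟩ rfl
  have h₃ := does_emit_g_of (n := 10) (S := ⟨inp, [], pad, g, e, [], m, c, 0, [], 0, 0, 0, false⟩)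
    (b := b) ⟨hm, by simp only; omega, Nat.zero_le _, Nat.zero_le _, Nat.zero_le _, rfl, rfl⟩
    (l := edgeText (lits (encNat 0)) 4 (lits (encNat 0)) (nm .c 0)) (v := rawEdge (0, 4, 0, c))
    (by simp [edgeText, lits, nm, isCounter])
    (by simp [text_append, edgeText, text_lits, text_nm, rawEdge_mk, Conf.stk, ones])
    (by simp [edgeText, lits, nm, encNat])
  have h₄ := does_atomProg_loop
    (S := ⟨inp, [], pad, g ++ rawEdge (0, 4, 0, c), e, [], m, c, 0, [], 0, 0, 0, false⟩) (b := b)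
    ⟨hm, by simp only; omega, Nat.zero_le _, Nat.zero_le _, Nat.zero_le _, rfl, rfl⟩ hbs
    (by simp only; omega) hc hi.symm
  simp only [Nat.zero_add] at h₄
  generalize g ++ rawEdge (0, 4, 0, c) = g' at h₃ h₄ ⊢
  generalize g' ++ (atomEdges c 0 bs).flatMap rawEdge = g'' at h₄ ⊢
  have h₅ := does_pop_inp ⟨some .done :: r, [], pad, g'', e, [], m, c + 3 * bs.length, bs.length, [],
    0, 0, 0, false⟩ rfl
  have h₆ := does_emit_g_of (n := 10)
    (S := ⟨r, [], pad, g'', e, [], m, c + 3 * bs.length, bs.length, [], 0, 0, 0, false⟩)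
    (b := b) ⟨hm, hc, by simp only; omega, Nat.zero_le _, Nat.zero_le _, rfl, rfl⟩
    (l := edgeText (nm .c 0) 4 (lits (encNat 0)) (lits (encNat 0)))
    (v := rawEdge (c + 3 * bs.length, 4, 0, 0))
    (by simp [edgeText, lits, nm, isCounter])
    (by simp [text_append, edgeText, text_lits, text_nm, rawEdge_mk, Conf.stk, ones])
    (by simp [edgeText, lits, nm, encNat])
  have h₇ := does_push_c ⟨r, [], pad, g'' ++ rawEdge (c + 3 * bs.length, 4, 0, 0), e, [], m,
    c + 3 * bs.length, bs.length, [], 0, 0, 0, false⟩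
  refine Does.congr (Does.seq h₁ (Does.seq h₂ (Does.seq h₃ (Does.seq h₄ (Does.seq h₅
    (Does.seq h₆ h₇)))))) rfl ?_
  have h₈ : bs.length * (500 * (b + 1) + 1) ≤ b * (500 * (b + 1) + 1) :=
    Nat.mul_le_mul_right _ (by omega)
  nlinarith

/-- Write the edges for the formula. -/
def formProg : Prog Stk SymOpt :=
  .seq (emit .tmp .fr (lits (frame true 0 1)).reverse) (.loop .fr Option.isSome stepProg)

theorem does_formProg {b n : ℕ} (hn : n ≤ b) {φ : BForm n} (hφ : formSize φ ≤ b) {c p m : ℕ}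
    (hm : m ≤ b) (hp : p ≤ b) (hc : c + formNodes φ ≤ b) (hb : 1 ≤ b) (r : List SymOpt) (pad : ℕ)
    (g e : List Sym) :
    Does formProg
      ⟨(encForm φ).map some ++ r, [], pad, g, e, [], m, c, p, [], 0, 0, 0, false⟩
      ⟨r, [], pad, g ++ (formEdges φ true 0 1 c).flatMap rawEdge, e, [], m, c + formNodes φ, p, [],
        0, 0, 0, false⟩ (200 * (b + 1) ^ 2) := by
  have h₁ := does_emit_fr_of (n := 4)
    (S := ⟨(encForm φ).map some ++ r, [], pad, g, e, [], m, c, p, [], 0, 0, 0, false⟩) (b := b)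
    ⟨hm, by simp only; omega, hp, Nat.zero_le _, Nat.zero_le _, rfl, rfl⟩
    (all_isCounter_lits (frame true 0 1)) (text_lits _ _) (by simp [lits, frame, encNat])
  simp only [List.append_nil] at h₁
  have h₂ := processes hn φ
    ⟨(encForm φ).map some ++ r, [], pad, g, e, [], m, c, p, frame true 0 1, 0, 0, 0, false⟩
    _ true 0 1 1 [] r ⟨hm, by simp only; omega, hp, Nat.zero_le _, Nat.zero_le _, rfl, rfl⟩ hc rfl
    rfl (Nat.zero_le _) hb (List.append_nil _).symm rfl (does_loop_done rfl)
  refine Does.congr (Does.seq h₁ h₂) rfl ?_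
  have h₈ : formSize φ * (100 * (b + 1)) ≤ b * (100 * (b + 1)) := Nat.mul_le_mul_right _ hφ
  nlinarith

/-- The program computing the reduction. -/
def mainProg : Prog Stk SymOpt :=
  .seq exprProg (.seq atomsProg (.seq formProg finishProg))

theorem does_mainProg {b n k : ℕ} {ks bs : List ℕ} {φ : BForm n} (hks : ks.sum ≤ b) (hn : n ≤ b)
    (hbs : ∀ x ∈ bs, x ≤ b) (hφ : formSize φ ≤ b) (hg : graphNodes ks.length bs φ ≤ b)
    (hk : k ≤ b) :
    Does mainProg
      (ioConf ((encList encNat ks).map some ++ ((encNat n).map some ++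
        ((encList encNat bs).map some ++ ((encForm φ).map some ++ List.replicate k none)))) [] 0)
      (ioConf [] (encNat (graphNodes ks.length bs φ) ++ (encNat 8 ++ (encNat (ks.sum + 1) ++
        ((graphEdges ks.length bs φ).flatMap rawEdge ++ Sym.done :: (exprToks ks ++
        (valToks (ks.sum + 1) ++ (encNat 2 ++ encNat 0))))))) (weight (exprToks ks)))
      (50000 * (b + 1) ^ 4) := by
  rw [graphNodes] at hg
  have h₁ := does_exprProg hks (by omega) ((encNat n).map some ++
    ((encList encNat bs).map some ++ ((encForm φ).map some ++ List.replicate k none)))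
  have h₂ := does_atomsProg (c := 3 + ks.length) hn hbs hks (by omega)
    ((encForm φ).map some ++ List.replicate k none) (weight (exprToks ks))
    (rawEdge (1, 7, 0, 0) ++ rawEdge (2, 6, 3, 0) ++ (blockEdges 3 ks.length).flatMap rawEdge)
    (exprToks ks)
  have h₃ := does_formProg (c := 3 + ks.length + 3 * bs.length + 1) (p := bs.length) hn hφ hks
    (by omega) hg (by omega) (List.replicate k none) (weight (exprToks ks))
    (rawEdge (1, 7, 0, 0) ++ rawEdge (2, 6, 3, 0) ++ (blockEdges 3 ks.length).flatMap rawEdge ++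
      rawEdge (0, 4, 0, 3 + ks.length) ++
      (atomEdges (3 + ks.length) 0 bs).flatMap rawEdge ++
      rawEdge (3 + ks.length + 3 * bs.length, 4, 0, 0)) (exprToks ks)
  have h₁₂₃ := Does.seq h₁ (Does.seq h₂ h₃)
  -- The last stage is linear in the lengths of the texts, and these are bounded by the time spent
  -- so far.
  have he := Runs.length_le h₁₂₃ .e
  have hg' := Runs.length_le h₁₂₃ .g
  have hG : rawEdge (1, 7, 0, 0) ++ rawEdge (2, 6, 3, 0) ++
      (blockEdges 3 ks.length).flatMap rawEdge ++ rawEdge (0, 4, 0, 3 + ks.length) ++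
      (atomEdges (3 + ks.length) 0 bs).flatMap rawEdge ++
      rawEdge (3 + ks.length + 3 * bs.length, 4, 0, 0) ++
      (formEdges φ true 0 1 (3 + ks.length + 3 * bs.length + 1)).flatMap rawEdge =
      (graphEdges ks.length bs φ).flatMap rawEdge := by
    simp [graphEdges]
  rw [hG] at h₃ hg'
  have h₄ := does_finishProg (S := ⟨List.replicate k none, [], weight (exprToks ks),
    (graphEdges ks.length bs φ).flatMap rawEdge, exprToks ks, [], ks.sum,
    graphNodes ks.length bs φ, bs.length, [], 0, 0, 0, false⟩) rfl rfl rfl rfl rfl rfl rfl rfl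
  refine Does.congr (Does.seq h₁ (Does.seq h₂ (Does.seq h₃ h₄))) rfl ?_
  simp only [Conf.stk, ioConf, List.length_reverse, List.length_map, List.length_nil] at he hg'
  have h₁₁ : (b + 1) ^ 2 ≤ (b + 1) ^ 4 := Nat.pow_le_pow_right (by omega) (by norm_num)
  have h₁₂ : b + 1 ≤ (b + 1) ^ 4 := Nat.le_self_pow (by norm_num) _
  simp only [graphNodes]
  omega

end REWBEval

namespace REWBEval

/-! ## Codes of expressions -/

theorem weight_encCond {v : ℕ} (c : Cond (Fin v)) : weight (encCond c) = c.size := by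
  induction c with
  | eq x => simp [encCond, weight_cons, weight_encNat, wt, Cond.size]
  | ne x => simp [encCond, weight_cons, weight_encNat, wt, Cond.size]
  | not c ih => simp [encCond, weight_cons, wt, Cond.size, ih, Nat.add_comm]
  | and c c' ih ih' =>
    simp [encCond, weight_cons, weight_append, wt, Cond.size, ih, ih', Nat.add_comm]
  | or c c' ih ih' =>
    simp [encCond, weight_cons, weight_append, wt, Cond.size, ih, ih', Nat.add_comm]

/-- Hence the extra symbols pushed while the expression is written represent the new parameter in
unary. -/
theorem weight_encExpr {m v : ℕ} (e : REWB (Fin m) (Fin v)) : weight (encExpr e) = e.size := by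
  induction e with
  | eps => rfl
  | letter a => simp [encExpr, weight_cons, weight_encNat, wt, REWB.size]
  | test a c =>
    simp [encExpr, weight_cons, weight_append, weight_encNat, wt, REWB.size, weight_encCond,
      Nat.add_comm]
  | plus r s ih ih' =>
    simp [encExpr, weight_cons, weight_append, wt, REWB.size, ih, ih', Nat.add_comm]
  | comp r s ih ih' =>
    simp [encExpr, weight_cons, weight_append, wt, REWB.size, ih, ih', Nat.add_comm]
  | star r ih => simp [encExpr, weight_cons, wt, REWB.size, ih, Nat.add_comm]
  | bind a x r ih =>
    simp [encExpr, weight_cons, weight_append, weight_encNat, wt, REWB.size, ih, Nat.add_comm]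

section Codes

variable {V K : ℕ} {v : ℕ → Fin V} (hv : ∀ i ≤ K, (v i : ℕ) = i)

include hv

theorem encCond_orCond {m : ℕ} (hm : m ≤ K) : encCond (orCond v m) = orToks m := by
  induction m with
  | zero => simp [orCond, encCond, orToks, hv 0 hm, encNat]
  | succ m ih => simp [orCond, encCond, orToks, hv (m + 1) hm, ih (by omega)]

theorem encExpr_checkExpr {m : ℕ} (hm : m ≤ K) : encExpr (checkExpr v m) = checkToks m := by
  simp [checkExpr, encExpr, encCond, checkToks, encCond_orCond hv hm]

theorem encExpr_exExpr {m : ℕ} (hm : m + 1 ≤ K) (r : REWB (Fin 8) (Fin V)) :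
    encExpr (exExpr v m r) = exToks m ++ encExpr r := by
  have h := encCond_orCond hv (m := m) (by omega)
  simp [exExpr, encExpr, encCond, exToks, h, hv (m + 1) hm, hv 0 (Nat.zero_le _)]

theorem encExpr_allExpr {m : ℕ} (hm : m + 1 ≤ K) (r : REWB (Fin 8) (Fin V)) :
    encExpr (allExpr v m r) = allToks m ++ encExpr r ++ allClose m := by
  have h := encCond_orCond hv (m := m) (by omega)
  simp [allExpr, encExpr, encCond, allToks, allClose, h, hv (m + 1) hm, hv 0 (Nat.zero_le _)]

theorem encExpr_blockExpr (ex : Bool) {k m : ℕ} (hm : m + k ≤ K) (r : REWB (Fin 8) (Fin V)) :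
    encExpr (blockExpr v ex k m r) = blockToks ex k m ++ encExpr r ++ blockClose ex k m := by
  induction k generalizing m with
  | zero => simp [blockExpr, blockToks, blockClose]
  | succ k ih =>
    have h := ih (m := m + 1) (by omega)
    cases ex with
    | true => simp [blockExpr, blockToks, blockClose, levToks, levClose,
        encExpr_exExpr hv (m := m) (by omega), h]
    | false => simp [blockExpr, blockToks, blockClose, levToks, levClose,
        encExpr_allExpr hv (m := m) (by omega), h]

theorem encExpr_queryExpr (ex : Bool) {ks : List ℕ} {m : ℕ} (hm : m + ks.sum ≤ K) :
    encExpr (queryExpr v ex ks m) =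
      queryToks ex ks m ++ checkToks (m + ks.sum) ++ queryClose ex ks m := by
  induction ks generalizing ex m with
  | nil => simp [queryExpr, queryToks, queryClose, encExpr_checkExpr hv (m := m) (by simpa using hm)]
  | cons k ks ih =>
    rw [List.sum_cons] at hm
    have h := ih (!ex) (m := m + k) (by omega)
    simp [queryExpr, queryToks, queryClose, encExpr, encCond, bumpToks, hv 0 (Nat.zero_le _), h,
      encExpr_blockExpr hv ex (k := k) (m := m) (by omega), Nat.add_assoc]

theorem encExpr_mainExpr {ks : List ℕ} (hm : ks.sum ≤ K) :
    encExpr (mainExpr v ks) = exprToks ks := by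
  have h := encExpr_queryExpr hv true (ks := ks) (m := 0) (by omega)
  simp [mainExpr, encExpr, exprToks, h, hv 0 (Nat.zero_le _)]

end Codes

/-! ## Size, free variables and nesting depth of the query -/

section QueryProperties

variable {X : Type} (v : ℕ → X)

theorem size_orCond (m : ℕ) : (orCond v m).size = 2 * m + 3 := by
  induction m with
  | zero => rfl
  | succ m ih =>
    simp only [orCond, Cond.size, ih]
    omega

theorem size_blockExpr_le (ex : Bool) {k m K : ℕ} (hm : m + k ≤ K) (r : REWB (Fin 8) X) :
    (blockExpr v ex k m r).size ≤ r.size + k * (2 * K + 40) := by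
  induction k generalizing m with
  | zero => simp [blockExpr]
  | succ k ih =>
    have h := ih (m := m + 1) (by omega)
    rw [Nat.succ_mul]
    cases ex <;> simp only [blockExpr, cond_true, cond_false, exExpr, allExpr, REWB.size, Cond.size,
      size_orCond] <;> omega

theorem size_queryExpr_le (ex : Bool) {ks : List ℕ} {m K : ℕ} (hm : m + ks.sum ≤ K) :
    (queryExpr v ex ks m).size ≤ ks.sum * (2 * K + 40) + 5 * ks.length + (4 * K + 20) := by
  induction ks generalizing ex m with
  | nil =>
    simp only [queryExpr, checkExpr, REWB.size, Cond.size, size_orCond]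
    simp at hm
    omega
  | cons k ks ih =>
    rw [List.sum_cons] at hm
    have h := ih (!ex) (m := m + k) (by omega)
    have h' := size_blockExpr_le v ex (k := k) (m := m) (K := K) (by omega)
      (queryExpr v (!ex) ks (m + k))
    simp only [queryExpr, REWB.size, Cond.size, List.sum_cons, List.length_cons, Nat.add_mul]
    omega

/-- Each of the `ks.sum` atoms contributes a bounded number of symbols and a single `orCond`, whose
size is linear in `ks.sum`. -/
theorem size_mainExpr_le (ks : List ℕ) :
    (mainExpr v ks).size ≤ 60 * (ks.length + ks.sum + 1) ^ 2 := by
  have h := size_queryExpr_le v true (ks := ks) (m := 0) (K := ks.sum) (by omega)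
  simp only [mainExpr, REWB.size]
  generalize ks.sum = s at h ⊢
  generalize ks.length = l at h ⊢
  nlinarith [Nat.zero_le (l * s), Nat.zero_le (l * l), Nat.zero_le (s * s)]

theorem vars_orCond {i m : ℕ} (hi : m ≤ i) : (orCond v m).vars ⊆ v '' Set.Iic i := by
  induction m with
  | zero =>
    have : v 0 ∈ v '' Set.Iic i := ⟨0, by simp, rfl⟩
    simpa [orCond, Cond.vars] using this
  | succ m ih =>
    have : v (m + 1) ∈ v '' Set.Iic i := ⟨m + 1, hi, rfl⟩
    simpa [orCond, Cond.vars, Set.insert_subset_iff, this] using ih (by omega)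

/-- The variables with index at most `m` are the ones bound outside; the binding of `v (m + 1)`
removes the only additional one. -/
theorem fv_blockExpr (ex : Bool) {k m : ℕ} {r : REWB (Fin 8) X}
    (hr : r.fv ⊆ v '' Set.Iic (m + k)) : (blockExpr v ex k m r).fv ⊆ v '' Set.Iic m := by
  induction k generalizing m with
  | zero => exact hr
  | succ k ih =>
    have h := ih (m := m + 1) (by rwa [Nat.add_right_comm])
    have h₀ : v 0 ∈ v '' Set.Iic m := ⟨0, by simp, rfl⟩
    have h₁ := vars_orCond v (le_refl m)
    have h₂ : (blockExpr v ex k (m + 1) r).fv \ {v (m + 1)} ⊆ v '' Set.Iic m := by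
      rintro x ⟨hx, hx'⟩
      obtain ⟨i, hi, rfl⟩ := h hx
      refine ⟨i, ?_, rfl⟩
      have : i ≠ m + 1 := by
        rintro rfl
        exact hx' rfl
      rw [Set.mem_Iic] at hi ⊢
      omega
    intro x hx
    cases ex <;> simp only [blockExpr, cond_true, cond_false, exExpr, allExpr, REWB.fv, Cond.vars,
      Set.mem_union, Set.mem_sdiff, Set.mem_singleton_iff, Set.mem_empty_iff_false, false_or,
      or_false] at hx
    · rcases hx with ⟨((hx | rfl) | hx) | hx, hx'⟩
      exacts [h₁ hx, h₀, h₂ ⟨hx, hx'⟩, absurd hx hx']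
    · rcases hx with ⟨hx | rfl | hx, hx'⟩
      exacts [h₁ hx, h₀, h₂ ⟨hx, hx'⟩]

theorem fv_queryExpr (ex : Bool) (ks : List ℕ) (m : ℕ) :
    (queryExpr v ex ks m).fv ⊆ v '' Set.Iic m := by
  induction ks generalizing ex m with
  | nil =>
    have h := vars_orCond v (le_refl m)
    simp [queryExpr, checkExpr, REWB.fv, Cond.vars, h]
  | cons k ks ih =>
    have h := fv_blockExpr v ex (ih (!ex) (m + k))
    have h₀ : v 0 ∈ v '' Set.Iic m := ⟨0, by simp, rfl⟩
    intro x hx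
    simp only [queryExpr, REWB.fv, Cond.vars] at hx
    rcases hx with rfl | hx
    exacts [h₀, h hx.1]

theorem fv_mainExpr (ks : List ℕ) : (mainExpr v ks).fv = ∅ := by
  refine Set.eq_empty_of_forall_notMem fun x hx => ?_
  obtain ⟨i, hi, rfl⟩ := fv_queryExpr v true ks 0 hx.1
  obtain rfl : i = 0 := by simpa using hi
  exact hx.2 rfl

-- Nesting depth

open REWB

theorem InE.mono {A : Type} {i j : ℕ} (hij : i ≤ j) {r : REWB A X} (h : InE i r) : InE j r := by
  induction hij with
  | refl => exact h
  | step _ ih => exact .ofF (.ofE ih)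

theorem inE_of_inF_zero {A : Type} {i : ℕ} {r : REWB A X} (h : InF 0 r) : InE (i + 1) r :=
  InE.mono (by omega) (.ofF h)

/-- An existential atom uses only letters, tests, compositions and a binding, under which every
level `E` is closed. -/
theorem inE_blockExpr_true {k m i : ℕ} {r : REWB (Fin 8) X} (h : InE (i + 1) r) :
    InE (i + 1) (blockExpr v true k m r) := by
  induction k generalizing m with
  | zero => exact h
  | succ k ih =>
    exact .comp (inE_of_inF_zero (.letter _)) (.bind _ _ (.comp (inE_of_inF_zero (.test _ _))
      (.comp (inE_of_inF_zero (.test _ _)) ih)))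

/-- The star lifts a member of `E i` to `F i`, and the composition with the surrounding letters
takes it to `E (i + 1)`; this happens once per atom. -/
theorem inE_blockExpr_false {k m i : ℕ} {r : REWB (Fin 8) X} (h : InE (i + 1) r) :
    InE (i + k + 1) (blockExpr v false k m r) := by
  induction k generalizing m with
  | zero => exact h
  | succ k ih =>
    refine .comp (inE_of_inF_zero (.letter _)) (.comp (.ofF (.star (.ofE (.bind _ _ (.comp
      (.plus (inE_of_inF_zero ?_) (.comp (inE_of_inF_zero (.letter _))
        (.comp (inE_of_inF_zero (.letter _)) ih))) (inE_of_inF_zero (.test _ _)))))))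
      (inE_of_inF_zero (.letter _)))
    exact .plus (.comp (.test _ _) (.letter _)) (.comp (.letter _) (.test _ _))

theorem universalWeight_cons (k : ℕ) (ks : List ℕ) :
    universalWeight (k :: ks) = universalWeight (0 :: ks) := by
  cases ks <;> rfl

/-- If a universal block comes next, a dummy weight 0 is put in front, so that `universalWeight`
counts the blocks of the right parity. -/
theorem inE_queryExpr (ks : List ℕ) : ∀ m,
    InE (universalWeight ks + 1) (queryExpr v true ks m) ∧
    InE (universalWeight (0 :: ks) + 1) (queryExpr v false ks m) := by
  induction ks with
  | nil =>
    intro m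
    have h : InE 1 (checkExpr v m) :=
      .ofF (.comp (.star (.plus (.test _ _) (.test _ _))) (.letter _))
    exact ⟨h, h⟩
  | cons k ks ih =>
    intro m
    constructor
    · rw [universalWeight_cons]
      exact .comp (inE_of_inF_zero (.test _ _)) (.bind _ _ (inE_blockExpr_true v (ih _).2))
    · rw [universalWeight, Nat.add_comm k]
      exact .comp (inE_of_inF_zero (.test _ _)) (.bind _ _ (inE_blockExpr_false v (ih _).1))

theorem inE_mainExpr (ks : List ℕ) : InE (1 + universalWeight ks) (mainExpr v ks) := by
  rw [Nat.add_comm]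
  exact .bind _ _ (inE_queryExpr v ks 0).1

end QueryProperties

end REWBEval

namespace REWBEval

open Prog

/-! ## The reduction -/

/-- Edges end in the range of `f`, so a path that starts there never leaves it. This carries the
analysis on the nodes `ℕ` over to `Fin N`. -/
theorem isDataPath_of_embedding {V W A D : Type} {E : Set (V × A × D × V)} {E' : Set (W × A × D × W)}
    {f : W → V} (hf : ∀ u ∈ E, u.2.2.2 ∈ Set.range f)
    (hE : ∀ u a d v, (u, a, d, v) ∈ E' ↔ (f u, a, d, f v) ∈ E) (hinj : Function.Injective f)
    (w : List (A × D)) (u v : W) : IsDataPath E' u w v ↔ IsDataPath E (f u) w (f v) := by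
  induction w generalizing u with
  | nil => exact hinj.eq_iff.symm
  | cons a w ih =>
    constructor
    · rintro ⟨u', h, h'⟩
      exact ⟨f u', (hE _ _ _ _).1 h, (ih _).1 h'⟩
    · rintro ⟨x, h, h'⟩
      obtain ⟨u', rfl⟩ := hf _ h
      exact ⟨u', (hE _ _ _ _).2 h, (ih _).2 h'⟩

instance graphNodes_neZero {n : ℕ} (l : ℕ) (bs : List ℕ) (φ : BForm n) :
    NeZero (graphNodes l bs φ) :=
  ⟨by rw [graphNodes]; omega⟩

theorem lt_graphNodes {n l : ℕ} {bs : List ℕ} {φ : BForm n} {e : ℕ × Fin 8 × ℕ × ℕ}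
    (he : e ∈ graphEdges l bs φ) :
    e.1 < graphNodes l bs φ ∧ e.2.2.2 < graphNodes l bs φ := by
  rw [graphEdges, List.mem_cons, List.mem_cons, List.mem_append, List.mem_cons, List.mem_append,
    List.mem_cons, mem_blockEdges, mem_atomEdges] at he
  rw [graphNodes]
  rcases he with rfl | rfl | ⟨j, hj, rfl | rfl⟩ | rfl | ⟨j, b, hj, he⟩ | rfl | he
  · simp only; omega
  · simp only; omega
  · simp only; omega
  · simp only; omega
  · simp only; omega
  · obtain ⟨hj, -⟩ := List.getElem?_eq_some_iff.1 hj
    rcases he with rfl | rfl | rfl | rfl | rfl <;> simp only <;> omega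
  · simp only; omega
  · obtain ⟨h, h'⟩ := node_of_mem_formEdges (u := e.1) (a := e.2.1) (d := e.2.2.1) (v := e.2.2.2) he
    omega

/-- An edge, with nodes in `Fin N`. -/
def finEdge (N : ℕ) [NeZero N] (e : ℕ × Fin 8 × ℕ × ℕ) : Fin N × Fin 8 × ℕ × Fin N :=
  (Fin.ofNat N e.1, e.2.1, e.2.2.1, Fin.ofNat N e.2.2.2)

/-- All nodes lie below `N`, so `Fin.ofNat` reduces nothing and the written code is the one of the
graph on `ℕ`. -/
theorem encList_finEdge {N : ℕ} [NeZero N] {L : List (ℕ × Fin 8 × ℕ × ℕ)}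
    (hL : ∀ e ∈ L, e.1 < N ∧ e.2.2.2 < N) :
    encList encEdge (L.map (finEdge N)) = L.flatMap rawEdge ++ [Sym.done] := by
  induction L with
  | nil => rfl
  | cons e L ih =>
    have h := hL e (by simp)
    rw [List.map_cons, encList, ih fun e he => hL e (by simp [he])]
    simp [encEdge, finEdge, rawEdge, Nat.mod_eq_of_lt h.1, Nat.mod_eq_of_lt h.2]

theorem mem_map_finEdge {N : ℕ} [NeZero N] {L : List (ℕ × Fin 8 × ℕ × ℕ)}
    (hL : ∀ e ∈ L, e.1 < N ∧ e.2.2.2 < N) {u v : Fin N} {a : Fin 8} {d : ℕ} :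
    (u, a, d, v) ∈ L.map (finEdge N) ↔ ((u : ℕ), a, d, (v : ℕ)) ∈ L := by
  rw [List.mem_map]
  constructor
  · rintro ⟨e, he, h⟩
    have h' := hL e he
    simp only [finEdge, Prod.mk.injEq] at h
    obtain ⟨rfl, rfl, rfl, rfl⟩ := h
    simpa [Nat.mod_eq_of_lt h'.1, Nat.mod_eq_of_lt h'.2] using he
  · intro h
    exact ⟨_, h, by simp [finEdge]⟩

theorem encList_encOption_ofFn (m : ℕ) :
    encList encOption (List.ofFn fun _ : Fin m => (none : Option ℕ)) = valToks m := by
  induction m with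
  | zero => rfl
  | succ m ih =>
    rw [List.ofFn_succ, encList, ih]
    rfl

theorem encList_ofFn {α : Type} (f : α → List Sym) {n : ℕ} (g : Fin n → α) {β : Type}
    (h : α → β) (f' : β → List Sym) (hf : ∀ a, f' (h a) = f a) :
    encList f (List.ofFn g) = encList f' (List.ofFn fun i => h (g i)) := by
  induction n with
  | zero => rfl
  | succ n ih => rw [List.ofFn_succ, List.ofFn_succ, encList, encList, hf, ih]

/-- The blocks of the atoms. -/
def WQSatInstance.blocks (I : WQSatInstance) : List ℕ := List.ofFn fun p => (I.block p : ℕ)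

/-- The number of nodes of the data graph of an instance. -/
def WQSatInstance.nodes (I : WQSatInstance) : ℕ := graphNodes I.weights.length I.blocks I.form

instance (I : WQSatInstance) : NeZero I.nodes := graphNodes_neZero _ _ _

/-- The query for given weights. -/
def query (ks : List ℕ) : REWB (Fin 8) (Fin (ks.sum + 1)) := mainExpr (Fin.ofNat (ks.sum + 1)) ks

/-- The instance of query evaluation for an instance of weighted quantified satisfiability. -/
def reduction (I : WQSatInstance) : EvalInstance where
  numNodes := I.nodes
  numLetters := 8
  numVars := I.weights.sum + 1
  edges := (graphEdges I.weights.length I.blocks I.form).map (finEdge I.nodes)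
  expr := query I.weights
  val _ := none
  compatible x hx := by
    rw [query, fv_mainExpr] at hx
    exact hx.elim
  src := Fin.ofNat I.nodes 2
  tgt := Fin.ofNat I.nodes 0

theorem reduction_holds (I : WQSatInstance) : I.Holds ↔ (reduction I).Holds := by
  have hbs : ∀ i b : ℕ, I.blocks[i]? = some b ↔ ∃ p : Fin I.n, (p : ℕ) = i ∧ (I.block p : ℕ) = b := by
    intro i b
    simp only [WQSatInstance.blocks, List.getElem?_ofFn, Option.dite_none_right_eq_some,
      Option.some.injEq]
    exact ⟨fun ⟨h, h'⟩ => ⟨⟨i, h⟩, rfl, h'⟩, fun ⟨p, hp, hb⟩ => ⟨hp ▸ p.2, by subst hp; exact hb⟩⟩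
  -- `Fin.ofNat` is injective on the indices that fit into the number of variables.
  have hv : ∀ i j, i ≤ I.weights.sum → j ≤ I.weights.sum →
      Fin.ofNat (I.weights.sum + 1) i = Fin.ofNat (I.weights.sum + 1) j → i = j := by
    intro i j hi hj h
    have := congrArg Fin.val h
    simpa [Nat.mod_eq_of_lt (Nat.lt_succ_of_le hi), Nat.mod_eq_of_lt (Nat.lt_succ_of_le hj)]
      using this
  have h := reach_mainExpr (φ := I.form) hv hbs le_rfl le_rfl fun _ => none
  refine h.symm.trans ?_
  have hN : 2 < I.nodes := by
    rw [WQSatInstance.nodes, graphNodes]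
    omega
  have key : ∀ w, IsDataPath {t | t ∈ (reduction I).edges} (reduction I).src w (reduction I).tgt ↔
      IsDataPath {e | e ∈ graphEdges I.weights.length I.blocks I.form} 2 w 0 := by
    intro w
    have := isDataPath_of_embedding (E := {e | e ∈ graphEdges I.weights.length I.blocks I.form})
      (E' := {t | t ∈ (reduction I).edges}) (f := Fin.val)
      (fun e he => ⟨⟨e.2.2.2, (lt_graphNodes he).2⟩, rfl⟩)
      (fun u a d v => mem_map_finEdge fun e he => lt_graphNodes he) Fin.val_injective w
      (reduction I).src (reduction I).tgt
    have h₂ : ((reduction I).src : ℕ) = 2 := Nat.mod_eq_of_lt hN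
    have h₀ : ((reduction I).tgt : ℕ) = 0 := Nat.zero_mod _
    rwa [h₂, h₀] at this
  exact exists_congr fun w => and_congr Iff.rfl (key w).symm

theorem enc_reduction (I : WQSatInstance) :
    (reduction I).enc = encNat (graphNodes I.weights.length I.blocks I.form) ++ (encNat 8 ++
      (encNat (I.weights.sum + 1) ++ ((graphEdges I.weights.length I.blocks I.form).flatMap rawEdge ++
        Sym.done :: (exprToks I.weights ++ (valToks (I.weights.sum + 1) ++
          (encNat 2 ++ encNat 0)))))) := by
  have h₁ : encList encEdge (reduction I).edges = _ :=
    encList_finEdge (N := I.nodes) fun e he => lt_graphNodes he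
  have h₂ : encExpr (reduction I).expr = exprToks I.weights :=
    encExpr_mainExpr (fun i hi => Nat.mod_eq_of_lt (Nat.lt_succ_of_le hi)) le_rfl
  have h₃ : encList encOption (List.ofFn (reduction I).val) = valToks (I.weights.sum + 1) :=
    encList_encOption_ofFn _
  have h₄ : ((reduction I).src : ℕ) = 2 := Nat.mod_eq_of_lt (by
    rw [WQSatInstance.nodes, graphNodes]
    omega)
  have h₅ : ((reduction I).tgt : ℕ) = 0 := Nat.zero_mod _
  rw [EvalInstance.enc, h₁, h₂, h₃, h₄, h₅, List.append_assoc]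
  rfl

-- Bounds in terms of the length of the input code

theorem length_encNat (n : ℕ) : (encNat n).length = n + 1 := by simp [encNat]

theorem sum_le_length_encList (l : List ℕ) : l.length + l.sum ≤ (encList encNat l).length := by
  induction l with
  | nil => simp
  | cons a l ih =>
    rw [encList]
    simp [length_encNat]
    omega

theorem formSize_le {n : ℕ} (φ : BForm n) : formSize φ ≤ (encForm φ).length := by
  induction φ with
  | atom p => simp [formSize, encForm]
  | neg φ ih => simpa [formSize, encForm] using ih
  | conj φ ψ ih ih' => simp [formSize, encForm]; omega
  | disj φ ψ ih ih' => simp [formSize, encForm]; omega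

theorem formNodes_le {n : ℕ} (φ : BForm n) : formNodes φ ≤ formSize φ := by
  induction φ with
  | atom p => simp [formSize, formNodes]
  | neg φ ih => rw [formSize, formNodes]; omega
  | conj φ ψ ih ih' => rw [formSize, formNodes]; omega
  | disj φ ψ ih ih' => rw [formSize, formNodes]; omega

/-- The code of an instance of weighted quantified satisfiability. -/
def inputCode (I : WQSatInstance) : List SymOpt :=
  I.enc.map some ++ List.replicate (I.weights.length + I.weights.sum) none

theorem does_mainProg_reduction (I : WQSatInstance) :
    Does mainProg (ioConf (inputCode I) [] 0)
      (ioConf [] (reduction I).enc (reduction I).expr.size)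
      (50000 * (4 * (inputCode I).length + 5) ^ 4) := by
  have hc : inputCode I = (encList encNat I.weights).map some ++ ((encNat I.n).map some ++
      ((encList encNat I.blocks).map some ++ ((encForm I.form).map some ++
        List.replicate (I.weights.length + I.weights.sum) none))) := by
    rw [WQSatInstance.blocks, ← encList_ofFn (fun j : Fin I.weights.length => encNat j) I.block
      (fun j => (j : ℕ)) encNat fun _ => rfl]
    simp only [inputCode, WQSatInstance.enc, List.map_append, List.append_assoc]
  have hlen := congrArg List.length hc
  simp only [List.length_append, List.length_map, List.length_replicate, length_encNat] at hlen
  have hw : (reduction I).expr.size = weight (exprToks I.weights) := by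
    rw [← encExpr_mainExpr (v := Fin.ofNat (I.weights.sum + 1)) (K := I.weights.sum)
      (fun i hi => Nat.mod_eq_of_lt (Nat.lt_succ_of_le hi)) le_rfl, weight_encExpr]
    rfl
  have h₁ := sum_le_length_encList I.weights
  have h₂ := formSize_le I.form
  have h₃ := formNodes_le I.form
  have h₄ : I.blocks.length = I.n := by simp [WQSatInstance.blocks]
  have hb : ∀ x ∈ I.blocks, x ≤ 4 * (inputCode I).length + 4 := by
    intro x hx
    obtain ⟨p, rfl⟩ := (List.mem_ofFn' _ _).1 hx
    have := (I.block p).2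
    change (I.block p : ℕ) ≤ _
    omega
  -- The number of nodes is `4 + l + 3 * n + formNodes φ`, and `l`, `n` and `formNodes φ` are
  -- bounded by the lengths of different parts of the code.
  have h := does_mainProg (b := 4 * (inputCode I).length + 4) (n := I.n)
    (k := I.weights.length + I.weights.sum) (ks := I.weights) (bs := I.blocks) (φ := I.form)
    (by omega) (by omega) hb (by omega) (by rw [graphNodes]; omega) (by omega)
  rw [← hc, ← enc_reduction, ← hw] at h
  exact h

end REWBEval

namespace REWBEval

open Prog

-- Polynomial time and hardness

/-- The machine computing the reduction. -/
noncomputable def reductionMachine : TM2ComputableAux SymOpt SymOpt where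
  tm := mainProg.machine .inp .out
  inputAlphabet := Equiv.refl _
  outputAlphabet := Equiv.refl _

theorem stk_ioConf_inp (l : List SymOpt) :
    (ioConf l [] 0).stk = Function.update (fun _ => []) Stk.inp l := by
  funext k
  cases k <;> simp [ioConf, Conf.stk, ones]

theorem stk_ioConf_out (l : List Sym) (n : ℕ) :
    (ioConf [] l n).stk = Function.update (fun _ => []) Stk.out
      (l.map some ++ List.replicate n none) := by
  funext k
  cases k <;> simp [ioConf, Conf.stk, ones]

theorem reductionMachine_outputs (I : WQSatInstance) :
    ∃ t ≤ 50000 * (4 * (wqSat.code I).length + 5) ^ 4 + 1,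
    Nonempty (TM2OutputsInTime reductionMachine.tm
      ((wqSat.code I).map reductionMachine.inputAlphabet.invFun)
      (some ((rewbEval.code (reduction I)).map reductionMachine.outputAlphabet.invFun)) t) := by
  obtain ⟨t, ht, h⟩ := does_mainProg_reduction I
  rw [stk_ioConf_inp, stk_ioConf_out] at h
  refine ⟨t + 1, by exact Nat.succ_le_succ ht, ?_⟩
  have h' := machine_outputs h
  have e₁ : (wqSat.code I).map reductionMachine.inputAlphabet.invFun = inputCode I :=
    List.map_id _
  have e₂ : (rewbEval.code (reduction I)).map reductionMachine.outputAlphabet.invFun =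
      (reduction I).enc.map some ++ List.replicate (reduction I).expr.size none := List.map_id _
  rw [e₁, e₂]
  exact h'

theorem TM2OutputsInTime.nonempty_mono {tm : FinTM2} {l : List (tm.Γ tm.k₀)}
    {l' : Option (List (tm.Γ tm.k₁))} {t t' : ℕ} (h : Nonempty (TM2OutputsInTime tm l l' t))
    (ht : t ≤ t') : Nonempty (TM2OutputsInTime tm l l' t') := by
  obtain ⟨h⟩ := h
  exact ⟨⟨h.toEvalsTo, h.steps_le_m.trans ht⟩⟩

theorem reduction_polyTime :
    Nonempty (TM2ComputableInPolyTime wqSat.code rewbEval.code reduction) := by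
  refine ⟨⟨reductionMachine, 50000 * (4 * Polynomial.X + 5) ^ 4 + 1, fun I => Nonempty.some ?_⟩⟩
  obtain ⟨t, ht, h⟩ := reductionMachine_outputs I
  refine TM2OutputsInTime.nonempty_mono h (ht.trans (le_of_eq ?_))
  simp

theorem primrec_param : Primrec fun n => 60 * (n + 1) ^ 2 :=
  (Primrec.nat_mul.comp (Primrec.const 60) (Primrec.nat_mul.comp Primrec.succ Primrec.succ)).of_eq
    fun n => by rw [sq]

theorem primrec_time : Primrec fun n => 100000 * (4 * n + 5) ^ 4 := by
  have h : Primrec fun n => 4 * n + 5 :=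
    Primrec.nat_add.comp (Primrec.nat_mul.comp (Primrec.const 4) Primrec.id) (Primrec.const 5)
  have h₂ : Primrec fun n => (4 * n + 5) * (4 * n + 5) := Primrec.nat_mul.comp h h
  exact (Primrec.nat_mul.comp (Primrec.const 100000) (Primrec.nat_mul.comp h₂ h₂)).of_eq
    fun n => by ring

/-- With `Y = (x + 1) ^ (c + 1)`, both times and lengths are at most `Y` times a number that depends
on the parameter only, and the fourth power respects this factorisation. The exponent is `c + 1` so
that `Y` dominates `x + 1` even if `c = 0`. -/
theorem composed_time_le {x k f B c T L t : ℕ} (hT : T = f * (x + 1) ^ c)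
    (hL : L ≤ x + k + B * T) (ht : t ≤ 50000 * (4 * L + 5) ^ 4 + 1) :
    T + 2 * L + 2 + t ≤
      100000 * (4 * (k + 2 + (B + 1) * f) + 5) ^ 4 * (x + 1) ^ ((c + 1) * 4) := by
  rw [pow_mul]
  have h₁ : (x + 1) ^ c ≤ (x + 1) ^ (c + 1) := Nat.pow_le_pow_right (by omega) (by omega)
  have h₂ : x + 1 ≤ (x + 1) ^ (c + 1) := Nat.le_self_pow (by omega) _
  generalize (x + 1) ^ (c + 1) = Y at h₁ h₂ ⊢
  have h₃ : (B + 1) * T ≤ (B + 1) * f * Y := by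
    rw [hT, Nat.mul_assoc]
    gcongr
  have h₄ : k ≤ k * Y := Nat.le_mul_of_pos_right _ (by omega)
  have h₅ : L + T ≤ (k + 2 + (B + 1) * f) * Y := by
    linarith [Nat.zero_le Y]
  generalize k + 2 + (B + 1) * f = A at h₅ ⊢
  have h₆ : (4 * L + 5) ^ 4 ≤ ((4 * A + 5) * Y) ^ 4 := by
    gcongr
    linarith
  have h₇ : (4 * A + 5) * Y ≤ ((4 * A + 5) * Y) ^ 4 := Nat.le_self_pow (by omega) _
  have h₈ : T + 2 * L + 3 ≤ (4 * A + 5) * Y := by linarith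
  rw [mul_assoc, ← mul_pow]
  omega

/-- The given reduction is followed by `reductionMachine`, whose explicit polynomial bound is
evaluated at the length of the intermediate word. -/
theorem FPTReducible.to_rewbEval {P : ParamProblem} (h : FPTReducible P wqSat) :
    FPTReducible P rewbEval := by
  obtain ⟨R, hR, ⟨g, hg, hgR⟩, M, f, c, hf, hM⟩ := h
  obtain ⟨M', hM'⟩ := exists_comp (B := Option Sym) M reductionMachine
  obtain ⟨B, hB⟩ := exists_length_le M.tm
  refine ⟨fun i => reduction (R i), fun i => (hR i).trans (reduction_holds (R i)),
    ⟨fun k => 60 * (g k + 1) ^ 2, ?_, fun i => ?_⟩,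
    M', fun k => 100000 * (4 * (k + 2 + (B + 1) * f k) + 5) ^ 4, (c + 1) * 4, ?_, fun i => ?_⟩
  · exact primrec_param.to_comp.comp hg
  · refine (size_mainExpr_le _ _).trans ?_
    have := hgR i
    change (R i).weights.length + (R i).weights.sum ≤ g (P.param i) at this
    exact Nat.mul_le_mul_left _ (Nat.pow_le_pow_left (Nat.succ_le_succ this) 2)
  · exact primrec_time.to_comp.comp (Primrec.nat_add.to_comp.comp
      (Primrec.nat_add.to_comp.comp Computable.id (Computable.const 2))
      (Primrec.nat_mul.to_comp.comp (Computable.const (B + 1)) hf))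
  · obtain ⟨t, ht, h⟩ := reductionMachine_outputs (R i)
    refine TM2OutputsInTime.nonempty_mono (hM' _ _ _ _ _ (hM i) h) (composed_time_le rfl ?_ ht)
    have hL := hB _ _ _ (hM i)
    rw [List.length_map, List.length_map] at hL
    refine hL.trans (le_of_eq ?_)
    simp [ParamProblem.code]

end REWBEval

theorem mainTheorem6 :
    REWBEval.FPTHard REWBEval.AWSat REWBEval.rewbEval ∧
    ∃ R : REWBEval.WQSatInstance → REWBEval.EvalInstance,
      Nonempty (Turing.TM2ComputableInPolyTime
        REWBEval.wqSat.code REWBEval.rewbEval.code R) ∧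
      (∀ I, I.Holds ↔ (R I).Holds) ∧
      (∀ I, (R I).expr.fv = ∅) ∧
      (∀ I, REWBEval.REWB.InE (1 + REWBEval.universalWeight I.weights) (R I).expr) ∧
      ∃ s : List ℕ → ℕ, ∀ I, (R I).expr.size = s I.weights :=
  ⟨fun _ hP => REWBEval.FPTReducible.to_rewbEval hP, REWBEval.reduction,
    REWBEval.reduction_polyTime, REWBEval.reduction_holds, fun _ => REWBEval.fv_mainExpr _ _,
    -- The expression of `reduction I` is `query I.weights`, so its size is a function of the
    -- weights by definition.
    fun _ => REWBEval.inE_mainExpr _ _, fun ks => (REWBEval.query ks).size, fun _ => rfl⟩
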